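/- Consider the following two decision problems. (i) $\mathsf{NFA}\subseteq\mathsf{UCFG}$: given a finite alphabet $\Sigma$, a nondeterministic finite automaton $A$ over $\Sigma$ and an unambiguous context-free grammar $G$ with set of terminal symbols $\Sigma$, decide whether $L(A)\subseteq L(G)$. (ii) $\mathsf{UUCFG}$ (universality of unambiguous context-free grammars): given a finite alphabet $\Sigma$ and an unambiguous context-free grammar $G$ with set of terminal symbols $\Sigma$, decide whether $L(G)=\Sigma^*$. Here a context-free grammar $G$ is unambiguous if every word $w\in L(G)$ has exactly one derivation tree (rooted at the starting nonterminal). In both problems the alphabet is part of the input, and the unambiguity of $G$ is a promise on the input: only inputs with an unambiguous grammar are instances. Theorem. The problems $\mathsf{NFA}\subseteq\mathsf{UCFG}$ and $\mathsf{UUCFG}$ are inter-reducible in polynomial time: there are a polynomial-time computable function that maps every instance $(\Sigma,A,G)$ of (i) to an instance $(\Sigma',G')$ of (ii) with $L(A)\subseteq L(G)\iff L(G')=\Sigma'^*$, and a polynomial-time computable function that maps every instance $(\Sigma,G)$ of (ii) to an instance $(\Sigma'',A'',G'')$ of (i) with $L(G)=\Sigma^*\iff L(A'')\subseteq L(G'')$.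 -/

import Mathlib

/-! ## Derivation trees and unambiguity of context-free grammars -/

namespace ContextFreeGrammar

universe u

/-- `g.Forest s` is the type of ordered forests of derivation trees of `g` whose roots are labelled,
from left to right, by the symbols in `s`. A root labelled by a terminal is a leaf. A root labelled
by a nonterminal `X` carries a production `X → α` of `g` and its children form a forest with roots
labelled by `α`. Productions enter only through membership in the set of rules, so two forests are
equal exactly when they are equal as labelled ordered forests. -/
inductive Forest {T : Type u} (g : ContextFreeGrammar T) : List (Symbol T g.NT) → Type u
  | nil : Forest g []
  | leaf (a : T) {s : List (Symbol T g.NT)} (rest : Forest g s) :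
      Forest g (Symbol.terminal a :: s)
  | node (X : g.NT) (α : List (Symbol T g.NT))
      (h : (⟨X, α⟩ : ContextFreeRule T g.NT) ∈ g.rules) (children : Forest g α)
      {s : List (Symbol T g.NT)} (rest : Forest g s) :
      Forest g (Symbol.nonterminal X :: s)

/-- The word formed by the terminal labels of the leaves, read from left to right. -/
def Forest.yield {T : Type u} {g : ContextFreeGrammar T} :
    {s : List (Symbol T g.NT)} → g.Forest s → List T
  | _, .nil => []
  | _, .leaf a rest => a :: rest.yield
  | _, .node _ _ _ children rest => children.yield ++ rest.yield

/-- A derivation tree of `g`: a forest with a single root, labelled by the initial nonterminal. -/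
abbrev DerivationTree {T : Type u} (g : ContextFreeGrammar T) : Type u :=
  g.Forest [Symbol.nonterminal g.initial]

/-- A grammar is unambiguous if every accepted word has exactly one derivation tree. -/
def Unambiguous {T : Type u} (g : ContextFreeGrammar T) : Prop :=
  ∀ w ∈ g.language, ∃! t : g.DerivationTree, t.yield = w

theorem Forest.derives {T : Type u} {g : ContextFreeGrammar T} {s : List (Symbol T g.NT)}
    (F : g.Forest s) : g.Derives s (F.yield.map Symbol.terminal) := by
  induction F with
  | nil => exact Relation.ReflTransGen.refl
  | leaf a rest ih =>
    simpa [Forest.yield] using ih.append_left [Symbol.terminal a]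
  | @node X α h children s rest ih₁ ih₂ =>
    have h₁ : g.Produces (Symbol.nonterminal X :: s) (α ++ s) :=
      ⟨⟨X, α⟩, h, ContextFreeRule.Rewrites.head s⟩
    have h₂ := ih₁.append_right s
    have h₃ := ih₂.append_left (children.yield.map Symbol.terminal)
    simpa [Forest.yield] using h₁.single.trans (h₂.trans h₃)

theorem Forest.exists_split {T : Type u} {g : ContextFreeGrammar T} :
    ∀ (p : List (Symbol T g.NT)) {q : List (Symbol T g.NT)} (F : g.Forest (p ++ q)),
      ∃ (F₁ : g.Forest p) (F₂ : g.Forest q), F.yield = F₁.yield ++ F₂.yield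
  | [], _, F => ⟨.nil, F, rfl⟩
  | Symbol.terminal a :: p, _, .leaf _ rest => by
    obtain ⟨F₁, F₂, h⟩ := Forest.exists_split p rest
    exact ⟨.leaf a F₁, F₂, by simp [Forest.yield, h]⟩
  | Symbol.nonterminal X :: p, _, .node _ α hr children rest => by
    obtain ⟨F₁, F₂, h⟩ := Forest.exists_split p rest
    exact ⟨.node X α hr children F₁, F₂, by simp [Forest.yield, h]⟩

theorem Forest.exists_append {T : Type u} {g : ContextFreeGrammar T}
    {p q : List (Symbol T g.NT)} (F₁ : g.Forest p) (F₂ : g.Forest q) :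
    ∃ F : g.Forest (p ++ q), F.yield = F₁.yield ++ F₂.yield := by
  induction F₁ with
  | nil => exact ⟨F₂, rfl⟩
  | leaf a rest ih =>
    obtain ⟨F, h⟩ := ih
    exact ⟨.leaf a F, by simp [Forest.yield, h]⟩
  | node X α hr children rest _ ih =>
    obtain ⟨F, h⟩ := ih
    exact ⟨.node X α hr children F, by simp [Forest.yield, h]⟩

theorem Forest.exists_of_derives {T : Type u} {g : ContextFreeGrammar T}
    {s : List (Symbol T g.NT)} {w : List T} (h : g.Derives s (w.map Symbol.terminal)) :
    ∃ F : g.Forest s, F.yield = w := by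
  induction h using Relation.ReflTransGen.head_induction_on with
  | refl =>
    induction w with
    | nil => exact ⟨.nil, rfl⟩
    | cons a w ih =>
      obtain ⟨F, hF⟩ := ih
      exact ⟨.leaf a F, by simp [Forest.yield, hF]⟩
  | head h _ ih =>
    obtain ⟨F, hF⟩ := ih
    obtain ⟨r, hr, hrw⟩ := h
    obtain ⟨p, q, rfl, rfl⟩ := hrw.exists_parts
    obtain ⟨F₁₂, F₃, h₁⟩ := Forest.exists_split _ F
    obtain ⟨F₁, F₂, h₂⟩ := Forest.exists_split _ F₁₂
    obtain ⟨F', h₃⟩ := Forest.exists_append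
      (Forest.exists_append F₁ (.node r.input r.output hr F₂ .nil)).choose F₃
    refine ⟨F', ?_⟩
    rw [h₃, (Forest.exists_append F₁ (.node r.input r.output hr F₂ .nil)).choose_spec, ← hF, h₁, h₂]
    simp [Forest.yield]

/-- A word belongs to the language of `g` exactly when some derivation tree yields it. -/
theorem mem_language_iff_exists_tree {T : Type u} (g : ContextFreeGrammar T) (w : List T) :
    w ∈ g.language ↔ ∃ t : g.DerivationTree, t.yield = w :=
  ⟨fun h => Forest.exists_of_derives h, fun ⟨t, ht⟩ => ht ▸ t.derives⟩

end ContextFreeGrammar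

namespace InclusionProblems

/-! ## Decision problems and polynomial-time reductions -/

/-- A decision problem: a type of admissible instances, a faithful binary encoding of the
instances, and the set of instances with answer `yes`. Conditions that an input is promised to
satisfy (such as unambiguity of a grammar) are part of the type of instances. -/
structure DecisionProblem where
  /-- The admissible instances. -/
  Instance : Type
  /-- The binary encoding of instances. -/
  encode : Instance → List Bool
  /-- Different instances have different encodings. -/
  encode_injective : Function.Injective encode
  /-- The instances with a positive answer. -/
  Yes : Instance → Prop

/-- `P` reduces to `Q` in polynomial time (many-one): some function computed by a polynomial-time
Turing machine maps instances of `P` to instances of `Q` and preserves the answer. -/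
def PolyTimeReducible (P Q : DecisionProblem) : Prop :=
  ∃ f : P.Instance → Q.Instance,
    Nonempty (Turing.TM2ComputableInPolyTime P.encode Q.encode f) ∧ ∀ x, P.Yes x ↔ Q.Yes (f x)

/-- `P` and `Q` are inter-reducible in polynomial time. -/
def PolyTimeInterreducible (P Q : DecisionProblem) : Prop :=
  PolyTimeReducible P Q ∧ PolyTimeReducible Q P

/-! ## Self-delimiting binary encodings -/

/-- `enc` is self-delimiting: in a word starting with an encoding, both the encoded object and the
remainder of the word are determined. -/
def SelfDelimiting {α : Type*} (enc : α → List Bool) : Prop :=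
  ∀ x y u v, enc x ++ u = enc y ++ v → x = y ∧ u = v

theorem SelfDelimiting.injective {α : Type*} {enc : α → List Bool} (h : SelfDelimiting enc) :
    Function.Injective enc :=
  fun x y hxy => (h x y [] [] (by rw [hxy])).1

/-- Unary encoding of numbers, ended by `false`. It is only used for the cardinalities of the
finite sets (alphabet, states, nonterminals) that are part of an input and for the elements of these
sets, so that encodings have the usual size up to a polynomial. -/
def encodeNat (n : ℕ) : List Bool :=
  List.replicate n true ++ [false]

/-- An element of a finite set is encoded through its index. -/
def encodeFin {n : ℕ} (i : Fin n) : List Bool :=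
  encodeNat i

/-- A list is encoded by the encodings of its elements, each preceded by `true`, and a final
`false`. -/
def encodeList {α : Type*} (enc : α → List Bool) : List α → List Bool
  | [] => [false]
  | x :: l => true :: (enc x ++ encodeList enc l)

theorem encodeNat_selfDelimiting : SelfDelimiting encodeNat := by
  intro x
  induction x with
  | zero =>
    intro y u v h
    cases y <;> simp_all [encodeNat, List.replicate_succ]
  | succ x ih =>
    intro y u v h
    cases y with
    | zero => simp_all [encodeNat, List.replicate_succ]
    | succ y =>
      have h' : encodeNat x ++ u = encodeNat y ++ v := by
        simpa [encodeNat, List.replicate_succ] using h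
      exact ⟨by rw [(ih y u v h').1], (ih y u v h').2⟩

theorem encodeFin_selfDelimiting (n : ℕ) : SelfDelimiting (encodeFin (n := n)) := by
  intro x y u v h
  have h' := encodeNat_selfDelimiting _ _ _ _ h
  exact ⟨Fin.ext h'.1, h'.2⟩

theorem encodeList_selfDelimiting {α : Type*} {enc : α → List Bool} (he : SelfDelimiting enc) :
    SelfDelimiting (encodeList enc) := by
  intro x
  induction x with
  | nil =>
    intro y u v h
    cases y <;> simp_all [encodeList]
  | cons a x ih =>
    intro y u v h
    cases y with
    | nil => simp_all [encodeList]
    | cons b y =>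
      simp only [encodeList, List.cons_append, List.append_assoc, List.cons.injEq, true_and] at h
      obtain ⟨rfl, h₁⟩ := he _ _ _ _ h
      obtain ⟨rfl, h₂⟩ := ih _ _ _ h₁
      exact ⟨rfl, h₂⟩

/-! ## Finite automata as inputs -/

/-- A finite presentation of a nondeterministic finite automaton over the alphabet
`{0, …, k - 1}` with states `{0, …, numStates - 1}`; the sets of initial states, accepting states
and transitions are given by lists. A transition `(p, a, q)` leads from `p` to `q` reading `a`. -/
@[ext]
structure FiniteNFA (k : ℕ) where
  /-- The number of states. -/
  numStates : ℕ
  /-- The initial states. -/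
  start : List (Fin numStates)
  /-- The accepting states. -/
  accept : List (Fin numStates)
  /-- The transitions. -/
  trans : List (Fin numStates × Fin k × Fin numStates)

/-- The automaton that is presented. -/
def FiniteNFA.toNFA {k : ℕ} (A : FiniteNFA k) : NFA (Fin k) (Fin A.numStates) where
  step p a := {q | (p, a, q) ∈ A.trans}
  start := {q | q ∈ A.start}
  accept := {q | q ∈ A.accept}

/-- Encoding of a transition. -/
def encodeTransition {n k : ℕ} (t : Fin n × Fin k × Fin n) : List Bool :=
  encodeFin t.1 ++ (encodeFin t.2.1 ++ encodeFin t.2.2)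

/-- Encoding of a finite automaton. -/
def FiniteNFA.encode {k : ℕ} (A : FiniteNFA k) : List Bool :=
  encodeNat A.numStates ++ (encodeList encodeFin A.start ++
    (encodeList encodeFin A.accept ++ encodeList encodeTransition A.trans))

theorem encodeTransition_selfDelimiting (n k : ℕ) :
    SelfDelimiting (encodeTransition (n := n) (k := k)) := by
  rintro ⟨p, a, q⟩ ⟨p', a', q'⟩ u v h
  simp only [encodeTransition, List.append_assoc] at h
  obtain ⟨rfl, h1⟩ := encodeFin_selfDelimiting _ _ _ _ _ h
  obtain ⟨rfl, h2⟩ := encodeFin_selfDelimiting _ _ _ _ _ h1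
  obtain ⟨rfl, h3⟩ := encodeFin_selfDelimiting _ _ _ _ _ h2
  exact ⟨rfl, h3⟩

theorem FiniteNFA.encode_selfDelimiting (k : ℕ) : SelfDelimiting (FiniteNFA.encode (k := k)) := by
  rintro ⟨n, s, f, t⟩ ⟨n', s', f', t'⟩ u v h
  simp only [FiniteNFA.encode, List.append_assoc] at h
  obtain ⟨rfl, h1⟩ := encodeNat_selfDelimiting _ _ _ _ h
  obtain ⟨rfl, h2⟩ := encodeList_selfDelimiting (encodeFin_selfDelimiting _) _ _ _ _ h1
  obtain ⟨rfl, h3⟩ := encodeList_selfDelimiting (encodeFin_selfDelimiting _) _ _ _ _ h2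
  obtain ⟨rfl, h4⟩ := encodeList_selfDelimiting (encodeTransition_selfDelimiting _ _) _ _ _ _ h3
  exact ⟨rfl, h4⟩

/-! ## Context-free grammars as inputs -/

/-- A finite presentation of a context-free grammar with terminals `{0, …, k - 1}` and
nonterminals `{0, …, numNT - 1}`; the set of productions is given by a list without repetitions. -/
@[ext]
structure FiniteCFG (k : ℕ) where
  /-- The number of nonterminals. -/
  numNT : ℕ
  /-- The starting nonterminal. -/
  initial : Fin numNT
  /-- The productions. -/
  rules : List (ContextFreeRule (Fin k) (Fin numNT))
  /-- No production is listed twice. -/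
  rules_nodup : rules.Nodup

/-- The grammar that is presented. -/
def FiniteCFG.toCFG {k : ℕ} (G : FiniteCFG k) : ContextFreeGrammar (Fin k) where
  NT := Fin G.numNT
  initial := G.initial
  rules := ⟨G.rules, G.rules_nodup⟩

/-- Encoding of a terminal or nonterminal: a bit for its kind, followed by its index. -/
def encodeSymbol {k n : ℕ} : Symbol (Fin k) (Fin n) → List Bool
  | Symbol.terminal a => true :: encodeFin a
  | Symbol.nonterminal X => false :: encodeFin X

/-- Encoding of a production. -/
def encodeRule {k n : ℕ} (r : ContextFreeRule (Fin k) (Fin n)) : List Bool :=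
  encodeFin r.input ++ encodeList encodeSymbol r.output

/-- Encoding of a context-free grammar. -/
def FiniteCFG.encode {k : ℕ} (G : FiniteCFG k) : List Bool :=
  encodeNat G.numNT ++ (encodeFin G.initial ++ encodeList encodeRule G.rules)

theorem encodeSymbol_selfDelimiting (k n : ℕ) :
    SelfDelimiting (encodeSymbol (k := k) (n := n)) := by
  rintro (a | X) (b | Y) u v h
  · simp only [encodeSymbol, List.cons_append, List.cons.injEq, true_and] at h
    obtain ⟨rfl, h1⟩ := encodeFin_selfDelimiting _ _ _ _ _ h
    exact ⟨rfl, h1⟩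
  · simp [encodeSymbol] at h
  · simp [encodeSymbol] at h
  · simp only [encodeSymbol, List.cons_append, List.cons.injEq, true_and] at h
    obtain ⟨rfl, h1⟩ := encodeFin_selfDelimiting _ _ _ _ _ h
    exact ⟨rfl, h1⟩

theorem encodeRule_selfDelimiting (k n : ℕ) :
    SelfDelimiting (encodeRule (k := k) (n := n)) := by
  rintro ⟨X, α⟩ ⟨Y, β⟩ u v h
  simp only [encodeRule, List.append_assoc] at h
  obtain ⟨rfl, h1⟩ := encodeFin_selfDelimiting _ _ _ _ _ h
  obtain ⟨rfl, h2⟩ := encodeList_selfDelimiting (encodeSymbol_selfDelimiting _ _) _ _ _ _ h1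
  exact ⟨rfl, h2⟩

theorem FiniteCFG.encode_selfDelimiting (k : ℕ) : SelfDelimiting (FiniteCFG.encode (k := k)) := by
  rintro ⟨n, i, r, hr⟩ ⟨n', i', r', hr'⟩ u v h
  simp only [FiniteCFG.encode, List.append_assoc] at h
  obtain ⟨rfl, h1⟩ := encodeNat_selfDelimiting _ _ _ _ h
  obtain ⟨rfl, h2⟩ := encodeFin_selfDelimiting _ _ _ _ _ h1
  obtain ⟨rfl, h3⟩ := encodeList_selfDelimiting (encodeRule_selfDelimiting _ _) _ _ _ _ h2
  exact ⟨rfl, h3⟩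

/-! ## The two problems -/

/-- An instance of universality of unambiguous context-free grammars: a finite alphabet and an
unambiguous context-free grammar over it. -/
@[ext]
structure UUCFGInstance where
  /-- The size of the alphabet. -/
  alphabetSize : ℕ
  /-- The grammar. -/
  grammar : FiniteCFG alphabetSize
  /-- The grammar is unambiguous. -/
  unambiguous : grammar.toCFG.Unambiguous

/-- Encoding of the alphabet and the grammar. -/
def UUCFGInstance.encode (I : UUCFGInstance) : List Bool :=
  encodeNat I.alphabetSize ++ I.grammar.encode

theorem UUCFGInstance.encode_injective : Function.Injective UUCFGInstance.encode := by
  rintro ⟨k, G, hG⟩ ⟨k', G', hG'⟩ h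
  simp only [UUCFGInstance.encode] at h
  obtain ⟨rfl, h1⟩ := encodeNat_selfDelimiting _ _ _ _ h
  obtain rfl := (FiniteCFG.encode_selfDelimiting _).injective h1
  rfl

/-- The universality problem for unambiguous context-free grammars: does the given unambiguous
grammar generate every word over its alphabet? -/
def UUCFG : DecisionProblem where
  Instance := UUCFGInstance
  encode := UUCFGInstance.encode
  encode_injective := UUCFGInstance.encode_injective
  Yes I := ∀ w : List (Fin I.alphabetSize), w ∈ I.grammar.toCFG.language

/-- An instance of the inclusion problem: a finite alphabet, a nondeterministic finite automaton
and an unambiguous context-free grammar, both over this alphabet. -/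
@[ext]
structure NFAInUCFGInstance where
  /-- The size of the alphabet. -/
  alphabetSize : ℕ
  /-- The automaton. -/
  automaton : FiniteNFA alphabetSize
  /-- The grammar. -/
  grammar : FiniteCFG alphabetSize
  /-- The grammar is unambiguous. -/
  unambiguous : grammar.toCFG.Unambiguous

/-- Encoding of the alphabet, the automaton and the grammar. -/
def NFAInUCFGInstance.encode (I : NFAInUCFGInstance) : List Bool :=
  encodeNat I.alphabetSize ++ (I.automaton.encode ++ I.grammar.encode)

theorem NFAInUCFGInstance.encode_injective : Function.Injective NFAInUCFGInstance.encode := by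
  rintro ⟨k, A, G, hG⟩ ⟨k', A', G', hG'⟩ h
  simp only [NFAInUCFGInstance.encode] at h
  obtain ⟨rfl, h1⟩ := encodeNat_selfDelimiting _ _ _ _ h
  obtain ⟨rfl, h2⟩ := FiniteNFA.encode_selfDelimiting _ _ _ _ _ h1
  obtain rfl := (FiniteCFG.encode_selfDelimiting _).injective h2
  rfl

/-- The inclusion problem of nondeterministic finite automata in unambiguous context-free grammars:
does the given grammar generate every word that the given automaton accepts? -/
def NFAInUCFG : DecisionProblem where
  Instance := NFAInUCFGInstance
  encode := NFAInUCFGInstance.encode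
  encode_injective := NFAInUCFGInstance.encode_injective
  Yes I := I.automaton.toNFA.accepts ≤ I.grammar.toCFG.language

end InclusionProblems

/-! Universality is inclusion of the language of a one-state automaton, so only the converse
reduction needs an idea. One would like a grammar for the complement of L(A) together with the part
of L(A) inside L(G). But complementing a nondeterministic automaton is costly, and the product of A
with G becomes ambiguous as soon as a word has several runs.

The remedy is to take the transitions of A as letters. A word of transitions determines its labels
and all states it visits, so being an accepting run is a deterministic property. The new grammar
derives the words that are not accepting runs and the accepting runs whose labels lie in L(G). It is
universal iff the labels of every accepting run lie in L(G), that is, iff L(A) is contained in L(G).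

The two kinds of words are disjoint. The first is generated by a right-linear grammar that imitates
a deterministic automaton (`exists_parses_coRun_iff`, `uniqueParses_coRun`). The second uses the
triple construction, with nonterminals `inner p α q`, where α is a suffix of a right-hand side.
Consuming α symbol by symbol keeps new right-hand sides at length at most two, and thus the number
of rules polynomial. Erasing the states from a parse gives a parse of the labels
(`parses_of_parses_inner`), which is unique as G is unambiguous; conversely this parse and the word
determine the states (`uniqueParses_inner`). Fresh states `n` and `n + 1`, entered and left through
the fresh labels `k` and `k + 1`, give A a single initial and a single final state.

Uniqueness is handled with `Parses`, where a derivation forest becomes the preorder list of its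
right-hand sides; such lists are easily compared and renamed.

For the running time, data are binary trees written in prefix code on a stack. Programs over four
stacks are translated step by step into stack machines (`Run.leads`), and the functions they compute
in polynomial time are closed under composition, pairing, case distinction and iteration with
polynomially bounded values (`PolyTime.foldl_of_bound`). Both reductions are composed from these
operations between a decoder and an encoder (`computable_of_polyTime`). -/

/-! ## Structured programs over four stacks -/

namespace StackProgram

open Turing

/-- The names of the four stacks. -/
inductive Stack
  | d | a | b | c
  deriving DecidableEq

instance : Fintype Stack := ⟨{.d, .a, .b, .c}, fun x => by cases x <;> simp⟩

/-- The contents of the four stacks. -/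
structure Store where
  d : List Bool
  a : List Bool
  b : List Bool
  c : List Bool

/-- The content of a stack. -/
def Store.get (s : Store) : Stack → List Bool
  | .d => s.d
  | .a => s.a
  | .b => s.b
  | .c => s.c

/-- Replace the content of a stack. -/
def Store.set (s : Store) : Stack → List Bool → Store
  | .d, l => { s with d := l }
  | .a, l => { s with a := l }
  | .b, l => { s with b := l }
  | .c, l => { s with c := l }

theorem Store.update_get (s : Store) (k : Stack) (l : List Bool) :
    Function.update s.get k l = (s.set k l).get := by
  funext j
  cases k <;> cases j <;> simp [Function.update, Store.set, Store.get]

/-- Structured programs. `pop k p q r` pops from the stack `k` and continues with `p` if it was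
empty, with `q` if the popped bit is `false` and with `r` if it is `true`. `loop k p` repeats `p` as
long as `true` can be popped from the stack `k`. -/
inductive Cmd
  | skip
  | push (k : Stack) (x : Bool)
  | pop (k : Stack) (p q r : Cmd)
  | seq (p q : Cmd)
  | loop (k : Stack) (p : Cmd)

/-- `Run p s s' t`: started on the store `s`, the program `p` ends with the store `s'` after `t`
steps. -/
inductive Run : Cmd → Store → Store → ℕ → Prop
  | skip (s) : Run .skip s s 1
  | push (k x s) : Run (.push k x) s (s.set k (x :: s.get k)) 1
  | pop_none {k p q r s s' t} (h : s.get k = []) (hp : Run p s s' t) :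
      Run (.pop k p q r) s s' (t + 1)
  | pop_false {k p q r s s' t l} (h : s.get k = false :: l) (hq : Run q (s.set k l) s' t) :
      Run (.pop k p q r) s s' (t + 1)
  | pop_true {k p q r s s' t l} (h : s.get k = true :: l) (hr : Run r (s.set k l) s' t) :
      Run (.pop k p q r) s s' (t + 1)
  | seq {p q s s₁ s₂ t₁ t₂} (hp : Run p s s₁ t₁) (hq : Run q s₁ s₂ t₂) :
      Run (.seq p q) s s₂ (t₁ + t₂)
  | loop_none {k p s} (h : s.get k = []) : Run (.loop k p) s s 1
  | loop_false {k p s l} (h : s.get k = false :: l) : Run (.loop k p) s (s.set k l) 1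
  | loop_true {k p s s₁ s₂ t₁ t₂ l} (h : s.get k = true :: l) (hp : Run p (s.set k l) s₁ t₁)
      (hl : Run (.loop k p) s₁ s₂ t₂) : Run (.loop k p) s s₂ (t₁ + t₂ + 1)

/-! ### Translation of programs into stack machines -/

/-- The labels used for a program by the stack machine. -/
def Cmd.Label : Cmd → Type
  | .skip => Unit
  | .push _ _ => Unit
  | .pop _ p q r => Option (p.Label ⊕ q.Label ⊕ r.Label)
  | .seq p q => p.Label ⊕ q.Label
  | .loop _ p => Option p.Label

instance Cmd.fintypeLabel : (p : Cmd) → Fintype p.Label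
  | .skip => inferInstanceAs (Fintype Unit)
  | .push _ _ => inferInstanceAs (Fintype Unit)
  | .pop _ p q r =>
    haveI := p.fintypeLabel
    haveI := q.fintypeLabel
    haveI := r.fintypeLabel
    inferInstanceAs (Fintype (Option (p.Label ⊕ q.Label ⊕ r.Label)))
  | .seq p q =>
    haveI := p.fintypeLabel
    haveI := q.fintypeLabel
    inferInstanceAs (Fintype (p.Label ⊕ q.Label))
  | .loop _ p =>
    haveI := p.fintypeLabel
    inferInstanceAs (Fintype (Option p.Label))

/-- The label at which the execution of a program starts. -/
def Cmd.entry : (p : Cmd) → p.Label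
  | .skip => ()
  | .push _ _ => ()
  | .pop _ _ _ _ => none
  | .seq p _ => Sum.inl p.entry
  | .loop _ _ => none

/-- Statements of the stack machine with labels in `Λ`; the machine has one register for the bit
that was popped last. -/
abbrev MStmt (Λ : Type) := TM2.Stmt (fun _ : Stack => Bool) Λ (Option Bool)

/-- Clear the register and jump. -/
def jump {Λ : Type} (l : Λ) : MStmt Λ :=
  .load (fun _ => none) (.goto fun _ => l)

/-- Pop a bit and jump according to the result. -/
def popJump {Λ : Type} (k : Stack) (l₀ l₁ l₂ : Λ) : MStmt Λ :=
  .pop k (fun _ o => o) (.branch (fun v => v == some true) (jump l₂)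
    (.branch (fun v => v == some false) (jump l₁) (jump l₀)))

/-- The statements of a program whose labels are embedded by `emb` and which jumps to `exit` in the
end. -/
def Cmd.stmt {Λ : Type} : (p : Cmd) → (exit : Λ) → (emb : p.Label → Λ) → p.Label → MStmt Λ
  | .skip, exit, _, _ => jump exit
  | .push k x, exit, _, _ => .push k (fun _ => x) (jump exit)
  | .pop k p q r, _, emb, none =>
    popJump k (emb (some (.inl p.entry))) (emb (some (.inr (.inl q.entry))))
      (emb (some (.inr (.inr r.entry))))
  | .pop _ p _ _, exit, emb, some (.inl l) => p.stmt exit (fun l => emb (some (.inl l))) l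
  | .pop _ _ q _, exit, emb, some (.inr (.inl l)) =>
    q.stmt exit (fun l => emb (some (.inr (.inl l)))) l
  | .pop _ _ _ r, exit, emb, some (.inr (.inr l)) =>
    r.stmt exit (fun l => emb (some (.inr (.inr l)))) l
  | .seq p q, _, emb, .inl l => p.stmt (emb (.inr q.entry)) (fun l => emb (.inl l)) l
  | .seq _ q, exit, emb, .inr l => q.stmt exit (fun l => emb (.inr l)) l
  | .loop k p, exit, emb, none => popJump k exit exit (emb (some p.entry))
  | .loop _ p, _, emb, some l => p.stmt (emb none) (fun l => emb (some l)) l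

/-- The configuration of the machine with a given label and store and a cleared register. -/
def config {Λ : Type} (l : Λ) (s : Store) : TM2.Cfg (fun _ : Stack => Bool) Λ (Option Bool) :=
  ⟨some l, none, s.get⟩

/-- `t` steps lead from one configuration to another. -/
def Leads {Λ : Type} (M : Λ → MStmt Λ) (t : ℕ)
    (x y : TM2.Cfg (fun _ : Stack => Bool) Λ (Option Bool)) : Prop :=
  (flip bind (TM2.step M))^[t] (some x) = some y

theorem Leads.trans {Λ : Type} {M : Λ → MStmt Λ} {t₁ t₂ : ℕ}
    {x y z : TM2.Cfg (fun _ : Stack => Bool) Λ (Option Bool)}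
    (h₁ : Leads M t₁ x y) (h₂ : Leads M t₂ y z) : Leads M (t₁ + t₂) x z := by
  unfold Leads at *
  rw [add_comm, Function.iterate_add_apply, h₁, h₂]

theorem Leads.single {Λ : Type} {M : Λ → MStmt Λ}
    {x y : TM2.Cfg (fun _ : Stack => Bool) Λ (Option Bool)}
    (h : TM2.step M x = some y) : Leads M 1 x y := by
  simpa [Leads, flip] using h

theorem leads_popJump_none {Λ : Type} {M : Λ → MStmt Λ} {k : Stack} {l l₀ l₁ l₂ : Λ} {s : Store}
    (hM : M l = popJump k l₀ l₁ l₂) (h : s.get k = []) :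
    Leads M 1 (config l s) (config l₀ s) := by
  apply Leads.single
  have : s.set k [] = s := by
    cases k <;> simp [Store.get] at h <;> simp [Store.set, ← h]
  simp [config, hM, popJump, jump, h, Store.update_get, this]

theorem leads_popJump_false {Λ : Type} {M : Λ → MStmt Λ} {k : Stack} {l l₀ l₁ l₂ : Λ} {s : Store}
    {u : List Bool} (hM : M l = popJump k l₀ l₁ l₂) (h : s.get k = false :: u) :
    Leads M 1 (config l s) (config l₁ (s.set k u)) := by
  apply Leads.single
  simp [config, hM, popJump, jump, h, Store.update_get]

theorem leads_popJump_true {Λ : Type} {M : Λ → MStmt Λ} {k : Stack} {l l₀ l₁ l₂ : Λ} {s : Store}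
    {u : List Bool} (hM : M l = popJump k l₀ l₁ l₂) (h : s.get k = true :: u) :
    Leads M 1 (config l s) (config l₂ (s.set k u)) := by
  apply Leads.single
  simp [config, hM, popJump, jump, h, Store.update_get]

/-- The step counts in `Run` are chosen to agree exactly with those of the machine: one step per
`skip`, push or test, none for sequencing. The statement is relative to an embedding of labels, so
the induction hypotheses apply to subprograms placed inside a larger machine. -/
theorem Run.leads {p : Cmd} {s s' : Store} {t : ℕ} (h : Run p s s' t) {Λ : Type}
    {M : Λ → MStmt Λ} {exit : Λ} {emb : p.Label → Λ}
    (hM : ∀ l, M (emb l) = p.stmt exit emb l) :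
    Leads M t (config (emb p.entry) s) (config exit s') := by
  induction h generalizing exit with
  | skip s =>
    apply Leads.single
    simp [config, hM, Cmd.stmt, jump]
  | push k x s =>
    apply Leads.single
    simp [config, hM, Cmd.stmt, jump, Store.update_get]
  | pop_none h _ ih =>
    rw [add_comm]
    exact (leads_popJump_none (hM none) h).trans
      (ih (emb := fun l => emb (some (.inl l))) fun l => hM (some (.inl l)))
  | pop_false h _ ih =>
    rw [add_comm]
    exact (leads_popJump_false (hM none) h).trans
      (ih (emb := fun l => emb (some (.inr (.inl l)))) fun l => hM (some (.inr (.inl l))))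
  | pop_true h _ ih =>
    rw [add_comm]
    exact (leads_popJump_true (hM none) h).trans
      (ih (emb := fun l => emb (some (.inr (.inr l)))) fun l => hM (some (.inr (.inr l))))
  | seq _ _ ih₁ ih₂ =>
    exact (ih₁ (emb := fun l => emb (.inl l)) fun l => hM (.inl l)).trans
      (ih₂ (emb := fun l => emb (.inr l)) fun l => hM (.inr l))
  | loop_none h => exact leads_popJump_none (hM none) h
  | loop_false h => exact leads_popJump_false (hM none) h
  | loop_true h _ _ ih₁ ih₂ =>
    rw [add_comm]
    exact (leads_popJump_true (hM none) h).trans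
      ((ih₁ (emb := fun l => emb (some l)) fun l => hM (some l)).trans (ih₂ hM))

/-- The stack machine of a program, with input stack `a` and output stack `b`. -/
def Cmd.machine (p : Cmd) : FinTM2 where
  K := Stack
  k₀ := .a
  k₁ := .b
  Γ _ := Bool
  Λ := Option p.Label
  main := some p.entry
  σ := Option Bool
  initialState := none
  Γk₀Fin := inferInstanceAs (Fintype Bool)
  m := fun l => match l with
    | none => .halt
    | some l => p.stmt none some l

/-- A program that turns encodings on the stack `a` into encodings on the stack `b` in polynomial
time witnesses polynomial-time computability. -/
theorem computableInPolyTime_of_run {α β : Type} {ea : α → List Bool} {eb : β → List Bool}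
    {f : α → β} (p : Cmd) (time : Polynomial ℕ)
    (h : ∀ x, ∃ t ≤ time.eval (ea x).length,
      Run p ⟨[], ea x, [], []⟩ ⟨[], [], eb (f x), []⟩ t) :
    Nonempty (TM2ComputableInPolyTime ea eb f) := by
  choose t ht hr using h
  refine ⟨{ tm := p.machine, inputAlphabet := Equiv.refl _, outputAlphabet := Equiv.refl _,
            time := time + 1, outputsFun := fun x => ⟨⟨t x + 1, ?_⟩, ?_⟩ }⟩
  · have h₁ := (hr x).leads (M := p.machine.m) (exit := none) (emb := some) fun l => rfl
    -- The exit label `none` carries the halting statement; executing it is the extra step in the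
    -- time bound `time + 1`.
    have h₂ : Leads p.machine.m 1 (config none ⟨[], [], eb (f x), []⟩)
        ⟨none, none, Store.get ⟨[], [], eb (f x), []⟩⟩ := Leads.single rfl
    have h₃ := h₁.trans h₂
    have e₁ : initList p.machine (List.map (Equiv.refl Bool).invFun (ea x)) =
        config (some p.entry) ⟨[], ea x, [], []⟩ := by
      simp only [initList, config]
      congr 1
      funext k
      cases k <;> simp [Store.get, Cmd.machine] <;> rfl
    have e₂ : haltList p.machine (List.map (Equiv.refl Bool).invFun (eb (f x))) =
        ⟨none, none, Store.get ⟨[], [], eb (f x), []⟩⟩ := by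
      simp only [haltList]
      congr 1
      funext k
      cases k <;> simp [Store.get, Cmd.machine] <;> rfl
    refine Eq.trans ?_ (Eq.trans h₃ ?_)
    · exact congrArg _ (congrArg some e₁)
    · exact congrArg some e₂.symm
  · simpa using ht x

end StackProgram

namespace StackProgram

/-! ## Running times with bounds -/

/-- The program `p` leads from `s` to `s'` in at most `T` steps. -/
def RunIn (p : Cmd) (s s' : Store) (T : ℕ) : Prop :=
  ∃ t ≤ T, Run p s s' t

theorem RunIn.mono {p : Cmd} {s s' : Store} {T T' : ℕ} (h : RunIn p s s' T) (hT : T ≤ T') :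
    RunIn p s s' T' :=
  let ⟨t, ht, hr⟩ := h
  ⟨t, ht.trans hT, hr⟩

theorem RunIn.skip (s : Store) : RunIn .skip s s 1 :=
  ⟨1, le_rfl, .skip s⟩

theorem RunIn.push (k : Stack) (x : Bool) (s : Store) :
    RunIn (.push k x) s (s.set k (x :: s.get k)) 1 :=
  ⟨1, le_rfl, .push k x s⟩

theorem RunIn.pop_none {k : Stack} {p q r : Cmd} {s s' : Store} {T : ℕ} (h : s.get k = [])
    (hp : RunIn p s s' T) : RunIn (.pop k p q r) s s' (T + 1) :=
  let ⟨t, ht, hr⟩ := hp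
  ⟨t + 1, by lia, .pop_none h hr⟩

theorem RunIn.pop_false {k : Stack} {p q r : Cmd} {s s' : Store} {T : ℕ} {l : List Bool}
    (h : s.get k = false :: l) (hp : RunIn q (s.set k l) s' T) :
    RunIn (.pop k p q r) s s' (T + 1) :=
  let ⟨t, ht, hr⟩ := hp
  ⟨t + 1, by lia, .pop_false h hr⟩

theorem RunIn.pop_true {k : Stack} {p q r : Cmd} {s s' : Store} {T : ℕ} {l : List Bool}
    (h : s.get k = true :: l) (hp : RunIn r (s.set k l) s' T) :
    RunIn (.pop k p q r) s s' (T + 1) :=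
  let ⟨t, ht, hr⟩ := hp
  ⟨t + 1, by lia, .pop_true h hr⟩

theorem RunIn.seq {p q : Cmd} {s s₁ s₂ : Store} {T₁ T₂ : ℕ} (hp : RunIn p s s₁ T₁)
    (hq : RunIn q s₁ s₂ T₂) : RunIn (.seq p q) s s₂ (T₁ + T₂) :=
  let ⟨t₁, ht₁, hr₁⟩ := hp
  let ⟨t₂, ht₂, hr₂⟩ := hq
  ⟨t₁ + t₂, by lia, .seq hr₁ hr₂⟩

theorem RunIn.loop_none {k : Stack} {p : Cmd} {s : Store} (h : s.get k = []) :
    RunIn (.loop k p) s s 1 :=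
  ⟨1, le_rfl, .loop_none h⟩

theorem RunIn.loop_false {k : Stack} {p : Cmd} {s : Store} {l : List Bool}
    (h : s.get k = false :: l) : RunIn (.loop k p) s (s.set k l) 1 :=
  ⟨1, le_rfl, .loop_false h⟩

theorem RunIn.loop_true {k : Stack} {p : Cmd} {s s₁ s₂ : Store} {T₁ T₂ : ℕ} {l : List Bool}
    (h : s.get k = true :: l) (hp : RunIn p (s.set k l) s₁ T₁) (hl : RunIn (.loop k p) s₁ s₂ T₂) :
    RunIn (.loop k p) s s₂ (T₁ + T₂ + 1) :=
  let ⟨t₁, ht₁, hr₁⟩ := hp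
  let ⟨t₂, ht₂, hr₂⟩ := hl
  ⟨t₁ + t₂ + 1, by lia, .loop_true h hr₁ hr₂⟩

/-- Push the bits of a list; the last one ends on top. -/
def pushAll (k : Stack) : List Bool → Cmd
  | [] => .skip
  | x :: l => .seq (.push k x) (pushAll k l)

theorem pushAll_d (l d a b c : List Bool) :
    RunIn (pushAll .d l) ⟨d, a, b, c⟩ ⟨l.reverse ++ d, a, b, c⟩ (l.length + 1) := by
  induction l generalizing d with
  | nil => exact RunIn.skip _
  | cons x l ih =>
    have := (RunIn.push .d x ⟨d, a, b, c⟩).seq (ih (x :: d))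
    rw [List.reverse_cons, List.append_assoc]
    exact this.mono (by rw [List.length_cons]; lia)

/-! ## Binary trees on stacks -/

/-- Binary trees, the universal data type. -/
inductive STree
  | leaf
  | node (l r : STree)

/-- The prefix code of a tree. -/
def STree.code : STree → List Bool
  | .leaf => [false]
  | .node l r => true :: (l.code ++ r.code)

theorem STree.code_length_pos (t : STree) : 0 < t.code.length := by
  cases t <;> simp [STree.code]

/-- The bits of a list are put on a stack, each followed by `true`. -/
def stash : List Bool → List Bool → List Bool
  | [], a => a
  | x :: l, a => stash l (true :: x :: a)

theorem stash_append (l l' a : List Bool) : stash (l ++ l') a = stash l' (stash l a) := by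
  induction l generalizing a with
  | nil => rfl
  | cons x l ih => exact ih _

/-- The body of the loop of `take`. -/
def takeStep : Cmd :=
  .pop .d .skip
    (.seq (.push .a false) (.seq (.push .a true) (.seq (.push .b false) (.push .b true))))
    (.seq (.push .a true) (.seq (.push .a true) (.seq (.push .b true) (.seq (.push .b true)
      (.seq (.push .c true) (.push .c true))))))

/-- The stack `c` counts in unary the trees still to be read, above the marker `false`. A leaf
completes one of them; an inner node replaces one by its two children. Hence the list of pending
trees, and induction on the number of bits. The factor 8 is one test of the loop and at most 7 steps
of the body. -/
theorem takeStep_loop (n : ℕ) : ∀ (ts : List STree) (d a b c : List Bool),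
    (ts.flatMap STree.code).length = n →
    RunIn (.loop .c takeStep)
      ⟨ts.flatMap STree.code ++ d, a, b, List.replicate ts.length true ++ false :: c⟩
      ⟨d, stash (ts.flatMap STree.code) a, stash (ts.flatMap STree.code) b, c⟩ (8 * n + 1) := by
  induction n with
  | zero =>
    rintro (_ | ⟨t, ts⟩) d a b c h
    · exact RunIn.loop_false rfl
    · have := t.code_length_pos
      rw [List.flatMap_cons, List.length_append] at h
      lia
  | succ n ih =>
    rintro (_ | ⟨_ | ⟨l, r⟩, ts⟩) d a b c h
    · simp at h
    · have h' := ih ts d (true :: false :: a) (true :: false :: b) c (by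
        simp [STree.code] at h ⊢; lia)
      refine RunIn.mono (RunIn.loop_true (T₁ := 5) (s₁ := ⟨_, _, _, _⟩) rfl ?_ h') (by lia)
      refine RunIn.pop_false rfl ?_
      exact (RunIn.push _ _ _).seq ((RunIn.push _ _ _).seq ((RunIn.push _ _ _).seq
        (RunIn.push _ _ _)))
    · have h' := ih (l :: r :: ts) d (true :: true :: a) (true :: true :: b) c (by
        simp [STree.code] at h ⊢; lia)
      simp only [List.flatMap_cons, List.append_assoc, List.length_cons, List.replicate_succ,
        List.cons_append, STree.code] at h' ⊢
      refine RunIn.mono (RunIn.loop_true (T₁ := 7) (s₁ := ⟨_, _, _, _⟩) rfl ?_ h') (by lia)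
      refine RunIn.pop_true rfl ?_
      exact (RunIn.push _ _ _).seq ((RunIn.push _ _ _).seq ((RunIn.push _ _ _).seq
        ((RunIn.push _ _ _).seq ((RunIn.push _ _ _).seq (RunIn.push _ _ _)))))

/-- Move a tree from the stack `d` to both `a` and `b`. -/
def take : Cmd :=
  .seq (.push .a false) (.seq (.push .b false) (.seq (.push .c false) (.seq (.push .c true)
    (.loop .c takeStep))))

/-- Each bit of a copy lies below a flag `true`, and the whole copy above a `false`. A later loop
thus finds its end without a counter, whatever is underneath. -/
theorem run_take (t : STree) (d a b c : List Bool) :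
    RunIn take ⟨t.code ++ d, a, b, c⟩
      ⟨d, stash t.code (false :: a), stash t.code (false :: b), c⟩ (8 * t.code.length + 5) := by
  have h := takeStep_loop _ [t] d (false :: a) (false :: b) c rfl
  simp only [List.flatMap_cons, List.flatMap_nil, List.append_nil] at h
  exact ((RunIn.push _ _ _).seq ((RunIn.push _ _ _).seq ((RunIn.push _ _ _).seq
    ((RunIn.push _ _ _).seq h)))).mono (by lia)

/-- Move stashed bits from the stack `a` to `d`. -/
def restoreA : Cmd := .loop .a (.pop .a .skip (.push .d false) (.push .d true))

/-- Move stashed bits from the stack `b` to `d`. -/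
def restoreB : Cmd := .loop .b (.pop .b .skip (.push .d false) (.push .d true))

/-- Delete stashed bits on the stack `a`. -/
def clearA : Cmd := .loop .a (.pop .a .skip .skip .skip)

/-- Delete stashed bits on the stack `b`. -/
def clearB : Cmd := .loop .b (.pop .b .skip .skip .skip)

theorem run_restoreA (l d a b c : List Bool) :
    RunIn restoreA ⟨d, stash l (false :: a), b, c⟩ ⟨l ++ d, a, b, c⟩ (3 * l.length + 1) := by
  -- The bit stashed last is popped first, so the list is consumed from its right end and arrives on
  -- `d` in the original order.
  induction l using List.reverseRecOn generalizing d with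
  | nil => exact RunIn.loop_false rfl
  | append_singleton l x ih =>
    rw [stash_append]
    have := ih (x :: d)
    simp only [List.append_assoc, List.cons_append, List.nil_append] at this ⊢
    refine RunIn.mono (RunIn.loop_true (T₁ := 2) (s₁ := ⟨_, _, _, _⟩) rfl ?_ this)
      (by simp; lia)
    cases x
    · exact RunIn.pop_false rfl (RunIn.push _ _ _)
    · exact RunIn.pop_true rfl (RunIn.push _ _ _)

theorem run_restoreB (l d a b c : List Bool) :
    RunIn restoreB ⟨d, a, stash l (false :: b), c⟩ ⟨l ++ d, a, b, c⟩ (3 * l.length + 1) := by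
  induction l using List.reverseRecOn generalizing d with
  | nil => exact RunIn.loop_false rfl
  | append_singleton l x ih =>
    rw [stash_append]
    have := ih (x :: d)
    simp only [List.append_assoc, List.cons_append, List.nil_append] at this ⊢
    refine RunIn.mono (RunIn.loop_true (T₁ := 2) (s₁ := ⟨_, _, _, _⟩) rfl ?_ this)
      (by simp; lia)
    cases x
    · exact RunIn.pop_false rfl (RunIn.push _ _ _)
    · exact RunIn.pop_true rfl (RunIn.push _ _ _)

theorem run_clearA (l d a b c : List Bool) :
    RunIn clearA ⟨d, stash l (false :: a), b, c⟩ ⟨d, a, b, c⟩ (3 * l.length + 1) := by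
  induction l using List.reverseRecOn with
  | nil => exact RunIn.loop_false rfl
  | append_singleton l x ih =>
    rw [stash_append]
    refine RunIn.mono (RunIn.loop_true (T₁ := 2) (s₁ := ⟨_, _, _, _⟩) rfl ?_ ih)
      (by simp; lia)
    cases x
    · exact RunIn.pop_false rfl (RunIn.skip _)
    · exact RunIn.pop_true rfl (RunIn.skip _)

theorem run_clearB (l d a b c : List Bool) :
    RunIn clearB ⟨d, a, stash l (false :: b), c⟩ ⟨d, a, b, c⟩ (3 * l.length + 1) := by
  induction l using List.reverseRecOn with
  | nil => exact RunIn.loop_false rfl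
  | append_singleton l x ih =>
    rw [stash_append]
    refine RunIn.mono (RunIn.loop_true (T₁ := 2) (s₁ := ⟨_, _, _, _⟩) rfl ?_ ih)
      (by simp; lia)
    cases x
    · exact RunIn.pop_false rfl (RunIn.skip _)
    · exact RunIn.pop_true rfl (RunIn.skip _)

/-- Duplicate the tree on top of the stack `d`. -/
def dup : Cmd := .seq take (.seq restoreA restoreB)

/-- Delete the tree on top of the stack `d`. -/
def drop : Cmd := .seq take (.seq clearA clearB)

/-- Move the tree on top of the stack `d` to the stack `a`. -/
def save : Cmd := .seq take clearB

theorem run_dup (t : STree) (d a b c : List Bool) :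
    RunIn dup ⟨t.code ++ d, a, b, c⟩ ⟨t.code ++ (t.code ++ d), a, b, c⟩
      (14 * t.code.length + 7) :=
  ((run_take t d a b c).seq ((run_restoreA _ _ _ _ _).seq (run_restoreB _ _ _ _ _))).mono
    (by lia)

theorem run_drop (t : STree) (d a b c : List Bool) :
    RunIn drop ⟨t.code ++ d, a, b, c⟩ ⟨d, a, b, c⟩ (14 * t.code.length + 7) :=
  ((run_take t d a b c).seq ((run_clearA _ _ _ _ _).seq (run_clearB _ _ _ _ _))).mono (by lia)

theorem run_save (t : STree) (d a b c : List Bool) :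
    RunIn save ⟨t.code ++ d, a, b, c⟩ ⟨d, stash t.code (false :: a), b, c⟩
      (11 * t.code.length + 6) :=
  ((run_take t d a b c).seq (run_clearB _ _ _ _ _)).mono (by lia)

/-! ## Data types represented by trees -/

/-- A representation of the elements of a type by trees. -/
class ToTree (α : Type) where
  toTree : α → STree

open ToTree (toTree)

instance : ToTree Bool where
  toTree x := if x then .node .leaf .leaf else .leaf

instance : ToTree Unit where
  toTree _ := .leaf

instance {α β : Type} [ToTree α] [ToTree β] : ToTree (α × β) where
  toTree x := .node (toTree x.1) (toTree x.2)

instance {α : Type} [ToTree α] : ToTree (List α) where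
  toTree l := l.foldr (fun x t => .node (toTree x) t) .leaf

/-- Unary, in agreement with `encodeNat`. Passing between a number and a list of units then leaves
the tree unchanged. -/
instance : ToTree ℕ where
  toTree n := toTree (List.replicate n ())

/-- The code of the tree of an element. -/
def bits {α : Type} [ToTree α] (x : α) : List Bool := (toTree x).code

/-- The length of the code of an element. -/
def tsize {α : Type} [ToTree α] (x : α) : ℕ := (bits x).length

section bits

variable {α β : Type} [ToTree α] [ToTree β]

theorem bits_pair (x : α) (y : β) : bits (x, y) = true :: (bits x ++ bits y) := rfl

theorem bits_cons (x : α) (l : List α) : bits (x :: l) = true :: (bits x ++ bits l) := rfl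

theorem bits_true : bits true = [true, false, false] := rfl

theorem bits_false : bits false = [false] := rfl

theorem tsize_pos (x : α) : 0 < tsize x := STree.code_length_pos _

theorem tsize_pair (x : α) (y : β) : tsize (x, y) = tsize x + tsize y + 1 := by
  simp [tsize, bits_pair]

theorem tsize_nil : tsize ([] : List α) = 1 := rfl

theorem tsize_cons (x : α) (l : List α) : tsize (x :: l) = tsize x + tsize l + 1 := by
  simp [tsize, bits_cons]

theorem length_lt_tsize (l : List α) : l.length < tsize l := by
  induction l with
  | nil => exact tsize_pos _
  | cons x l ih =>
    have := tsize_pos x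
    rw [tsize_cons, List.length_cons]
    lia

end bits

/-! ## Functions computable in polynomial time -/

/-- Coefficients are natural numbers, so all polynomial bounds are monotone. This is what allows
them to be composed. -/
theorem eval_mono (q : Polynomial ℕ) {m n : ℕ} (h : m ≤ n) : q.eval m ≤ q.eval n := by
  rw [Polynomial.eval_eq_sum, Polynomial.eval_eq_sum]
  exact Finset.sum_le_sum fun i _ => Nat.mul_le_mul_left _ (Nat.pow_le_pow_left h i)

/-- A function is computable in polynomial time by a program that replaces the argument on top of
the stack `d` by the value and leaves what is below and the other stacks as they were. -/
def PolyTime {α β : Type} [ToTree α] [ToTree β] (f : α → β) : Prop :=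
  ∃ (p : Cmd) (q : Polynomial ℕ), ∀ x, tsize (f x) ≤ q.eval (tsize x) ∧
    ∀ d a b c, RunIn p ⟨bits x ++ d, a, b, c⟩ ⟨bits (f x) ++ d, a, b, c⟩ (q.eval (tsize x))

namespace PolyTime

variable {α β γ δ : Type} [ToTree α] [ToTree β] [ToTree γ] [ToTree δ]

/-- The size of the value is polynomial in that of the argument. -/
theorem size {f : α → β} (hf : PolyTime f) :
    ∃ q : Polynomial ℕ, ∀ x, tsize (f x) ≤ q.eval (tsize x) :=
  let ⟨_, q, h⟩ := hf
  ⟨q, fun x => (h x).1⟩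

/-- A function that preserves the representing trees is computable in polynomial time. -/
theorem of_toTree_eq {f : α → β} (h : ∀ x, toTree (f x) = toTree x) : PolyTime f := by
  refine ⟨.skip, .X + 1, fun x => ?_⟩
  have h₁ : bits (f x) = bits x := by simp [bits, h]
  refine ⟨by simp [tsize, h₁], fun d a b c => ?_⟩
  rw [h₁]
  exact (RunIn.skip _).mono (by simp)

protected theorem id : PolyTime fun x : α => x :=
  of_toTree_eq fun _ => rfl

/-- The size bound contained in `PolyTime` is needed here: it limits the argument, and hence the
time, of the second program. -/
theorem comp {g : β → γ} {f : α → β} (hg : PolyTime g) (hf : PolyTime f) :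
    PolyTime fun x => g (f x) := by
  obtain ⟨p, q, h⟩ := hf
  obtain ⟨p', q', h'⟩ := hg
  refine ⟨.seq p p', q + q'.comp q, fun x => ?_⟩
  have h₁ : q'.eval (tsize (f x)) ≤ q'.eval (q.eval (tsize x)) := eval_mono _ (h x).1
  simp only [Polynomial.eval_add, Polynomial.eval_comp]
  refine ⟨?_, fun d a b c => ?_⟩
  · have := (h' (f x)).1
    lia
  · exact (((h x).2 d a b c).seq ((h' (f x)).2 d a b c)).mono (by lia)

protected theorem const (y : β) : PolyTime fun _ : α => y := by
  refine ⟨.seq drop (pushAll .d (bits y).reverse),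
    14 * .X + .C ((bits y).length + 10), fun x => ?_⟩
  simp only [Polynomial.eval_add, Polynomial.eval_mul, Polynomial.eval_X, Polynomial.eval_C,
    Polynomial.eval_ofNat]
  refine ⟨by simp [tsize]; lia, fun d a b c => ?_⟩
  have h := (run_drop (toTree x) d a b c).seq (pushAll_d (bits y).reverse d a b c)
  rw [List.reverse_reverse] at h
  refine h.mono ?_
  simp [tsize, bits]
  lia

theorem pair {f : α → β} {g : α → γ} (hf : PolyTime f) (hg : PolyTime g) :
    PolyTime fun x => (f x, g x) := by
  obtain ⟨p, q, h⟩ := hf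
  obtain ⟨p', q', h'⟩ := hg
  refine ⟨.seq dup (.seq p (.seq save (.seq p' (.seq restoreA (.push .d true))))),
    14 * .X + 15 * q + q' + 20, fun x => ?_⟩
  simp only [Polynomial.eval_add, Polynomial.eval_mul, Polynomial.eval_X, Polynomial.eval_ofNat]
  have h₁ := (h x).1
  have h₂ := (h' x).1
  refine ⟨by rw [tsize_pair]; lia, fun d a b c => ?_⟩
  have h₃ := (run_dup (toTree x) d a b c).seq (((h x).2 _ a b c).seq
    ((run_save (toTree (f x)) _ a b c).seq (((h' x).2 _ _ b c).seq
      ((run_restoreA (bits (f x)) (bits (g x) ++ d) a b c).seq (RunIn.push .d true _)))))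
  rw [bits_pair, List.cons_append, List.append_assoc]
  refine h₃.mono ?_
  change 14 * tsize x + 7 + (_ + (11 * tsize (f x) + 6 + (_ + (3 * tsize (f x) + 1 + 1)))) ≤ _
  lia

protected theorem fst : PolyTime fun x : α × β => x.1 := by
  refine ⟨.pop .d .skip .skip (.seq save (.seq drop restoreA)), 40 * .X + 20, fun x => ?_⟩
  simp only [Polynomial.eval_add, Polynomial.eval_mul, Polynomial.eval_X, Polynomial.eval_ofNat]
  obtain ⟨x, y⟩ := x
  rw [tsize_pair]
  refine ⟨by lia, fun d a b c => ?_⟩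
  have h := (run_save (toTree x) (bits y ++ d) a b c).seq
    ((run_drop (toTree y) d _ b c).seq (run_restoreA _ _ _ _ _))
  rw [bits_pair, List.cons_append, List.append_assoc]
  refine (RunIn.pop_true rfl h).mono ?_
  change 11 * tsize x + 6 + (14 * tsize y + 7 + (3 * tsize x + 1)) + 1 ≤ _
  lia

protected theorem snd : PolyTime fun x : α × β => x.2 := by
  refine ⟨.pop .d .skip .skip drop, 40 * .X + 20, fun x => ?_⟩
  simp only [Polynomial.eval_add, Polynomial.eval_mul, Polynomial.eval_X, Polynomial.eval_ofNat]
  obtain ⟨x, y⟩ := x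
  rw [tsize_pair]
  refine ⟨by lia, fun d a b c => ?_⟩
  rw [bits_pair, List.cons_append, List.append_assoc]
  refine (RunIn.pop_true rfl (run_drop (toTree x) (bits y ++ d) a b c)).mono ?_
  change 14 * tsize x + 7 + 1 ≤ _
  lia

/-- Case distinction on a Boolean value that is given together with the argument. -/
theorem cond_pair {f g : α → β} (hf : PolyTime f) (hg : PolyTime g) :
    PolyTime fun x : Bool × α => cond x.1 (f x.2) (g x.2) := by
  obtain ⟨p, q, h⟩ := hf
  obtain ⟨p', q', h'⟩ := hg
  -- After the bit of the pair, `false` is the whole code of the value `false`, while the value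
  -- `true` has the code `true, false, false`. The branches with `skip` are never reached.
  refine ⟨.pop .d .skip .skip (.pop .d .skip p' (.pop .d .skip (.pop .d .skip p .skip) .skip)),
    q + q' + 10, fun ⟨y, x⟩ => ?_⟩
  have h₁ : tsize x ≤ tsize (y, x) := by rw [tsize_pair]; lia
  have h₂ := eval_mono q h₁
  have h₃ := eval_mono q' h₁
  simp only [Polynomial.eval_add, Polynomial.eval_ofNat]
  cases y
  · refine ⟨(h' x).1.trans (by lia), fun d a b c => ?_⟩
    exact (RunIn.pop_true rfl (RunIn.pop_false rfl ((h' x).2 d a b c))).mono (by lia)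
  · refine ⟨(h x).1.trans (by lia), fun d a b c => ?_⟩
    exact (RunIn.pop_true rfl (RunIn.pop_true rfl (RunIn.pop_false rfl (RunIn.pop_false rfl
      ((h x).2 d a b c))))).mono (by lia)

protected theorem cond {b : α → Bool} {f g : α → β} (hb : PolyTime b) (hf : PolyTime f)
    (hg : PolyTime g) : PolyTime fun x => cond (b x) (f x) (g x) :=
  (cond_pair hf hg).comp (hb.pair PolyTime.id)

theorem ite {b : α → Prop} [DecidablePred b] {f g : α → β} (hb : PolyTime fun x => decide (b x))
    (hf : PolyTime f) (hg : PolyTime g) : PolyTime fun x => if b x then f x else g x := by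
  simpa only [Bool.cond_decide] using PolyTime.cond hb hf hg

/-- Case distinction on a list that is given together with the argument. -/
theorem list_cases_pair {f : α → γ} {g : (β × List β) × α → γ} (hf : PolyTime f)
    (hg : PolyTime g) :
    PolyTime fun x : List β × α =>
      match x.1 with
      | [] => f x.2
      | y :: l => g ((y, l), x.2) := by
  obtain ⟨p, q, h⟩ := hf
  obtain ⟨p', q', h'⟩ := hg
  -- The codes of `(y :: l, x)` and `((y, l), x)` coincide, so in the second case the two inspected
  -- bits are simply put back.
  refine ⟨.pop .d .skip .skip (.pop .d .skip p (.seq (.push .d true) (.seq (.push .d true) p'))),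
    q + q' + 10, fun ⟨l, x⟩ => ?_⟩
  have h₁ : tsize x ≤ tsize (l, x) := by rw [tsize_pair]; lia
  have h₂ := eval_mono q h₁
  simp only [Polynomial.eval_add, Polynomial.eval_ofNat]
  cases l with
  | nil =>
    refine ⟨(h x).1.trans (by lia), fun d a b c => ?_⟩
    exact (RunIn.pop_true rfl (RunIn.pop_false rfl ((h x).2 d a b c))).mono (by lia)
  | cons y l =>
    refine ⟨(h' _).1.trans ?_, fun d a b c => ?_⟩
    · change q'.eval (tsize (y :: l, x)) ≤ _
      lia
    · have h₃ := (RunIn.push .d true ⟨bits y ++ bits l ++ bits x ++ d, a, b, c⟩).seq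
        ((RunIn.push .d true _).seq ((h' ((y, l), x)).2 d a b c))
      rw [bits_pair, bits_cons]
      exact (RunIn.pop_true rfl (RunIn.pop_true rfl h₃)).mono (T' :=
        q.eval (tsize (y :: l, x)) + q'.eval (tsize (y :: l, x)) + 10) (by
          change 1 + (1 + q'.eval (tsize (y :: l, x))) + 1 + 1 ≤ _
          lia)

/-! ### Iteration with values of bounded size -/

/-- The loop that iterates over a list with the program `p` for a single step. -/
def foldLoop (p : Cmd) : Cmd :=
  .loop .c (.pop .d .skip .skip (.pop .d .skip .skip (.seq (.push .d true)
    (.seq (.push .d true) (.seq p (.push .c true))))))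

/-- The `true` on `c` permits one more round and is renewed only if the list was nonempty; the
`false` below it then ends the loop. Since `B` bounds all intermediate values, every round has the
same time bound, and rounds are as many as elements, plus one. -/
theorem run_foldLoop {p : Cmd} {q : Polynomial ℕ} {step : γ → β → γ}
    (h : ∀ x : (β × List β) × γ, ∀ d a b c,
      RunIn p ⟨bits x ++ d, a, b, c⟩ ⟨bits (x.1.2, step x.2 x.1.1) ++ d, a, b, c⟩
        (q.eval (tsize x))) (B : ℕ) (l : List β) (s : γ)
    (hB : ∀ l', l' <+: l → tsize (l'.foldl step s) ≤ B) (d a b c : List Bool) :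
    RunIn (foldLoop p)
      ⟨bits (l, s) ++ d, a, b, true :: false :: c⟩ ⟨bits (l.foldl step s) ++ d, a, b, c⟩
      ((l.length + 1) * (q.eval (tsize l + B + 1) + 10)) := by
  induction l generalizing s with
  | nil =>
    refine (RunIn.loop_true (l := false :: c) rfl (RunIn.pop_true rfl (RunIn.pop_false rfl
      (RunIn.skip _))) (RunIn.loop_false rfl)).mono ?_
    simp
  | cons y l ih =>
    have ih' := ih (step s y) fun l' hl' => by
      simpa using hB (y :: l') (by simpa using hl')
    have h₁ := (RunIn.push .d true ⟨bits y ++ bits l ++ bits s ++ d, a, b, false :: c⟩).seq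
        ((RunIn.push .d true _).seq ((h ((y, l), s) d a b (false :: c)).seq (RunIn.push .c true _)))
    have h₂ := RunIn.loop_true (s := ⟨bits (y :: l, s) ++ d, a, b, true :: false :: c⟩) rfl
      (RunIn.pop_true rfl (RunIn.pop_true rfl h₁)) ih'
    refine h₂.mono ?_
    have hs : tsize s ≤ B := hB [] (List.nil_prefix)
    have h₃ : q.eval (tsize ((y, l), s)) ≤ q.eval (tsize (y :: l) + B + 1) := eval_mono _ (by
      rw [tsize_cons, tsize_pair, tsize_pair]; lia)
    have h₄ : q.eval (tsize l + B + 1) ≤ q.eval (tsize (y :: l) + B + 1) := eval_mono _ (by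
      rw [tsize_cons]; lia)
    have h₅ := Nat.mul_le_mul_left (l.length + 1) (Nat.add_le_add_right h₄ 10)
    rw [List.length_cons]
    calc _ ≤ (l.length + 1) * (q.eval (tsize (y :: l) + B + 1) + 10) +
          (q.eval (tsize (y :: l) + B + 1) + 10) := by lia
      _ = _ := by ring

/-- Iterating over a list preserves computability in polynomial time if the values that occur in
the iteration have polynomial size. -/
theorem foldl_of_bound {l : α → List β} {s : α → γ} {step : γ → β → γ} (hl : PolyTime l)
    (hs : PolyTime s) (hstep : PolyTime fun x : γ × β => step x.1 x.2)
    (hB : ∃ q : Polynomial ℕ, ∀ x l', l' <+: l x → tsize (l'.foldl step (s x)) ≤ q.eval (tsize x)) :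
    PolyTime fun x => (l x).foldl step (s x) := by
  have hstep' : PolyTime fun x : (β × List β) × γ => (x.1.2, step x.2 x.1.1) :=
    (PolyTime.snd.comp PolyTime.fst).pair
      (hstep.comp (PolyTime.snd.pair (PolyTime.fst.comp PolyTime.fst)))
  obtain ⟨p, q, h⟩ := hl.pair hs
  obtain ⟨p', q', h'⟩ := hstep'
  obtain ⟨r, hr⟩ := hB
  refine ⟨.seq p (.seq (.push .c false) (.seq (.push .c true) (foldLoop p'))),
    q + r + (q + 1) * (q'.comp (q + r + 1) + 10) + 2, fun x => ?_⟩
  simp only [Polynomial.eval_add, Polynomial.eval_ofNat, Polynomial.eval_mul, Polynomial.eval_comp,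
    Polynomial.eval_one]
  refine ⟨(hr x _ (List.prefix_refl _)).trans (by lia), fun d a b c => ?_⟩
  have h₁ := run_foldLoop (fun x => (h' x).2) (r.eval (tsize x)) (l x) (s x) (hr x) d a b c
  refine (((h x).2 d a b c).seq ((RunIn.push .c false _).seq
    ((RunIn.push .c true _).seq h₁))).mono ?_
  have h₂ := (h x).1
  rw [tsize_pair] at h₂
  have h₃ := length_lt_tsize (l x)
  have h₄ : q'.eval (tsize (l x) + r.eval (tsize x) + 1) ≤
      q'.eval (q.eval (tsize x) + r.eval (tsize x) + 1) := eval_mono _ (by lia)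
  have h₅ := Nat.mul_le_mul (show (l x).length + 1 ≤ q.eval (tsize x) + 1 by lia)
    (Nat.add_le_add_right h₄ 10)
  lia

end PolyTime

/-! ## Conversion between words and trees -/

/-- Move the stack `a` to the stack `b`. -/
def reverseAB : Cmd :=
  .seq (.push .c true) (.loop .c (.pop .a .skip
    (.seq (.push .b false) (.push .c true)) (.seq (.push .b true) (.push .c true))))

theorem run_reverseAB (l d b : List Bool) :
    RunIn reverseAB ⟨d, l, b, []⟩ ⟨d, [], l.reverse ++ b, []⟩ (4 * l.length + 5) := by
  refine RunIn.mono (T := 1 + (4 * l.length + 4)) (RunIn.seq (RunIn.push .c true _) ?_) (by lia)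
  induction l generalizing b with
  | nil =>
    exact (RunIn.loop_true rfl (RunIn.pop_none rfl (RunIn.skip _)) (RunIn.loop_none rfl)).mono
      (by simp)
  | cons x l ih =>
    rw [List.reverse_cons, List.append_assoc]
    refine RunIn.mono (RunIn.loop_true (T₁ := 3) rfl ?_ (ih (x :: b)))
      (by rw [List.length_cons]; lia)
    cases x
    · exact RunIn.pop_false rfl ((RunIn.push _ _ _).seq (RunIn.push _ _ _))
    · exact RunIn.pop_true rfl ((RunIn.push _ _ _).seq (RunIn.push _ _ _))

/-- Build the tree of the list of bits on the stack `b`. -/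
def buildList : Cmd :=
  .seq (.push .d false) (.seq (.push .c true) (.loop .c (.pop .b .skip
    (.seq (pushAll .d [false, true]) (.push .c true))
    (.seq (pushAll .d [false, false, true, true]) (.push .c true)))))

theorem run_buildList (l : List Bool) :
    RunIn buildList ⟨[], [], l, []⟩ ⟨bits l.reverse, [], [], []⟩ (8 * l.length + 6) := by
  have key : ∀ l l' : List Bool, RunIn (.loop .c (.pop .b .skip
      (.seq (pushAll .d [false, true]) (.push .c true))
      (.seq (pushAll .d [false, false, true, true]) (.push .c true))))
      ⟨bits l', [], l, [true]⟩ ⟨bits (l.reverse ++ l'), [], [], []⟩ (8 * l.length + 4) := by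
    intro l
    induction l with
    | nil =>
      intro l'
      exact (RunIn.loop_true rfl (RunIn.pop_none rfl (RunIn.skip _)) (RunIn.loop_none rfl)).mono
        (by simp)
    | cons x l ih =>
      intro l'
      have h := ih (x :: l')
      rw [List.reverse_cons, List.append_assoc]
      refine RunIn.mono (RunIn.loop_true (T₁ := 7) rfl ?_ h) (by rw [List.length_cons]; lia)
      cases x
      · exact (RunIn.pop_false rfl ((pushAll_d [false, true] (bits l') [] l []).seq
          (RunIn.push .c true _))).mono (by simp)
      · exact (RunIn.pop_true rfl ((pushAll_d [false, false, true, true] (bits l') [] l []).seq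
          (RunIn.push .c true _))).mono (by simp)
  have h := key l []
  rw [List.append_nil] at h
  exact ((RunIn.push .d false _).seq ((RunIn.push .c true _).seq h)).mono (by lia)

/-- Move the bits of the list whose tree is on the stack `d` to the stack `a`. -/
def unbuildList : Cmd :=
  .seq (.push .c true) (.loop .c (.pop .d .skip .skip (.pop .d .skip
    (.seq (.push .a false) (.push .c true))
    (.pop .d .skip (.pop .d .skip (.seq (.push .a true) (.push .c true)) .skip) .skip))))

theorem run_unbuildList (l a : List Bool) :
    RunIn unbuildList ⟨bits l, a, [], []⟩ ⟨[], l.reverse ++ a, [], []⟩ (8 * l.length + 6) := by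
  refine RunIn.mono (T := 1 + (8 * l.length + 4)) (RunIn.seq (RunIn.push .c true _) ?_) (by lia)
  induction l generalizing a with
  | nil =>
    exact (RunIn.loop_true rfl (RunIn.pop_false rfl (RunIn.skip _)) (RunIn.loop_none rfl)).mono
      (by simp)
  | cons x l ih =>
    rw [List.reverse_cons, List.append_assoc]
    refine RunIn.mono (RunIn.loop_true (T₁ := 6) rfl ?_ (ih (x :: a)))
      (by rw [List.length_cons]; lia)
    cases x
    · exact (RunIn.pop_true rfl (RunIn.pop_false rfl ((RunIn.push .a false _).seq
        (RunIn.push _ _ _)))).mono (by lia)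
    · exact RunIn.pop_true rfl (RunIn.pop_true rfl (RunIn.pop_false rfl (RunIn.pop_false rfl
        ((RunIn.push .a true _).seq (RunIn.push _ _ _)))))

theorem tsize_bool_list_le (l : List Bool) : tsize l ≤ 4 * l.length + 1 := by
  induction l with
  | nil => simp [tsize_nil]
  | cons x l ih =>
    have : tsize x ≤ 3 := by cases x <;> simp [tsize, bits_true, bits_false]
    rw [tsize_cons, List.length_cons]
    lia

/-- A function on words that is computable in polynomial time gives a function between encoded
types that is computable in polynomial time. -/
theorem PolyTime.computableInPolyTime {α β : Type} {ea : α → List Bool} {eb : β → List Bool}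
    {f : α → β} {F : List Bool → List Bool} (hF : PolyTime F) (h : ∀ x, F (ea x) = eb (f x)) :
    Nonempty (Turing.TM2ComputableInPolyTime ea eb f) := by
  obtain ⟨p, q, hp⟩ := hF
  refine computableInPolyTime_of_run
    -- A list code grows from its end, so the last letter of the input must be on top: hence the
    -- first reversal. Unpacking the result reverses it, which the last step undoes.
    (.seq reverseAB (.seq buildList (.seq p (.seq unbuildList reverseAB))))
    -- The polynomial `4 * .X + 1` bounds the tree size of a word. Reversing and building cost 4 + 8
    -- steps per input letter; running `p`, unpacking and reversing cost 1 + 8 + 4 times the value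
    -- of `q`.
    (12 * .X + 13 * q.comp (4 * .X + 1) + 30) fun x => ?_
  have h₁ := run_reverseAB (ea x) [] []
  have h₂ := run_buildList (ea x).reverse
  have h₃ := (hp (ea x)).2 [] [] [] []
  have h₄ := run_unbuildList (F (ea x)) []
  have h₅ := run_reverseAB (F (ea x)).reverse [] []
  simp only [List.append_nil, List.reverse_reverse] at h₁ h₂ h₃ h₄ h₅
  rw [← h]
  have := h₁.seq (h₂.seq (h₃.seq (h₄.seq h₅)))
  refine this.mono ?_
  simp only [Polynomial.eval_add, Polynomial.eval_mul, Polynomial.eval_comp, Polynomial.eval_X,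
    Polynomial.eval_ofNat, Polynomial.eval_one, List.length_reverse]
  have h₆ := eval_mono q (tsize_bool_list_le (ea x))
  have h₇ := (hp (ea x)).1
  have h₈ := length_lt_tsize (F (ea x))
  lia

end StackProgram

namespace StackProgram

open ToTree (toTree)

/-! ## A library of functions computable in polynomial time -/

instance {T N : Type} [ToTree T] [ToTree N] : ToTree (Symbol T N) where
  toTree s := match s with
    | .terminal a => .node (toTree true) (toTree a)
    | .nonterminal X => .node (toTree false) (toTree X)

instance {T N : Type} [ToTree T] [ToTree N] : ToTree (ContextFreeRule T N) where
  toTree r := .node (toTree r.input) (toTree r.output)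

theorem tsize_bool_le (x : Bool) : tsize x ≤ 3 := by
  cases x <;> simp [tsize, bits_true, bits_false]

theorem tsize_le_of_mem {α : Type} [ToTree α] {x : α} {l : List α} (h : x ∈ l) :
    tsize x < tsize l := by
  induction l with
  | nil => simp at h
  | cons y l ih =>
    rw [tsize_cons]
    rcases List.mem_cons.1 h with rfl | h
    · lia
    · have := ih h
      lia

theorem tsize_append {α : Type} [ToTree α] (l l' : List α) :
    tsize (l ++ l') + 1 = tsize l + tsize l' := by
  induction l with
  | nil => simp [tsize_nil]; lia
  | cons y l ih => rw [List.cons_append, tsize_cons, tsize_cons]; lia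

theorem tsize_tail_le {α : Type} [ToTree α] (l : List α) : tsize l.tail ≤ tsize l := by
  cases l with
  | nil => rfl
  | cons y l => rw [List.tail_cons, tsize_cons]; lia

theorem tsize_succ (n : ℕ) : tsize (n + 1) = tsize n + 2 := by
  change tsize (List.replicate (n + 1) ()) = tsize (List.replicate n ()) + 2
  rw [List.replicate_succ, tsize_cons]
  change 1 + _ + 1 = _
  lia

/-- Case distinction on a list. -/
def listElim {β γ : Type} (l : List β) (f : γ) (g : β → List β → γ) : γ :=
  match l with
  | [] => f
  | y :: l => g y l

/-- Case distinction on a symbol. -/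
def symbolElim {T N γ : Type} (s : Symbol T N) (f : T → γ) (g : N → γ) : γ :=
  match s with
  | .terminal a => f a
  | .nonterminal X => g X

/-- Collecting all tails of a list by iteration. -/
theorem foldl_tails {β : Type} (l : List β) (acc : List (List β)) :
    ([] :: (l.foldl (fun (t : List β × List (List β)) _ => (t.1.tail, t.1 :: t.2)) (l, acc)).2).reverse =
      acc.reverse ++ l.tails := by
  induction l generalizing acc with
  | nil => simp
  | cons y l ih =>
    rw [List.foldl_cons, List.tail_cons, ih]
    simp

/-- The proper tails of a unary number have lengths `n - 1, …, 0`. This reduces `List.range` to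
operations already known to be polynomial. -/
theorem map_length_tails (n : ℕ) :
    ((List.replicate n ()).tails.tail.map List.length).reverse = List.range n := by
  induction n with
  | zero => rfl
  | succ n ih =>
    rw [List.range_succ, ← ih]
    cases n <;> simp [List.replicate_succ]

/-- The flag records that `y` has been met and freezes the counter. If `y` is absent, the counter
reaches the length, which is also the value of `List.idxOf`. -/
theorem foldl_idxOf {β : Type} [DecidableEq β] (y : β) (l : List β) (n : ℕ) :
    l.foldl (fun (t : Bool × ℕ) z => if t.1 || decide (z = y) then (true, t.2) else (false, t.2 + 1))
      (false, n) = (decide (y ∈ l), n + l.idxOf y) := by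
  have h : ∀ (l : List β) n, l.foldl (fun (t : Bool × ℕ) z =>
      if t.1 || decide (z = y) then (true, t.2) else (false, t.2 + 1)) (true, n) = (true, n) := by
    intro l n
    induction l with
    | nil => rfl
    | cons z l ih => simpa using ih
  induction l generalizing n with
  | nil => simp
  | cons z l ih =>
    rw [List.foldl_cons]
    by_cases hz : z = y
    · simp only [hz, decide_true, Bool.or_true, if_true, h]
      simp
    · simp only [hz, decide_false, Bool.or_false, Bool.false_eq_true, if_false, ih]
      simp [List.idxOf_cons_ne _ hz, Ne.symm hz]
      lia

/-- The first component is the part of `l'` not yet compared. If `l'` is too short the flag is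
cleared; if it is too long a nonempty rest remains, which the final test detects. -/
theorem foldl_decide_eq {α : Type} [DecidableEq α] (l l' : List α) (b : Bool) :
    ((l.foldl (fun (t : List α × Bool) y =>
        listElim t.1 ([], false) fun z r => (r, t.2 && decide (y = z))) (l', b)).2 &&
      decide ((l.foldl (fun (t : List α × Bool) y =>
        listElim t.1 ([], false) fun z r => (r, t.2 && decide (y = z))) (l', b)).1 = [])) =
      (b && decide (l = l')) := by
  induction l generalizing l' b with
  | nil =>
    cases l' <;> simp
  | cons y l ih =>
    cases l' with
    | nil => exact (ih [] false).trans (by simp)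
    | cons z l' => exact (ih l' (b && decide (y = z))).trans (by simp [Bool.and_assoc])

-- Closure under constructors and case distinctions

attribute [fun_prop] PolyTime
attribute [fun_prop] PolyTime.id PolyTime.const PolyTime.comp PolyTime.cond PolyTime.ite
  PolyTime.pair

namespace PolyTime

variable {α β γ δ T N : Type} [ToTree α] [ToTree β] [ToTree γ] [ToTree δ] [ToTree T] [ToTree N]

@[fun_prop]
theorem fst_comp {f : α → β × γ} (hf : PolyTime f) : PolyTime fun x => (f x).1 :=
  PolyTime.fst.comp hf

@[fun_prop]
theorem snd_comp {f : α → β × γ} (hf : PolyTime f) : PolyTime fun x => (f x).2 :=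
  PolyTime.snd.comp hf

@[fun_prop]
theorem cons {f : α → β} {l : α → List β} (hf : PolyTime f) (hl : PolyTime l) :
    PolyTime fun x => f x :: l x :=
  (of_toTree_eq (f := fun x : β × List β => x.1 :: x.2) fun _ => rfl).comp (hf.pair hl)

/-- A function that extends the code of its argument by a fixed word. -/
theorem of_bits_eq {f : α → β} (w : List Bool) (h : ∀ x, bits (f x) = w ++ bits x) :
    PolyTime f := by
  refine ⟨pushAll .d w.reverse, .X + .C (w.length + 1), fun x => ⟨?_, fun d a b c => ?_⟩⟩
  · simp [tsize, h]
    lia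
  · have := pushAll_d w.reverse (bits x ++ d) a b c
    rw [List.reverse_reverse, ← List.append_assoc, ← h] at this
    exact this.mono (by simp)

@[fun_prop]
theorem terminal {f : α → T} (hf : PolyTime f) :
    PolyTime fun x => (Symbol.terminal (f x) : Symbol T N) :=
  -- The bit of the inner node, followed by the code of the tag `true`.
  (of_bits_eq (f := fun a : T => (Symbol.terminal a : Symbol T N)) [true, true, false, false]
    fun _ => rfl).comp hf

@[fun_prop]
theorem nonterminal {f : α → N} (hf : PolyTime f) :
    PolyTime fun x => (Symbol.nonterminal (f x) : Symbol T N) :=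
  (of_bits_eq (f := fun a : N => (Symbol.nonterminal a : Symbol T N)) [true, false]
    fun _ => rfl).comp hf

theorem symbolElim_pair {f : T × α → γ} {g : N × α → γ} (hf : PolyTime f) (hg : PolyTime g) :
    PolyTime fun x : Symbol T N × α =>
      symbolElim x.1 (fun a => f (a, x.2)) (fun X => g (X, x.2)) := by
  obtain ⟨p, q, h⟩ := hf
  obtain ⟨p', q', h'⟩ := hg
  -- Below the bits of the pair and of the symbol lies the tag: `false` for a nonterminal, `true,
  -- false, false` for a terminal. The bit pushed afterwards pairs the bare index with the remaining
  -- argument.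
  refine ⟨.pop .d .skip .skip (.pop .d .skip .skip (.pop .d .skip (.seq (.push .d true) p')
    (.pop .d .skip (.pop .d .skip (.seq (.push .d true) p) .skip) .skip))),
    q + q' + 10, fun ⟨s, x⟩ => ?_⟩
  simp only [Polynomial.eval_add, Polynomial.eval_ofNat]
  cases s with
  | terminal t =>
    have h₁ : tsize (t, x) ≤ tsize ((Symbol.terminal t : Symbol T N), x) := by
      rw [tsize_pair, tsize_pair]
      change _ ≤ (bits true ++ bits t).length + 1 + _ + 1
      simp [tsize]
      lia
    have h₂ := eval_mono q h₁
    refine ⟨(h _).1.trans (by lia), fun d a b c => ?_⟩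
    exact (RunIn.pop_true rfl (RunIn.pop_true rfl (RunIn.pop_true rfl (RunIn.pop_false rfl
      (RunIn.pop_false rfl ((RunIn.push .d true ⟨bits t ++ bits x ++ d, a, b, c⟩).seq
        ((h (t, x)).2 d a b c))))))).mono (by lia)
  | nonterminal X =>
    have h₁ : tsize (X, x) ≤ tsize ((Symbol.nonterminal X : Symbol T N), x) := by
      rw [tsize_pair, tsize_pair]
      change _ ≤ (bits false ++ bits X).length + 1 + _ + 1
      simp [tsize]
      lia
    have h₂ := eval_mono q' h₁
    refine ⟨(h' _).1.trans (by lia), fun d a b c => ?_⟩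
    exact (RunIn.pop_true rfl (RunIn.pop_true rfl (RunIn.pop_false rfl
      ((RunIn.push .d true ⟨bits X ++ bits x ++ d, a, b, c⟩).seq
        ((h' (X, x)).2 d a b c))))).mono (by lia)

@[fun_prop]
theorem symbolElim {s : α → Symbol T N} {f : α → T → γ} {g : α → N → γ} (hs : PolyTime s)
    (hf : PolyTime fun x : α × T => f x.1 x.2) (hg : PolyTime fun x : α × N => g x.1 x.2) :
    PolyTime fun x => symbolElim (s x) (f x) (g x) :=
  (symbolElim_pair (f := fun y : T × α => f y.2 y.1) (g := fun y : N × α => g y.2 y.1)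
    (hf.comp (PolyTime.snd.pair PolyTime.fst)) (hg.comp (PolyTime.snd.pair PolyTime.fst))).comp
    (hs.pair PolyTime.id)

@[fun_prop]
theorem listElim {l : α → List β} {f : α → γ} {g : α → β → List β → γ} (hl : PolyTime l)
    (hf : PolyTime f) (hg : PolyTime fun x : α × β × List β => g x.1 x.2.1 x.2.2) :
    PolyTime fun x => listElim (l x) (f x) (g x) := by
  have h := (list_cases_pair (f := f) (g := fun y : (β × List β) × α => g y.2 y.1.1 y.1.2) hf
    (hg.comp (PolyTime.snd.pair PolyTime.fst))).comp (hl.pair PolyTime.id)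
  convert h using 2 with x
  cases l x <;> rfl

@[fun_prop]
theorem ruleMk {f : α → N} {l : α → List (Symbol T N)} (hf : PolyTime f) (hl : PolyTime l) :
    PolyTime fun x => (⟨f x, l x⟩ : ContextFreeRule T N) :=
  (of_toTree_eq (f := fun x : N × List (Symbol T N) => (⟨x.1, x.2⟩ : ContextFreeRule T N))
    fun _ => rfl).comp (hf.pair hl)

theorem ruleToPair : PolyTime fun r : ContextFreeRule T N => (r.input, r.output) :=
  of_toTree_eq fun _ => rfl

@[fun_prop]
theorem ruleInput {f : α → ContextFreeRule T N} (hf : PolyTime f) : PolyTime fun x => (f x).input :=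
  PolyTime.fst.comp (ruleToPair.comp hf)

@[fun_prop]
theorem ruleOutput {f : α → ContextFreeRule T N} (hf : PolyTime f) :
    PolyTime fun x => (f x).output :=
  PolyTime.snd.comp (ruleToPair.comp hf)

@[fun_prop]
theorem natToList {f : α → ℕ} (hf : PolyTime f) : PolyTime fun x => List.replicate (f x) () :=
  (of_toTree_eq (f := fun n : ℕ => List.replicate n ()) fun _ => rfl).comp hf

theorem unitListLength : PolyTime fun l : List Unit => l.length :=
  of_toTree_eq fun l => by
    change toTree (List.replicate l.length ()) = _
    congr 1
    exact (List.eq_replicate_iff.2 ⟨rfl, fun _ _ => rfl⟩).symm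

@[fun_prop]
theorem tail {l : α → List β} (hl : PolyTime l) : PolyTime fun x => (l x).tail := by
  have h : PolyTime fun x => StackProgram.listElim (l x) [] (fun _ t => t) := by fun_prop
  convert h using 2 with x
  cases l x <;> rfl

@[fun_prop]
theorem decide_eq_nil {l : α → List β} (hl : PolyTime l) : PolyTime fun x => decide (l x = []) := by
  have h : PolyTime fun x => StackProgram.listElim (l x) true (fun _ _ => false) := by fun_prop
  convert h using 2 with x
  cases l x <;> rfl

@[fun_prop]
theorem and {f g : α → Bool} (hf : PolyTime f) (hg : PolyTime g) : PolyTime fun x => f x && g x := by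
  have h : PolyTime fun x => cond (f x) (g x) false := by fun_prop
  convert h using 2 with x
  cases f x <;> rfl

@[fun_prop]
theorem or {f g : α → Bool} (hf : PolyTime f) (hg : PolyTime g) : PolyTime fun x => f x || g x := by
  have h : PolyTime fun x => cond (f x) true (g x) := by fun_prop
  convert h using 2 with x
  cases f x <;> rfl

@[fun_prop]
theorem not {f : α → Bool} (hf : PolyTime f) : PolyTime fun x => !(f x) := by
  have h : PolyTime fun x => cond (f x) false true := by fun_prop
  convert h using 2 with x
  cases f x <;> rfl

/-! ### Iteration over lists -/

/-- Iteration over a list where an invariant ensures that the value grows only by a polynomial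
amount in each step. -/
theorem foldl_of_invariant {l : α → List β} {s : α → γ} {step : α → γ → β → γ}
    (I : α → γ → Prop) (hl : PolyTime l) (hs : PolyTime s)
    (hstep : PolyTime fun x : α × γ × β => step x.1 x.2.1 x.2.2) (h₀ : ∀ x, I x (s x))
    (hI : ∀ x t, I x t → ∀ y ∈ l x, I x (step x t y))
    (hq : ∃ q : Polynomial ℕ, ∀ x t, I x t → ∀ y ∈ l x,
      tsize (step x t y) ≤ tsize t + q.eval (tsize (x, y))) :
    PolyTime fun x => (l x).foldl (step x) (s x) := by
  obtain ⟨q, hq⟩ := hq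
  obtain ⟨ql, hql⟩ := hl.size
  obtain ⟨qs, hqs⟩ := hs.size
  -- Growth is additive with the same summand in all rounds, so the total is a product of
  -- polynomials; multiplicative growth could become exponential.
  have key : ∀ x (l' : List β) t, (∀ y ∈ l', y ∈ l x) → I x t →
      tsize (l'.foldl (step x) t) ≤
        tsize t + l'.length * q.eval (tsize x + ql.eval (tsize x) + 1) := by
    intro x l'
    induction l' with
    | nil => simp
    | cons y l' ih =>
      intro t hl' ht
      have hy := hl' y (by simp)
      refine (ih _ (fun z hz => hl' z (by simp [hz])) (hI x t ht y hy)).trans ?_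
      have h₁ := hq x t ht y hy
      have h₂ : q.eval (tsize (x, y)) ≤ q.eval (tsize x + ql.eval (tsize x) + 1) := eval_mono _ (by
        have := tsize_le_of_mem hy
        have := hql x
        rw [tsize_pair]
        lia)
      rw [List.length_cons, Nat.add_mul]
      lia
  -- The parameter `x` travels inside the iterated value, because the step in `foldl_of_bound` has
  -- no access to it.
  have hpair : ∀ x (l' : List β) t,
      l'.foldl (fun (u : α × γ) y => (u.1, step u.1 u.2 y)) (x, t) =
        (x, l'.foldl (step x) t) := by
    intro x l'
    induction l' with
    | nil => simp
    | cons y l' ih => intro t; simp [ih]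
  have h := PolyTime.snd.comp (foldl_of_bound (s := fun x => (x, s x))
    (step := fun (u : α × γ) y => (u.1, step u.1 u.2 y)) hl (PolyTime.id.pair hs)
    ((PolyTime.fst.comp PolyTime.fst).pair (hstep.comp ((PolyTime.fst.comp PolyTime.fst).pair
      ((PolyTime.snd.comp PolyTime.fst).pair PolyTime.snd))))
    ⟨.X + qs + ql * q.comp (.X + ql + 1) + 1, fun x l' hl' => by
      rw [hpair, tsize_pair]
      have h₁ := key x l' (s x) (fun y hy => hl'.subset hy) (h₀ x)
      have h₂ := hqs x
      have h₃ := length_lt_tsize (l x)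
      have h₄ := hl'.length_le
      have h₅ := hql x
      have h₆ := Nat.mul_le_mul_right (q.eval (tsize x + ql.eval (tsize x) + 1))
        (show l'.length ≤ ql.eval (tsize x) by lia)
      simp only [Polynomial.eval_add, Polynomial.eval_mul, Polynomial.eval_comp,
        Polynomial.eval_X, Polynomial.eval_one]
      lia⟩)
  simpa only [hpair] using h

/-- Iteration over a list where the value grows only by a polynomial amount in each step. -/
theorem foldl {l : α → List β} {s : α → γ} {step : α → γ → β → γ} (hl : PolyTime l)
    (hs : PolyTime s) (hstep : PolyTime fun x : α × γ × β => step x.1 x.2.1 x.2.2)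
    (hq : ∃ q : Polynomial ℕ, ∀ x t y, tsize (step x t y) ≤ tsize t + q.eval (tsize (x, y))) :
    PolyTime fun x => (l x).foldl (step x) (s x) :=
  let ⟨q, hq⟩ := hq
  foldl_of_invariant (fun _ _ => True) hl hs hstep (fun _ => trivial) (fun _ _ _ _ _ => trivial)
    ⟨q, fun x t _ y _ => hq x t y⟩

@[fun_prop]
theorem reverse {l : α → List β} (hl : PolyTime l) : PolyTime fun x => (l x).reverse := by
  have h : PolyTime fun x => (l x).foldl (fun t y => y :: t) [] := by
    refine foldl (step := fun _ t y => y :: t) hl (by fun_prop) (by fun_prop)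
      ⟨.X, fun x t y => ?_⟩
    rw [tsize_cons, tsize_pair, Polynomial.eval_X]
    lia
  convert h using 2 with x
  simp

theorem foldr {l : α → List β} {s : α → γ} {step : α → β → γ → γ} (hl : PolyTime l)
    (hs : PolyTime s) (hstep : PolyTime fun x : α × γ × β => step x.1 x.2.2 x.2.1)
    (hq : ∃ q : Polynomial ℕ, ∀ x t y, tsize (step x y t) ≤ tsize t + q.eval (tsize (x, y))) :
    PolyTime fun x => (l x).foldr (step x) (s x) := by
  simpa only [List.foldl_reverse] using foldl (step := fun x t y => step x y t) hl.reverse hs hstep hq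

@[fun_prop]
theorem append {l l' : α → List β} (hl : PolyTime l) (hl' : PolyTime l') :
    PolyTime fun x => l x ++ l' x := by
  have h : PolyTime fun x => (l x).foldr (fun y t => y :: t) (l' x) := by
    refine foldr (step := fun _ y t => y :: t) hl hl' (by fun_prop) ⟨.X, fun x t y => ?_⟩
    rw [tsize_cons, tsize_pair, Polynomial.eval_X]
    lia
  simpa using h

@[fun_prop]
theorem flatMap {l : α → List β} {f : α → β → List γ} (hl : PolyTime l)
    (hf : PolyTime fun x : α × β => f x.1 x.2) : PolyTime fun x => (l x).flatMap (f x) := by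
  have h : PolyTime fun x => (l x).foldr (fun y t => f x y ++ t) [] := by
    obtain ⟨q, hq⟩ := hf.size
    refine foldr (step := fun x y t => f x y ++ t) hl (by fun_prop) ?_ ⟨q, fun x t y => ?_⟩
    · exact (hf.comp (PolyTime.fst.pair (PolyTime.snd.comp PolyTime.snd))).append
        (PolyTime.fst.comp PolyTime.snd)
    · have h₁ := tsize_append (f x y) t
      have h₂ := hq (x, y)
      dsimp only at h₂
      lia
  convert h using 2 with x
  induction l x with
  | nil => rfl
  | cons y l ih => simp [ih]

@[fun_prop]
theorem map {l : α → List β} {f : α → β → γ} (hl : PolyTime l)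
    (hf : PolyTime fun x : α × β => f x.1 x.2) : PolyTime fun x => (l x).map (f x) := by
  simpa only [List.map_eq_flatMap] using flatMap (f := fun x y => [f x y]) hl
    (hf.cons (PolyTime.const []))

@[fun_prop]
theorem length {l : α → List β} (hl : PolyTime l) : PolyTime fun x => (l x).length := by
  simpa using unitListLength.comp (hl.map (f := fun _ _ => ()) (PolyTime.const ()))

@[fun_prop]
theorem add {f g : α → ℕ} (hf : PolyTime f) (hg : PolyTime g) : PolyTime fun x => f x + g x := by
  simpa using (hf.natToList.append hg.natToList).length

@[fun_prop]
theorem replicate {f : α → ℕ} {g : α → β} (hf : PolyTime f) (hg : PolyTime g) :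
    PolyTime fun x => List.replicate (f x) (g x) := by
  simpa using hf.natToList.map (f := fun x _ => g x) (hg.comp PolyTime.fst)

@[fun_prop]
theorem tails {l : α → List β} (hl : PolyTime l) : PolyTime fun x => (l x).tails := by
  have h : PolyTime fun x => (l x).foldl
      (fun (t : List β × List (List β)) _ => (t.1.tail, t.1 :: t.2)) (l x, []) := by
    obtain ⟨q, hq⟩ := hl.size
    -- Each round copies the current rest. The invariant that this rest is no larger than the
    -- original list bounds the growth.
    refine foldl_of_invariant (step := fun _ (t : List β × List (List β)) _ => (t.1.tail, t.1 :: t.2))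
      (fun x t => tsize t.1 ≤ tsize (l x)) hl (by fun_prop) (by fun_prop) (fun x => le_rfl)
      (fun x t ht y _ => (tsize_tail_le _).trans ht) ⟨q + 1, fun x t ht y _ => ?_⟩
    obtain ⟨u, v⟩ := t
    have h₁ := tsize_tail_le u
    have h₂ := hq x
    have h₃ : q.eval (tsize x) ≤ q.eval (tsize (x, y)) := eval_mono _ (by rw [tsize_pair]; lia)
    rw [tsize_pair, tsize_pair, tsize_cons, Polynomial.eval_add, Polynomial.eval_one]
    dsimp only at ht
    lia
  have h' : PolyTime fun x => ([] :: ((l x).foldl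
      (fun (t : List β × List (List β)) _ => (t.1.tail, t.1 :: t.2)) (l x, [])).2).reverse := by
    fun_prop
  simpa only [foldl_tails, List.reverse_nil, List.nil_append] using h'

@[fun_prop]
theorem range {f : α → ℕ} (hf : PolyTime f) : PolyTime fun x => List.range (f x) := by
  simp only [← map_length_tails]
  fun_prop

theorem all {l : α → List β} {f : α → β → Bool} (hl : PolyTime l)
    (hf : PolyTime fun x : α × β => f x.1 x.2) : PolyTime fun x => (l x).all (f x) := by
  -- Each element that fails the test contributes a unit, so emptiness means that none fails.
  have h : PolyTime fun x => decide ((l x).flatMap (fun y => cond (f x y) [] [()]) = []) := by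
    fun_prop
  convert h using 2 with x
  rw [Bool.eq_iff_iff]
  simp [List.flatMap_eq_nil_iff]
  refine forall₂_congr fun y _ => ?_
  cases f x y <;> simp

theorem any {l : α → List β} {f : α → β → Bool} (hl : PolyTime l)
    (hf : PolyTime fun x : α × β => f x.1 x.2) : PolyTime fun x => (l x).any (f x) := by
  simpa only [List.not_all_eq_any_not, Bool.not_not] using
    (all (f := fun x y => !f x y) hl hf.not).not

end PolyTime

/-! ### Equality -/

/-- Equality of elements can be decided in polynomial time. -/
class PolyTimeEq (α : Type) [ToTree α] [DecidableEq α] : Prop where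
  decide_eq : PolyTime fun x : α × α => decide (x.1 = x.2)

namespace PolyTime

variable {α β γ δ T N : Type} [ToTree α] [ToTree β] [ToTree γ] [ToTree δ] [ToTree T] [ToTree N]

@[fun_prop]
theorem decide_eq [DecidableEq β] [PolyTimeEq β] {f g : α → β} (hf : PolyTime f) (hg : PolyTime g) :
    PolyTime fun x => decide (f x = g x) :=
  PolyTimeEq.decide_eq.comp (hf.pair hg)

instance : PolyTimeEq Unit where
  decide_eq := by simpa using PolyTime.const true

instance : PolyTimeEq Bool where
  decide_eq := by
    have h : PolyTime fun x : Bool × Bool => cond x.1 x.2 (!x.2) := by fun_prop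
    convert h using 2 with x
    rcases x with ⟨_ | _, _ | _⟩ <;> rfl

instance [DecidableEq α] [DecidableEq β] [PolyTimeEq α] [PolyTimeEq β] : PolyTimeEq (α × β) where
  decide_eq := by
    have h : PolyTime fun x : (α × β) × (α × β) =>
      decide (x.1.1 = x.2.1) && decide (x.1.2 = x.2.2) := by fun_prop
    convert h using 2 with x
    rw [Bool.eq_iff_iff]
    simp [Prod.ext_iff]

instance [DecidableEq α] [PolyTimeEq α] : PolyTimeEq (List α) where
  decide_eq := by
    have h : PolyTime fun x : List α × List α =>
        x.1.foldl (fun (t : List α × Bool) y =>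
          StackProgram.listElim t.1 ([], false) fun z r => (r, t.2 && decide (y = z))) (x.2, true) := by
      refine foldl (step := fun _ (t : List α × Bool) y =>
          StackProgram.listElim t.1 ([], false) fun z r => (r, t.2 && decide (y = z)))
        (by fun_prop) (by fun_prop) (by fun_prop) ⟨10, fun x t y => ?_⟩
      rcases t with ⟨_ | ⟨z, r⟩, b⟩
      · change tsize (([] : List α), false) ≤ _
        rw [tsize_pair, tsize_pair]
        have := tsize_bool_le false
        simp
        lia
      · change tsize (r, (b && decide (y = z))) ≤ _
        rw [tsize_pair, tsize_pair, tsize_cons]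
        have := tsize_bool_le (b && decide (y = z))
        simp
        lia
    have h' := (h.snd_comp).and h.fst_comp.decide_eq_nil
    simpa only [foldl_decide_eq, Bool.true_and] using h'

instance : PolyTimeEq ℕ where
  decide_eq := by
    have h : PolyTime fun x : ℕ × ℕ =>
      decide (List.replicate x.1 () = List.replicate x.2 ()) := by fun_prop
    simpa using h

instance [DecidableEq T] [DecidableEq N] [PolyTimeEq T] [PolyTimeEq N] :
    PolyTimeEq (Symbol T N) where
  decide_eq := by
    have h : PolyTime fun x : Symbol T N × Symbol T N =>
      StackProgram.symbolElim x.1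
        (fun a => StackProgram.symbolElim x.2 (fun b => decide (a = b)) fun _ => false)
        (fun a => StackProgram.symbolElim x.2 (fun _ => false) fun b => decide (a = b)) := by
      fun_prop
    convert h using 2 with x
    rcases x with ⟨_ | _, _ | _⟩ <;> simp [StackProgram.symbolElim]

instance [DecidableEq T] [DecidableEq N] [PolyTimeEq T] [PolyTimeEq N] :
    PolyTimeEq (ContextFreeRule T N) where
  decide_eq := by
    have h : PolyTime fun x : ContextFreeRule T N × ContextFreeRule T N =>
      decide (x.1.input = x.2.input) && decide (x.1.output = x.2.output) := by fun_prop
    convert h using 2 with x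
    rw [Bool.eq_iff_iff]
    simp [ContextFreeRule.ext_iff]

/-! ### Membership, removal of duplicates and positions -/

@[fun_prop]
theorem decide_mem [DecidableEq β] [PolyTimeEq β] {f : α → β} {l : α → List β} (hf : PolyTime f)
    (hl : PolyTime l) : PolyTime fun x => decide (f x ∈ l x) := by
  have h : PolyTime fun x => (l x).any fun y => decide (y = f x) :=
    any hl (by fun_prop)
  convert h using 2 with x
  rw [Bool.eq_iff_iff]
  simp

@[fun_prop]
theorem dedup [DecidableEq β] [PolyTimeEq β] {l : α → List β} (hl : PolyTime l) :
    PolyTime fun x => (l x).dedup := by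
  have h : PolyTime fun x => (l x).foldr (fun y t => if y ∈ t then t else y :: t) [] := by
    refine foldr (step := fun _ y t => if y ∈ t then t else y :: t) hl (by fun_prop) (by fun_prop)
      ⟨.X, fun x t y => ?_⟩
    split_ifs
    · lia
    · rw [tsize_cons, tsize_pair, Polynomial.eval_X]
      lia
  convert h using 2 with x
  induction l x with
  | nil => rfl
  | cons y l ih =>
    rw [List.foldr_cons, ← ih]
    split_ifs with hy
    · exact List.dedup_cons_of_mem' hy
    · exact List.dedup_cons_of_notMem' hy

@[fun_prop]
theorem idxOf [DecidableEq β] [PolyTimeEq β] {f : α → β} {l : α → List β} (hf : PolyTime f)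
    (hl : PolyTime l) : PolyTime fun x => (l x).idxOf (f x) := by
  have h : PolyTime fun x => (l x).foldl (fun (t : Bool × ℕ) z =>
      if t.1 || decide (z = f x) then (true, t.2) else (false, t.2 + 1)) (false, 0) := by
    refine foldl (step := fun x (t : Bool × ℕ) z =>
      if t.1 || decide (z = f x) then (true, t.2) else (false, t.2 + 1)) hl (by fun_prop) ?_
      ⟨10, fun x t y => ?_⟩
    · simp only [← Bool.cond_eq_ite]
      fun_prop
    · obtain ⟨u, n⟩ := t
      have h₁ := tsize_bool_le true
      have h₂ := tsize_bool_le false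
      have h₃ := tsize_succ n
      split_ifs <;> rw [tsize_pair, tsize_pair] <;> simp <;> lia
  simpa only [foldl_idxOf, Nat.zero_add] using h.snd_comp

end PolyTime
end StackProgram

/-! ## Parses of context-free grammars -/

namespace ContextFreeGrammar

variable {T N T' N' : Type}

/-- `Parses R s w ρ`: with the rules `R`, the word `w` is derived from `s` by a forest of derivation
trees in which the right-hand sides of the rules, listed in preorder, are `ρ`. -/
inductive Parses (R : Set (ContextFreeRule T N)) :
    List (Symbol T N) → List T → List (List (Symbol T N)) → Prop
  | nil : Parses R [] [] []
  | terminal (a : T) {s w ρ} (h : Parses R s w ρ) : Parses R (.terminal a :: s) (a :: w) ρ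
  | nonterminal (X : N) {α s w₁ w₂ ρ₁ ρ₂} (hr : ⟨X, α⟩ ∈ R) (h₁ : Parses R α w₁ ρ₁)
      (h₂ : Parses R s w₂ ρ₂) : Parses R (.nonterminal X :: s) (w₁ ++ w₂) (α :: (ρ₁ ++ ρ₂))

theorem parses_nil_iff {R : Set (ContextFreeRule T N)} {w : List T} {ρ : List (List (Symbol T N))} :
    Parses R [] w ρ ↔ w = [] ∧ ρ = [] := by
  constructor
  · rintro ⟨⟩
    exact ⟨rfl, rfl⟩
  · rintro ⟨rfl, rfl⟩
    exact .nil

theorem parses_terminal_iff {R : Set (ContextFreeRule T N)} {a : T} {s : List (Symbol T N)}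
    {w : List T} {ρ : List (List (Symbol T N))} :
    Parses R (.terminal a :: s) w ρ ↔ ∃ w', w = a :: w' ∧ Parses R s w' ρ := by
  constructor
  · rintro (_ | ⟨_, h⟩)
    exact ⟨_, rfl, h⟩
  · rintro ⟨w', rfl, h⟩
    exact .terminal a h

theorem parses_nonterminal_iff {R : Set (ContextFreeRule T N)} {X : N} {s : List (Symbol T N)}
    {w : List T} {ρ : List (List (Symbol T N))} :
    Parses R (.nonterminal X :: s) w ρ ↔ ∃ α w₁ w₂ ρ₁ ρ₂, w = w₁ ++ w₂ ∧ ρ = α :: (ρ₁ ++ ρ₂) ∧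
      ⟨X, α⟩ ∈ R ∧ Parses R α w₁ ρ₁ ∧ Parses R s w₂ ρ₂ := by
  constructor
  · rintro (_ | _ | ⟨_, hr, h₁, h₂⟩)
    exact ⟨_, _, _, _, _, rfl, rfl, hr, h₁, h₂⟩
  · rintro ⟨α, w₁, w₂, ρ₁, ρ₂, rfl, rfl, hr, h₁, h₂⟩
    exact .nonterminal X hr h₁ h₂

theorem parses_singleton_iff {R : Set (ContextFreeRule T N)} {X : N} {w : List T}
    {ρ : List (List (Symbol T N))} :
    Parses R [.nonterminal X] w ρ ↔ ∃ α ρ', ρ = α :: ρ' ∧ ⟨X, α⟩ ∈ R ∧ Parses R α w ρ' := by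
  simp only [parses_nonterminal_iff, parses_nil_iff]
  constructor
  · rintro ⟨α, w₁, w₂, ρ₁, ρ₂, rfl, rfl, hr, h, rfl, rfl⟩
    exact ⟨α, ρ₁, by simp, hr, by simpa using h⟩
  · rintro ⟨α, ρ', rfl, hr, h⟩
    exact ⟨α, w, [], ρ', [], by simp, by simp, hr, h, rfl, rfl⟩

/-- The right-hand sides determine the derived word, and no list of right-hand sides is a proper
prefix of another one. -/
theorem Parses.eq_of_append_eq {R : Set (ContextFreeRule T N)} {s : List (Symbol T N)}
    {w w' : List T} {ρ ρ' u u' : List (List (Symbol T N))} (h : Parses R s w ρ)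
    (h' : Parses R s w' ρ') (he : ρ ++ u = ρ' ++ u') : w = w' ∧ ρ = ρ' ∧ u = u' := by
  induction h generalizing w' ρ' u u' with
  | nil =>
    obtain ⟨rfl, rfl⟩ := parses_nil_iff.1 h'
    exact ⟨rfl, rfl, he⟩
  | terminal a h ih =>
    obtain ⟨w', rfl, h₁⟩ := parses_terminal_iff.1 h'
    obtain ⟨rfl, rfl, rfl⟩ := ih h₁ he
    exact ⟨rfl, rfl, rfl⟩
  | nonterminal X hr h₁ h₂ ih₁ ih₂ =>
    obtain ⟨α, w₁, w₂, ρ₁, ρ₂, rfl, rfl, hr', h₁', h₂'⟩ := parses_nonterminal_iff.1 h'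
    simp only [List.cons_append, List.append_assoc, List.cons.injEq] at he
    obtain ⟨rfl, he⟩ := he
    obtain ⟨rfl, rfl, he₂⟩ := ih₁ h₁' he
    obtain ⟨rfl, rfl, rfl⟩ := ih₂ h₂' he₂
    exact ⟨rfl, rfl, rfl⟩

/-- Every word has at most one parse from `s`. -/
def UniqueParses (R : Set (ContextFreeRule T N)) (s : List (Symbol T N)) : Prop :=
  ∀ w ρ ρ', Parses R s w ρ → Parses R s w ρ' → ρ = ρ'

/-! ### Parses and forests -/

/-- The right-hand sides of the rules of a forest in preorder. -/
def Forest.preorder {g : ContextFreeGrammar T} :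
    {s : List (Symbol T g.NT)} → g.Forest s → List (List (Symbol T g.NT))
  | _, .nil => []
  | _, .leaf _ rest => rest.preorder
  | _, .node _ α _ children rest => α :: (children.preorder ++ rest.preorder)

theorem Forest.parses {g : ContextFreeGrammar T} {s : List (Symbol T g.NT)} (F : g.Forest s) :
    Parses {r | r ∈ g.rules} s F.yield F.preorder := by
  induction F with
  | nil => exact .nil
  | leaf a rest ih => exact .terminal a ih
  | node X α h children rest ih₁ ih₂ => exact .nonterminal X h ih₁ ih₂

theorem Parses.exists_forest {g : ContextFreeGrammar T} {s : List (Symbol T g.NT)} {w : List T}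
    {ρ : List (List (Symbol T g.NT))} (h : Parses {r | r ∈ g.rules} s w ρ) :
    ∃ F : g.Forest s, F.yield = w ∧ F.preorder = ρ := by
  induction h with
  | nil => exact ⟨.nil, rfl, rfl⟩
  | terminal a h ih =>
    obtain ⟨F, rfl, rfl⟩ := ih
    exact ⟨.leaf a F, rfl, rfl⟩
  | nonterminal X hr h₁ h₂ ih₁ ih₂ =>
    obtain ⟨F₁, rfl, rfl⟩ := ih₁
    obtain ⟨F₂, rfl, rfl⟩ := ih₂
    exact ⟨.node X _ hr F₁ F₂, rfl, rfl⟩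

/-- The label of a node is prescribed by its position, so the right-hand side fixes its rule. The
trailing lists make the induction pass through concatenated preorders. -/
theorem Forest.eq_of_preorder_append_eq {g : ContextFreeGrammar T} {s : List (Symbol T g.NT)}
    (F F' : g.Forest s) {u u' : List (List (Symbol T g.NT))}
    (h : F.preorder ++ u = F'.preorder ++ u') : F = F' ∧ u = u' := by
  induction F generalizing u u' with
  | nil =>
    cases F'
    exact ⟨rfl, h⟩
  | leaf a rest ih =>
    cases F' with
    | leaf _ rest' =>
      obtain ⟨rfl, rfl⟩ := ih rest' h
      exact ⟨rfl, rfl⟩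
  | node X α hr children rest ih₁ ih₂ =>
    cases F' with
    | node _ α' hr' children' rest' =>
      simp only [Forest.preorder, List.cons_append, List.append_assoc, List.cons.injEq] at h
      obtain ⟨rfl, h⟩ := h
      obtain ⟨rfl, h₂⟩ := ih₁ children' h
      obtain ⟨rfl, rfl⟩ := ih₂ rest' h₂
      exact ⟨rfl, rfl⟩

theorem mem_language_iff_exists_parses (g : ContextFreeGrammar T) (w : List T) :
    w ∈ g.language ↔ ∃ ρ, Parses {r | r ∈ g.rules} [.nonterminal g.initial] w ρ := by
  rw [mem_language_iff_exists_tree]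
  constructor
  · rintro ⟨t, rfl⟩
    exact ⟨_, t.parses⟩
  · rintro ⟨ρ, h⟩
    obtain ⟨F, h, -⟩ := h.exists_forest
    exact ⟨F, h⟩

/-- Unambiguity becomes a statement about lists and sets of rules, independent of the dependent type
of forests, and can be transported along renamings. -/
theorem unambiguous_iff_uniqueParses (g : ContextFreeGrammar T) :
    g.Unambiguous ↔ UniqueParses {r | r ∈ g.rules} [.nonterminal g.initial] := by
  constructor
  · intro h w ρ ρ' hρ hρ'
    obtain ⟨F, h₁, rfl⟩ := hρ.exists_forest
    obtain ⟨F', h₁', rfl⟩ := hρ'.exists_forest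
    rw [(h w ((mem_language_iff_exists_tree g w).2 ⟨F, h₁⟩)).unique h₁ h₁']
  · intro h w hw
    obtain ⟨t, rfl⟩ := (mem_language_iff_exists_tree g w).1 hw
    refine ⟨t, rfl, fun t' ht' => ?_⟩
    have h₁ := t'.parses
    rw [ht'] at h₁
    have h₂ := h _ _ _ h₁ t.parses
    exact (Forest.eq_of_preorder_append_eq t' t (u := []) (u' := []) (by rw [h₂])).1

/-! ### Renaming of symbols -/

/-- Rename a symbol. -/
def mapSymbol (φ : T → T') (ψ : N → N') : Symbol T N → Symbol T' N'
  | .terminal a => .terminal (φ a)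
  | .nonterminal X => .nonterminal (ψ X)

/-- Rename the symbols of a rule. -/
def mapRule (φ : T → T') (ψ : N → N') (r : ContextFreeRule T N) : ContextFreeRule T' N' :=
  ⟨ψ r.input, r.output.map (mapSymbol φ ψ)⟩

/-- The terminals and nonterminals that occur are in the given sets. -/
def SymbolsIn (A : Set T) (B : Set N) (s : List (Symbol T N)) : Prop :=
  (∀ a, .terminal a ∈ s → a ∈ A) ∧ ∀ X, .nonterminal X ∈ s → X ∈ B

variable {R : Set (ContextFreeRule T N)} {φ : T → T'} {ψ : N → N'}

theorem Parses.map {s : List (Symbol T N)} {w : List T} {ρ : List (List (Symbol T N))}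
    (h : Parses R s w ρ) :
    Parses (mapRule φ ψ '' R) (s.map (mapSymbol φ ψ)) (w.map φ)
      (ρ.map (List.map (mapSymbol φ ψ))) := by
  induction h with
  | nil => exact .nil
  | terminal a h ih => exact .terminal _ ih
  | nonterminal X hr h₁ h₂ ih₁ ih₂ =>
    simp only [List.map_cons, List.map_append]
    exact .nonterminal _ ⟨_, hr, rfl⟩ ih₁ ih₂

/-- Injectivity matters only for nonterminals, where a renamed rule must be applied to the symbol it
came from. It is required only on occurring symbols, since numbering by position is injective only
there. The letters are shown to lie in `A` for the later comparison of words. -/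
theorem Parses.exists_of_map {A : Set T} {B : Set N} (hψ : Set.InjOn ψ B)
    (hR : ∀ r ∈ R, r.input ∈ B ∧ SymbolsIn A B r.output) {s' : List (Symbol T' N')}
    {w' : List T'} {ρ' : List (List (Symbol T' N'))} (h : Parses (mapRule φ ψ '' R) s' w' ρ')
    {s : List (Symbol T N)} (hs : SymbolsIn A B s) (he : s' = s.map (mapSymbol φ ψ)) :
    ∃ w ρ, w' = w.map φ ∧ ρ' = ρ.map (List.map (mapSymbol φ ψ)) ∧ Parses R s w ρ ∧
      ∀ a ∈ w, a ∈ A := by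
  induction h generalizing s with
  | nil =>
    obtain rfl := List.map_eq_nil_iff.1 he.symm
    exact ⟨[], [], rfl, rfl, .nil, by simp⟩
  | terminal a h ih =>
    obtain ⟨x, s, rfl, hx, rfl⟩ := List.map_eq_cons_iff.1 he.symm
    obtain _ | X := x
    · rename_i b
      simp only [mapSymbol, Symbol.terminal.injEq] at hx
      obtain ⟨w, ρ, rfl, rfl, hw, hA⟩ := ih (s := s)
        ⟨fun a ha => hs.1 a (by simp [ha]), fun a ha => hs.2 a (by simp [ha])⟩ rfl
      refine ⟨b :: w, ρ, by simp [hx], rfl, .terminal b hw, ?_⟩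
      simpa using ⟨hs.1 b (by simp), hA⟩
    · simp [mapSymbol] at hx
  | nonterminal X hr h₁ h₂ ih₁ ih₂ =>
    obtain ⟨x, s, rfl, hx, rfl⟩ := List.map_eq_cons_iff.1 he.symm
    obtain a | Y := x
    · simp [mapSymbol] at hx
    · simp only [mapSymbol, Symbol.nonterminal.injEq] at hx
      obtain ⟨⟨Z, β⟩, hr, he⟩ := hr
      simp only [mapRule, ContextFreeRule.mk.injEq] at he
      obtain ⟨h₃, rfl⟩ := he
      obtain rfl : Z = Y := hψ (hR _ hr).1 (hs.2 Y (by simp)) (h₃.trans hx.symm)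
      obtain ⟨w₁, ρ₁, rfl, rfl, hw₁, hA₁⟩ := ih₁ (hR _ hr).2 rfl
      obtain ⟨w₂, ρ₂, rfl, rfl, hw₂, hA₂⟩ := ih₂ (s := s)
        ⟨fun a ha => hs.1 a (by simp [ha]), fun a ha => hs.2 a (by simp [ha])⟩ rfl
      refine ⟨w₁ ++ w₂, β :: (ρ₁ ++ ρ₂), by simp, by simp, .nonterminal Z hr hw₁ hw₂, ?_⟩
      intro a ha
      rcases List.mem_append.1 ha with ha | ha
      · exact hA₁ a ha
      · exact hA₂ a ha

theorem _root_.List.eq_of_map_eq_of_injOn {α β : Type*} {f : α → β} {A : Set α}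
    (hf : Set.InjOn f A) {l l' : List α} (hl : ∀ x ∈ l, x ∈ A) (hl' : ∀ x ∈ l', x ∈ A)
    (h : l.map f = l'.map f) : l = l' := by
  induction l generalizing l' with
  | nil => exact (List.map_eq_nil_iff.1 h.symm).symm
  | cons x l ih =>
    obtain ⟨y, l', rfl, hy, h⟩ := List.map_eq_cons_iff.1 h.symm
    rw [hf (hl x (by simp)) (hl' y (by simp)) hy.symm,
      ih (fun z hz => hl z (by simp [hz])) (fun z hz => hl' z (by simp [hz])) h.symm]

theorem UniqueParses.map {A : Set T} {B : Set N} (hφ : Set.InjOn φ A) (hψ : Set.InjOn ψ B)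
    (hR : ∀ r ∈ R, r.input ∈ B ∧ SymbolsIn A B r.output) {s : List (Symbol T N)}
    (hs : SymbolsIn A B s) (h : UniqueParses R s) :
    UniqueParses (mapRule φ ψ '' R) (s.map (mapSymbol φ ψ)) := by
  intro w ρ ρ' hρ hρ'
  obtain ⟨w₁, ρ₁, rfl, rfl, h₁, hA₁⟩ := hρ.exists_of_map hψ hR hs rfl
  obtain ⟨w₂, ρ₂, he, rfl, h₂, hA₂⟩ := hρ'.exists_of_map hψ hR hs rfl
  obtain rfl := List.eq_of_map_eq_of_injOn hφ hA₁ hA₂ he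
  rw [h _ _ _ h₁ h₂]

theorem exists_parses_map_iff {A : Set T} {B : Set N} (hφ : Set.InjOn φ A) (hψ : Set.InjOn ψ B)
    (hR : ∀ r ∈ R, r.input ∈ B ∧ SymbolsIn A B r.output) {s : List (Symbol T N)}
    (hs : SymbolsIn A B s) {w : List T} (hw : ∀ a ∈ w, a ∈ A) :
    (∃ ρ, Parses (mapRule φ ψ '' R) (s.map (mapSymbol φ ψ)) (w.map φ) ρ) ↔
      ∃ ρ, Parses R s w ρ := by
  constructor
  · rintro ⟨ρ, h⟩
    obtain ⟨w₁, ρ₁, he, rfl, h₁, hA₁⟩ := h.exists_of_map hψ hR hs rfl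
    obtain rfl := List.eq_of_map_eq_of_injOn hφ hw hA₁ he
    exact ⟨ρ₁, h₁⟩
  · rintro ⟨ρ, h⟩
    exact ⟨_, h.map⟩

end ContextFreeGrammar

/-! ## The grammar of runs -/

namespace InclusionProblems

open ContextFreeGrammar StackProgram

/-- Transitions `(p, a, q)`, which are the letters of the words that describe runs. -/
abbrev Edge := ℕ × ℕ × ℕ

/-- Nonterminals of the grammar of runs. -/
abbrev RunNT := ℕ × ℕ × List (Symbol ℕ ℕ) × ℕ

/-- The nonterminal for the runs from `p` to `q` whose labels form a word derived from `α`. -/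
def inner (p : ℕ) (α : List (Symbol ℕ ℕ)) (q : ℕ) : RunNT := (0, p, α, q)

/-- The nonterminal for the words that are not runs from `q` to the final state. -/
def coRun (q : ℕ) : RunNT := (1, q, [], 0)

/-- The starting nonterminal. -/
def runStart : RunNT := (2, 0, [], 0)

/-- `IsRun p w q`: the transitions in `w` form a run from `p` to `q`. -/
def IsRun (p : ℕ) : List Edge → ℕ → Prop
  | [], q => p = q
  | e :: w, q => e.1 = p ∧ IsRun e.2.2 w q

/-- Determinism gained by reading transitions instead of labels; the uniqueness of the states
guessed by the grammar rests on it. -/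
theorem IsRun.right_unique {p : ℕ} {w : List Edge} {q q' : ℕ} (h : IsRun p w q)
    (h' : IsRun p w q') : q = q' := by
  induction w generalizing p with
  | nil => exact Eq.trans (Eq.symm h) h'
  | cons e w ih => exact ih h.2 h'.2

theorem isRun_append {p : ℕ} {u v : List Edge} {q : ℕ} :
    IsRun p (u ++ v) q ↔ ∃ s, IsRun p u s ∧ IsRun s v q := by
  induction u generalizing p with
  | nil => simp [IsRun]
  | cons e u ih => simp [IsRun, ih, and_assoc]

/-- The rules of the grammar of runs. The states are `0, …, n + 2`, where `n` is the initial state,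
`n + 1` the final state and `n + 2` a state without a run to the final state; `I` lists the
suffixes of right-hand sides that are used, and `α₀` the symbols from which the labels of a run have
to be derived. The words derived from the starting nonterminal are those that are not runs from the
initial to the final state and those that are such runs with labels derived from `α₀`. -/
def runRules (n : ℕ) (E : List Edge) (R : List (ContextFreeRule ℕ ℕ))
    (I : List (List (Symbol ℕ ℕ))) (α₀ : List (Symbol ℕ ℕ)) :
    List (ContextFreeRule Edge RunNT) :=
  [⟨runStart, [.nonterminal (inner n α₀ (n + 1))]⟩, ⟨runStart, [.nonterminal (coRun n)]⟩] ++
  (List.range (n + 2)).map (fun p => ⟨inner p [] p, []⟩) ++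
  (I.flatMap fun α => listElim α [] fun x β => symbolElim x
    (fun a => E.flatMap fun e => if e.2.1 = a then
      (List.range (n + 2)).map fun q =>
        ⟨inner e.1 α q, [.terminal e, .nonterminal (inner e.2.2 β q)]⟩ else [])
    (fun X => R.flatMap fun r => if r.input = X then
      (List.range (n + 2)).flatMap fun p => (List.range (n + 2)).flatMap fun q =>
        (List.range (n + 2)).map fun s =>
          ⟨inner p α q, [.nonterminal (inner p r.output s), .nonterminal (inner s β q)]⟩ else [])) ++
  (List.range (n + 3)).flatMap fun q => (if q = n + 1 then [] else [⟨coRun q, []⟩]) ++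
    E.map fun e => ⟨coRun q, [.terminal e, .nonterminal (coRun (if e.1 = q then e.2.2 else n + 2))]⟩

variable {n : ℕ} {E : List Edge} {R : List (ContextFreeRule ℕ ℕ)}
  {I : List (List (Symbol ℕ ℕ))} {α₀ : List (Symbol ℕ ℕ)}

/-! ### The rules sorted by left-hand side -/

theorem start_mem_runRules {γ : List (Symbol Edge RunNT)} :
    ⟨runStart, γ⟩ ∈ runRules n E R I α₀ ↔
      γ = [.nonterminal (inner n α₀ (n + 1))] ∨ γ = [.nonterminal (coRun n)] := by
  simp only [runRules, List.mem_append, List.mem_flatMap, List.mem_map, List.mem_range]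
  constructor
  · rintro (((h | ⟨p, -, h⟩) | ⟨α, -, h⟩) | ⟨q, -, h | ⟨e, -, h⟩⟩)
    · simpa using h
    · simp [inner, runStart] at h
    · obtain _ | ⟨_ | _, _⟩ := α <;> simp [listElim, symbolElim, inner, runStart] at h
    · split_ifs at h <;> simp [coRun, runStart] at h
    · simp [coRun, runStart] at h
  · rintro (rfl | rfl) <;> simp

theorem coRun_mem_runRules {q : ℕ} {γ : List (Symbol Edge RunNT)} :
    ⟨coRun q, γ⟩ ∈ runRules n E R I α₀ ↔ q < n + 3 ∧ ((q ≠ n + 1 ∧ γ = []) ∨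
      ∃ e ∈ E, γ = [.terminal e, .nonterminal (coRun (if e.1 = q then e.2.2 else n + 2))]) := by
  simp only [runRules, List.mem_append, List.mem_flatMap, List.mem_map, List.mem_range]
  constructor
  · rintro (((h | ⟨p, -, h⟩) | ⟨α, -, h⟩) | ⟨q', hq, h | ⟨e, he, h⟩⟩)
    · simp [coRun, runStart] at h
    · simp [inner, coRun] at h
    · obtain _ | ⟨_ | _, _⟩ := α <;> simp [listElim, symbolElim, inner, coRun] at h
    · split_ifs at h with h' <;> simp [coRun] at h
      obtain ⟨rfl, rfl⟩ := h
      exact ⟨hq, .inl ⟨h', rfl⟩⟩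
    · simp only [ContextFreeRule.mk.injEq] at h
      obtain ⟨h₁, rfl⟩ := h
      simp only [coRun, Prod.mk.injEq, true_and, and_true] at h₁
      subst h₁
      exact ⟨hq, .inr ⟨e, he, rfl⟩⟩
  · rintro ⟨hq, ⟨h, rfl⟩ | ⟨e, he, rfl⟩⟩
    · exact .inr ⟨q, hq, .inl (by simp [h])⟩
    · exact .inr ⟨q, hq, .inr ⟨e, he, rfl⟩⟩

/-- An exhausted form stops in place, a terminal is matched by a transition with this label, and a
nonterminal guesses a rule `δ` and the state `s` where the run is cut. The guess `δ` remains visible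
in the nonterminal `inner p δ s`, from which `baseRules` recovers it. -/
theorem inner_mem_runRules {p : ℕ} {α : List (Symbol ℕ ℕ)} {q : ℕ}
    {γ : List (Symbol Edge RunNT)} :
    ⟨inner p α q, γ⟩ ∈ runRules n E R I α₀ ↔
      (α = [] ∧ p = q ∧ p < n + 2 ∧ γ = []) ∨
      (∃ e β, α = .terminal e.2.1 :: β ∧ α ∈ I ∧ e ∈ E ∧ e.1 = p ∧ q < n + 2 ∧
        γ = [.terminal e, .nonterminal (inner e.2.2 β q)]) ∨
      ∃ X β δ s, α = .nonterminal X :: β ∧ α ∈ I ∧ ⟨X, δ⟩ ∈ R ∧ p < n + 2 ∧ q < n + 2 ∧ s < n + 2 ∧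
        γ = [.nonterminal (inner p δ s), .nonterminal (inner s β q)] := by
  simp only [runRules, List.mem_append, List.mem_flatMap, List.mem_map, List.mem_range]
  constructor
  · rintro (((h | ⟨p', hp, h⟩) | ⟨α', hα, h⟩) | ⟨q', hq, h | ⟨e, he, h⟩⟩)
    · simp [inner, runStart] at h
    · simp only [inner, ContextFreeRule.mk.injEq, Prod.mk.injEq, true_and] at h
      obtain ⟨⟨rfl, rfl, rfl⟩, rfl⟩ := h
      exact .inl ⟨rfl, rfl, hp, rfl⟩
    · obtain _ | ⟨a | X, β⟩ := α'
      · simp [listElim] at h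
      · simp only [listElim, symbolElim, List.mem_flatMap] at h
        obtain ⟨e, he, h⟩ := h
        split_ifs at h with hea
        · simp only [List.mem_map, List.mem_range, inner, ContextFreeRule.mk.injEq,
            Prod.mk.injEq, true_and] at h
          obtain ⟨q', hq, ⟨rfl, rfl, rfl⟩, rfl⟩ := h
          subst hea
          exact .inr (.inl ⟨e, β, rfl, hα, he, rfl, hq, rfl⟩)
        · simp at h
      · simp only [listElim, symbolElim, List.mem_flatMap] at h
        obtain ⟨⟨Y, δ⟩, hr, h⟩ := h
        dsimp only at h
        split_ifs at h with hX
        · simp only [List.mem_flatMap, List.mem_map, List.mem_range, inner,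
            ContextFreeRule.mk.injEq, Prod.mk.injEq, true_and] at h
          obtain ⟨p', hp, q', hq, s, hs, ⟨rfl, rfl, rfl⟩, rfl⟩ := h
          subst hX
          exact .inr (.inr ⟨Y, β, δ, s, rfl, hα, hr, hp, hq, hs, rfl⟩)
        · simp at h
    · split_ifs at h with h' <;> simp [coRun, inner] at h
    · simp [coRun, inner] at h
  · rintro (⟨rfl, rfl, hp, rfl⟩ | ⟨e, β, rfl, hα, he, rfl, hq, rfl⟩ |
      ⟨X, β, δ, s, rfl, hα, hr, hp, hq, hs, rfl⟩)
    · exact .inl (.inl (.inr ⟨p, hp, rfl⟩))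
    · refine .inl (.inr ⟨_, hα, ?_⟩)
      simp only [listElim, symbolElim, List.mem_flatMap]
      exact ⟨e, he, by simpa using ⟨q, hq, rfl, rfl⟩⟩
    · refine .inl (.inr ⟨_, hα, ?_⟩)
      simp only [listElim, symbolElim, List.mem_flatMap]
      refine ⟨_, hr, ?_⟩
      simp only [if_true, List.mem_flatMap, List.mem_map, List.mem_range]
      exact ⟨p, hp, q, hq, s, hs, rfl⟩

/-! ### Parses of runs and parses of their labels -/

/-- The set of rules of the grammar of runs. -/
abbrev runRuleSet (n : ℕ) (E : List Edge) (R : List (ContextFreeRule ℕ ℕ))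
    (I : List (List (Symbol ℕ ℕ))) (α₀ : List (Symbol ℕ ℕ)) : Set (ContextFreeRule Edge RunNT) :=
  {r | r ∈ runRules n E R I α₀}

theorem parses_inner_iff {p : ℕ} {α : List (Symbol ℕ ℕ)} {q : ℕ} {w : List Edge}
    {ρ : List (List (Symbol Edge RunNT))} :
    Parses (runRuleSet n E R I α₀) [.nonterminal (inner p α q)] w ρ ↔
      (α = [] ∧ p = q ∧ p < n + 2 ∧ w = [] ∧ ρ = [[]]) ∨
      (∃ e β w' ρ', α = .terminal e.2.1 :: β ∧ α ∈ I ∧ e ∈ E ∧ e.1 = p ∧ q < n + 2 ∧ w = e :: w' ∧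
        ρ = [.terminal e, .nonterminal (inner e.2.2 β q)] :: ρ' ∧
        Parses (runRuleSet n E R I α₀) [.nonterminal (inner e.2.2 β q)] w' ρ') ∨
      ∃ X β δ s w₁ w₂ ρ₁ ρ₂, α = .nonterminal X :: β ∧ α ∈ I ∧ ⟨X, δ⟩ ∈ R ∧ p < n + 2 ∧ q < n + 2 ∧
        s < n + 2 ∧ w = w₁ ++ w₂ ∧
        ρ = [.nonterminal (inner p δ s), .nonterminal (inner s β q)] :: (ρ₁ ++ ρ₂) ∧
        Parses (runRuleSet n E R I α₀) [.nonterminal (inner p δ s)] w₁ ρ₁ ∧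
        Parses (runRuleSet n E R I α₀) [.nonterminal (inner s β q)] w₂ ρ₂ := by
  rw [parses_singleton_iff]
  constructor
  · rintro ⟨γ, ρ', rfl, hr, h⟩
    rcases inner_mem_runRules.1 hr with ⟨rfl, rfl, hp, rfl⟩ | ⟨e, β, rfl, hα, he, rfl, hq, rfl⟩ |
      ⟨X, β, δ, s, rfl, hα, hX, hp, hq, hs, rfl⟩
    · obtain ⟨rfl, rfl⟩ := parses_nil_iff.1 h
      exact .inl ⟨rfl, rfl, hp, rfl, rfl⟩
    · obtain ⟨w', rfl, h₁⟩ := parses_terminal_iff.1 h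
      exact .inr (.inl ⟨e, β, w', ρ', rfl, hα, he, rfl, hq, rfl, rfl, h₁⟩)
    · obtain ⟨γ, w₁, w₂, ρ₁, ρ₂, rfl, rfl, hγ, h₁, h₂⟩ := parses_nonterminal_iff.1 h
      exact .inr (.inr ⟨X, β, δ, s, w₁, w₂, γ :: ρ₁, ρ₂, rfl, hα, hX, hp, hq, hs, rfl, rfl,
        parses_singleton_iff.2 ⟨γ, ρ₁, rfl, hγ, h₁⟩, h₂⟩)
  · rintro (⟨rfl, rfl, hp, rfl, rfl⟩ | ⟨e, β, w', ρ', rfl, hα, he, rfl, hq, rfl, rfl, h⟩ |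
      ⟨X, β, δ, s, w₁, w₂, ρ₁, ρ₂, rfl, hα, hr, hp, hq, hs, rfl, rfl, h₁, h₂⟩)
    · exact ⟨_, _, rfl, inner_mem_runRules.2 (.inl ⟨rfl, rfl, hp, rfl⟩), .nil⟩
    · exact ⟨_, _, rfl, inner_mem_runRules.2 (.inr (.inl ⟨e, β, rfl, hα, he, rfl, hq, rfl⟩)),
        .terminal _ h⟩
    · refine ⟨_, _, rfl, inner_mem_runRules.2
        (.inr (.inr ⟨X, β, δ, s, rfl, hα, hr, hp, hq, hs, rfl⟩)), ?_⟩
      obtain ⟨γ, ρ', rfl, hγ, h₁⟩ := parses_singleton_iff.1 h₁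
      exact .nonterminal _ hγ h₁ h₂

/-- The rules of the original grammar in a parse of the grammar of runs. -/
def baseRules (ρ : List (List (Symbol Edge RunNT))) : List (List (Symbol ℕ ℕ)) :=
  ρ.filterMap fun γ => match γ with
    | [.nonterminal (_, _, δ, _), .nonterminal _] => some δ
    | _ => none

/-- Only the steps that guess a rule leave a trace in `baseRules`, and they occur in the preorder of
the original parse. Induction is on the length of `ρ`, because `parses_inner_iff` passes from single
nonterminals to single nonterminals, unlike the recursion of `Parses`. -/
theorem parses_of_parses_inner (m : ℕ) : ∀ {p : ℕ} {α : List (Symbol ℕ ℕ)} {q : ℕ} {w : List Edge}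
    {ρ : List (List (Symbol Edge RunNT))}, ρ.length < m →
    Parses (runRuleSet n E R I α₀) [.nonterminal (inner p α q)] w ρ →
    IsRun p w q ∧ (∀ e ∈ w, e ∈ E) ∧
      Parses {r | r ∈ R} α (w.map fun e => e.2.1) (baseRules ρ) := by
  induction m with
  | zero => intro _ _ _ _ _ h; simp at h
  | succ m ih =>
    intro p α q w ρ hm h
    rcases parses_inner_iff.1 h with ⟨rfl, rfl, hp, rfl, rfl⟩ |
      ⟨e, β, w', ρ', rfl, hα, he, rfl, hq, rfl, rfl, h'⟩ |
      ⟨X, β, δ, s, w₁, w₂, ρ₁, ρ₂, rfl, hα, hr, hp, hq, hs, rfl, rfl, h₁, h₂⟩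
    · exact ⟨rfl, by simp, .nil⟩
    · obtain ⟨h₁, h₂, h₃⟩ := ih (by simp at hm; lia) h'
      exact ⟨⟨rfl, h₁⟩, List.forall_mem_cons.2 ⟨he, h₂⟩, .terminal _ h₃⟩
    · simp only [List.length_cons, List.length_append] at hm
      obtain ⟨h₁₁, h₁₂, h₁₃⟩ := ih (by lia) h₁
      obtain ⟨h₂₁, h₂₂, h₂₃⟩ := ih (by lia) h₂
      refine ⟨isRun_append.2 ⟨s, h₁₁, h₂₁⟩, ?_, ?_⟩
      · intro e he
        rcases List.mem_append.1 he with he | he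
        · exact h₁₂ e he
        · exact h₂₂ e he
      · have := Parses.nonterminal X (show ⟨X, δ⟩ ∈ {r | r ∈ R} from hr) h₁₃ h₂₃
        simpa [baseRules, inner] using this

/-- Once the parse of the labels is fixed, only the cutting states remain free, and the word
dictates them. -/
theorem uniqueParses_inner (m : ℕ) : ∀ {p : ℕ} {α : List (Symbol ℕ ℕ)} {q : ℕ} {w : List Edge}
    {ρ ρ' : List (List (Symbol Edge RunNT))}, ρ.length < m →
    Parses (runRuleSet n E R I α₀) [.nonterminal (inner p α q)] w ρ →
    Parses (runRuleSet n E R I α₀) [.nonterminal (inner p α q)] w ρ' →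
    baseRules ρ = baseRules ρ' → ρ = ρ' := by
  induction m with
  | zero => intro _ _ _ _ _ _ h; simp at h
  | succ m ih =>
    intro p α q w ρ ρ' hm h h' hρ
    rcases parses_inner_iff.1 h with ⟨rfl, rfl, hp, rfl, rfl⟩ |
      ⟨e, β, w', ρ₁, rfl, hα, he, rfl, hq, rfl, rfl, h₀⟩ |
      ⟨X, β, δ, s, w₁, w₂, ρ₁, ρ₂, rfl, hα, hr, hp, hq, hs, rfl, rfl, h₁, h₂⟩
    · rcases parses_inner_iff.1 h' with ⟨-, -, -, -, rfl⟩ | ⟨e, β, _, _, h, _⟩ |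
        ⟨X, β, δ, s, _, _, _, _, h, _⟩
      · rfl
      · simp at h
      · simp at h
    · rcases parses_inner_iff.1 h' with ⟨h, _⟩ | ⟨e', β', w₁, ρ₁', h₁, -, -, -, -, h₂, rfl, h₀'⟩ |
        ⟨X, β, δ, s, _, _, _, _, h, _⟩
      · simp at h
      · obtain ⟨rfl, rfl⟩ := List.cons.inj h₂
        obtain ⟨-, rfl⟩ := List.cons.inj h₁
        rw [ih (by simp at hm; lia) h₀ h₀' (by simpa [baseRules] using hρ)]
      · simp at h
    · rcases parses_inner_iff.1 h' with ⟨h, _⟩ | ⟨e', β', _, _, h, _⟩ |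
        ⟨X', β', δ', s', w₁', w₂', ρ₁', ρ₂', hX, -, -, -, -, -, hw, rfl, h₁', h₂'⟩
      · simp at h
      · simp at h
      · obtain ⟨-, rfl⟩ := List.cons.inj hX
        have hb : δ = δ' ∧ baseRules ρ₁ ++ baseRules ρ₂ = baseRules ρ₁' ++ baseRules ρ₂' := by
          simpa [baseRules, inner] using hρ
        obtain ⟨rfl, hb⟩ := hb
        obtain ⟨hr₁, -, hp₁⟩ := parses_of_parses_inner _ (Nat.lt_succ_self _) h₁
        obtain ⟨hr₁', -, hp₁'⟩ := parses_of_parses_inner _ (Nat.lt_succ_self _) h₁'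
        -- No parse is a proper prefix of another, so both lists of base rules are cut at the same
        -- place. The first parts derive equal label words, hence `w` is cut at the same length.
        obtain ⟨hl, hb₁, hb₂⟩ := hp₁.eq_of_append_eq hp₁' hb
        obtain ⟨rfl, rfl⟩ := List.append_inj hw (by simpa using congrArg List.length hl)
        -- The guessed state is where the run on the first factor ends.
        obtain rfl := hr₁.right_unique hr₁'
        simp only [List.length_cons, List.length_append] at hm
        rw [ih (by lia) h₁ h₁' hb₁, ih (by lia) h₂ h₂' hb₂]

/-- The conditions on the transitions and the list of suffixes under which the grammar of runs
works as intended. -/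
structure RunSystem (n : ℕ) (E : List Edge) (R : List (ContextFreeRule ℕ ℕ))
    (I : List (List (Symbol ℕ ℕ))) (α₀ : List (Symbol ℕ ℕ)) : Prop where
  target_lt : ∀ e ∈ E, e.1 < n + 2 → e.2.2 < n + 2
  target_sink : ∀ e ∈ E, e.1 = n + 2 → e.2.2 = n + 2
  start_mem : α₀ ∈ I
  output_mem : ∀ r ∈ R, r.output ∈ I
  tail_mem : ∀ x β, x :: β ∈ I → β ∈ I

theorem IsRun.lt (S : RunSystem n E R I α₀) {p : ℕ} {w : List Edge} {q : ℕ} (h : IsRun p w q)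
    (hp : p < n + 2) (hw : ∀ e ∈ w, e ∈ E) : q < n + 2 := by
  induction w generalizing p with
  | nil => exact Eq.subst (motive := (· < n + 2)) h hp
  | cons e w ih =>
    exact ih h.2 (S.target_lt e (hw e (by simp)) (h.1 ▸ hp)) fun e he => hw e (by simp [he])

/-- Follow the given parse of the labels, cut the run wherever the label word is cut, and take the
state reached there as the guess. Closure of `I` under tails and right-hand sides keeps all needed
nonterminals available. -/
theorem exists_parses_inner (S : RunSystem n E R I α₀) {α : List (Symbol ℕ ℕ)} {v : List ℕ}
    {ρ : List (List (Symbol ℕ ℕ))} (h : Parses {r | r ∈ R} α v ρ) (hα : α ∈ I) {p q : ℕ}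
    {w : List Edge} (hv : v = w.map fun e => e.2.1) (hr : IsRun p w q) (hp : p < n + 2)
    (hw : ∀ e ∈ w, e ∈ E) :
    ∃ ρ', Parses (runRuleSet n E R I α₀) [.nonterminal (inner p α q)] w ρ' := by
  induction h generalizing p q w with
  | nil =>
    obtain rfl := List.map_eq_nil_iff.1 hv.symm
    exact ⟨_, parses_inner_iff.2 (.inl ⟨rfl, hr, hp, rfl, rfl⟩)⟩
  | terminal a h ih =>
    obtain ⟨e, w, rfl, rfl, rfl⟩ := List.map_eq_cons_iff.1 hv.symm
    have hq := hr.lt S hp hw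
    obtain ⟨rfl, hr⟩ := hr
    obtain ⟨ρ', h'⟩ := ih (S.tail_mem _ _ hα) rfl hr (S.target_lt e (hw e (by simp)) hp)
      fun e he => hw e (by simp [he])
    exact ⟨_, parses_inner_iff.2 (.inr (.inl ⟨e, _, w, ρ', rfl, hα, hw e (by simp), rfl, hq, rfl,
      rfl, h'⟩))⟩
  | nonterminal X hX h₁ h₂ ih₁ ih₂ =>
    obtain ⟨w₁, w₂, rfl, h₃, h₄⟩ := List.map_eq_append_iff.1 hv.symm
    have hq := hr.lt S hp hw
    obtain ⟨s, hr₁, hr₂⟩ := isRun_append.1 hr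
    have hw₁ : ∀ e ∈ w₁, e ∈ E := fun e he => hw e (by simp [he])
    have hs := hr₁.lt S hp hw₁
    obtain ⟨ρ₁', h₁'⟩ := ih₁ (S.output_mem _ hX) h₃.symm hr₁ hp hw₁
    obtain ⟨ρ₂', h₂'⟩ := ih₂ (S.tail_mem _ _ hα) h₄.symm hr₂ hs fun e he => hw e (by simp [he])
    exact ⟨_, parses_inner_iff.2 (.inr (.inr ⟨X, _, _, s, w₁, w₂, _, _, rfl, hα, hX, hp, hq, hs, rfl,
      rfl, h₁', h₂'⟩))⟩

/-! ### Words that are not accepting runs -/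

theorem not_isRun_sink (S : RunSystem n E R I α₀) {w : List Edge} (hw : ∀ e ∈ w, e ∈ E) :
    ¬ IsRun (n + 2) w (n + 1) := by
  induction w with
  | nil => simp [IsRun]
  | cons e w ih =>
    rintro ⟨h₁, h₂⟩
    rw [S.target_sink e (hw e (by simp)) h₁] at h₂
    exact ih (fun e he => hw e (by simp [he])) h₂

theorem parses_coRun_nil_iff {q : ℕ} {ρ : List (List (Symbol Edge RunNT))} :
    Parses (runRuleSet n E R I α₀) [.nonterminal (coRun q)] [] ρ ↔
      q < n + 3 ∧ q ≠ n + 1 ∧ ρ = [[]] := by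
  rw [parses_singleton_iff]
  constructor
  · rintro ⟨γ, ρ', rfl, hr, h⟩
    obtain ⟨hq, ⟨hq', rfl⟩ | ⟨e, -, rfl⟩⟩ := coRun_mem_runRules.1 hr
    · exact ⟨hq, hq', by rw [(parses_nil_iff.1 h).2]⟩
    · obtain ⟨w', h, -⟩ := parses_terminal_iff.1 h
      simp at h
  · rintro ⟨hq, hq', rfl⟩
    exact ⟨_, _, rfl, coRun_mem_runRules.2 ⟨hq, .inl ⟨hq', rfl⟩⟩, .nil⟩

theorem parses_coRun_cons_iff {q : ℕ} {e : Edge} {w : List Edge}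
    {ρ : List (List (Symbol Edge RunNT))} :
    Parses (runRuleSet n E R I α₀) [.nonterminal (coRun q)] (e :: w) ρ ↔
      ∃ ρ', q < n + 3 ∧ e ∈ E ∧
        ρ = [.terminal e, .nonterminal (coRun (if e.1 = q then e.2.2 else n + 2))] :: ρ' ∧
        Parses (runRuleSet n E R I α₀)
          [.nonterminal (coRun (if e.1 = q then e.2.2 else n + 2))] w ρ' := by
  rw [parses_singleton_iff]
  constructor
  · rintro ⟨γ, ρ', rfl, hr, h⟩
    obtain ⟨hq, ⟨hq', rfl⟩ | ⟨e', he, rfl⟩⟩ := coRun_mem_runRules.1 hr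
    · simpa using (parses_nil_iff.1 h).1
    · obtain ⟨w', hw, h⟩ := parses_terminal_iff.1 h
      obtain ⟨rfl, rfl⟩ := List.cons.inj hw
      exact ⟨ρ', hq, he, rfl, h⟩
  · rintro ⟨ρ', hq, he, rfl, h⟩
    exact ⟨_, _, rfl, coRun_mem_runRules.2 ⟨hq, .inr ⟨e, he, rfl⟩⟩, .terminal _ h⟩

/-- The nonterminals `coRun q` are the states of a deterministic automaton. It follows the word
while it continues as a run, drops to `n + 2` when it breaks, and accepts everywhere except in `n +
1`. -/
theorem exists_parses_coRun_iff (S : RunSystem n E R I α₀) {q : ℕ} (hq : q < n + 3)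
    {w : List Edge} (hw : ∀ e ∈ w, e ∈ E) :
    (∃ ρ, Parses (runRuleSet n E R I α₀) [.nonterminal (coRun q)] w ρ) ↔ ¬ IsRun q w (n + 1) := by
  induction w generalizing q with
  | nil => simp [parses_coRun_nil_iff, hq, IsRun]
  | cons e w ih =>
    have he := hw e (by simp)
    have hw' : ∀ e ∈ w, e ∈ E := fun e he => hw e (by simp [he])
    have h : (∃ ρ, Parses (runRuleSet n E R I α₀) [.nonterminal (coRun q)] (e :: w) ρ) ↔
        ∃ ρ, Parses (runRuleSet n E R I α₀)
          [.nonterminal (coRun (if e.1 = q then e.2.2 else n + 2))] w ρ := by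
      simp only [parses_coRun_cons_iff]
      constructor
      · rintro ⟨_, ρ', -, -, -, h⟩
        exact ⟨ρ', h⟩
      · rintro ⟨ρ', h⟩
        exact ⟨_, ρ', hq, he, rfl, h⟩
    rw [h]
    split_ifs with heq
    · have : e.2.2 < n + 3 := by
        rcases Nat.lt_or_ge e.1 (n + 2) with h₁ | h₁
        · have := S.target_lt e he h₁
          lia
        · have := S.target_sink e he (by lia)
          lia
      rw [ih this hw']
      simp [IsRun, heq]
    · rw [ih (by lia) hw']
      simp [IsRun, heq, not_isRun_sink S hw']

/-- The next letter, or the end of the word, leaves only one applicable rule. -/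
theorem uniqueParses_coRun (q : ℕ) :
    UniqueParses (runRuleSet n E R I α₀) [.nonterminal (coRun q)] := by
  intro w
  induction w generalizing q with
  | nil =>
    intro ρ ρ' h h'
    rw [(parses_coRun_nil_iff.1 h).2.2, (parses_coRun_nil_iff.1 h').2.2]
  | cons e w ih =>
    intro ρ ρ' h h'
    obtain ⟨ρ₁, -, -, rfl, h₁⟩ := parses_coRun_cons_iff.1 h
    obtain ⟨ρ₂, -, -, rfl, h₂⟩ := parses_coRun_cons_iff.1 h'
    rw [ih _ _ _ h₁ h₂]

/-! ### The two kinds of words combined -/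

theorem parses_runStart_iff {w : List Edge} {ρ : List (List (Symbol Edge RunNT))} :
    Parses (runRuleSet n E R I α₀) [.nonterminal runStart] w ρ ↔ ∃ ρ',
      (ρ = [.nonterminal (inner n α₀ (n + 1))] :: ρ' ∧
        Parses (runRuleSet n E R I α₀) [.nonterminal (inner n α₀ (n + 1))] w ρ') ∨
      (ρ = [.nonterminal (coRun n)] :: ρ' ∧
        Parses (runRuleSet n E R I α₀) [.nonterminal (coRun n)] w ρ') := by
  rw [parses_singleton_iff]
  constructor
  · rintro ⟨γ, ρ', rfl, hr, h⟩
    rcases start_mem_runRules.1 hr with rfl | rfl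
    · exact ⟨ρ', .inl ⟨rfl, h⟩⟩
    · exact ⟨ρ', .inr ⟨rfl, h⟩⟩
  · rintro ⟨ρ', ⟨rfl, h⟩ | ⟨rfl, h⟩⟩
    · exact ⟨_, _, rfl, start_mem_runRules.2 (.inl rfl), h⟩
    · exact ⟨_, _, rfl, start_mem_runRules.2 (.inr rfl), h⟩

theorem exists_parses_runStart_iff (S : RunSystem n E R I α₀) {w : List Edge}
    (hw : ∀ e ∈ w, e ∈ E) :
    (∃ ρ, Parses (runRuleSet n E R I α₀) [.nonterminal runStart] w ρ) ↔
      (IsRun n w (n + 1) → ∃ ρ, Parses {r | r ∈ R} α₀ (w.map fun e => e.2.1) ρ) := by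
  simp only [parses_runStart_iff]
  constructor
  · rintro ⟨_, ρ, ⟨-, h⟩ | ⟨-, h⟩⟩ hr
    · exact ⟨_, (parses_of_parses_inner _ (Nat.lt_succ_self _) h).2.2⟩
    · exact absurd hr ((exists_parses_coRun_iff S (by lia) hw).1 ⟨ρ, h⟩)
  · intro h
    by_cases hr : IsRun n w (n + 1)
    · obtain ⟨ρ, h⟩ := h hr
      obtain ⟨ρ', h'⟩ := exists_parses_inner S h S.start_mem rfl hr (by lia) hw
      exact ⟨_, ρ', .inl ⟨rfl, h'⟩⟩
    · obtain ⟨ρ', h'⟩ := (exists_parses_coRun_iff S (by lia) hw).2 hr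
      exact ⟨_, ρ', .inr ⟨rfl, h'⟩⟩

theorem parses_coRun_subset {q : ℕ} {w : List Edge} {ρ : List (List (Symbol Edge RunNT))}
    (h : Parses (runRuleSet n E R I α₀) [.nonterminal (coRun q)] w ρ) : ∀ e ∈ w, e ∈ E := by
  induction w generalizing q ρ with
  | nil => simp
  | cons e w ih =>
    obtain ⟨ρ₁, -, he, -, h₁⟩ := parses_coRun_cons_iff.1 h
    exact List.forall_mem_cons.2 ⟨he, ih h₁⟩

theorem uniqueParses_runStart (S : RunSystem n E R I α₀) (hα : UniqueParses {r | r ∈ R} α₀) :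
    UniqueParses (runRuleSet n E R I α₀) [.nonterminal runStart] := by
  -- The two starting rules never compete: one derives only runs from `n` to `n + 1`, the other only
  -- words that are not such runs.
  have key : ∀ {w ρ ρ'}, Parses (runRuleSet n E R I α₀) [.nonterminal (inner n α₀ (n + 1))] w ρ →
      ¬ Parses (runRuleSet n E R I α₀) [.nonterminal (coRun n)] w ρ' := fun h h' =>
    (exists_parses_coRun_iff S (by lia) (parses_coRun_subset h')).1 ⟨_, h'⟩
      (parses_of_parses_inner _ (Nat.lt_succ_self _) h).1
  intro w ρ ρ' h h'
  obtain ⟨ρ₁, ⟨rfl, h₁⟩ | ⟨rfl, h₁⟩⟩ := parses_runStart_iff.1 h <;>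
    obtain ⟨ρ₂, ⟨rfl, h₂⟩ | ⟨rfl, h₂⟩⟩ := parses_runStart_iff.1 h'
  · rw [uniqueParses_inner _ (Nat.lt_succ_self _) h₁ h₂ (hα _ _ _
      (parses_of_parses_inner _ (Nat.lt_succ_self _) h₁).2.2
      (parses_of_parses_inner _ (Nat.lt_succ_self _) h₂).2.2)]
  · exact absurd h₂ (key h₁)
  · exact absurd h₁ (key h₂)
  · rw [uniqueParses_coRun _ _ _ _ h₁ h₂]

end InclusionProblems

namespace InclusionProblems

open ContextFreeGrammar StackProgram

/-! ## Renumbering the symbols of a grammar -/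

section Renumber

variable {T N : Type}

/-- The nonterminals that occur in a list of rules. -/
def nonterminals (rules : List (ContextFreeRule T N)) : List N :=
  rules.flatMap fun r => r.input :: r.output.flatMap fun x =>
    symbolElim x (fun _ => []) fun X => [X]

theorem nonterminals_spec {rules : List (ContextFreeRule T N)} {A : Set T}
    (h : ∀ r ∈ rules, ∀ a, Symbol.terminal a ∈ r.output → a ∈ A) :
    ∀ r ∈ {r | r ∈ rules}, r.input ∈ {X | X ∈ nonterminals rules} ∧
      SymbolsIn A {X | X ∈ nonterminals rules} r.output := by
  intro r hr
  refine ⟨List.mem_flatMap.2 ⟨r, hr, by simp⟩, h r hr, fun X hX => ?_⟩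
  refine List.mem_flatMap.2 ⟨r, hr, List.mem_cons_of_mem _ (List.mem_flatMap.2 ⟨_, hX, ?_⟩)⟩
  simp [symbolElim]

variable [DecidableEq T] [DecidableEq N]

/-- The index of an element in a list; elements that do not occur get the next free index. -/
def indexFin {α : Type} [DecidableEq α] (l : List α) (x : α) : Fin (l.length + 1) :=
  ⟨l.idxOf x, Nat.lt_succ_of_le List.idxOf_le_length⟩

theorem injOn_indexFin {α : Type} [DecidableEq α] (l : List α) :
    Set.InjOn (indexFin l) {x | x ∈ l} := fun _ hx _ _ h =>
  (List.idxOf_inj hx).1 (congrArg Fin.val h)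

/-- All absent elements receive the index `l.length`, so exactly one of them can be admitted as a
letter. The sink transition will play this role. -/
theorem injOn_indexFin_insert {α : Type} [DecidableEq α] {l : List α} {d : α} (hd : d ∉ l) :
    Set.InjOn (indexFin l) {x | x ∈ d :: l} := by
  intro x hx y hy h
  have h' : l.idxOf x = l.idxOf y := congrArg Fin.val h
  rcases List.mem_cons.1 hx with rfl | hx' <;> rcases List.mem_cons.1 hy with rfl | hy'
  · rfl
  · rw [List.idxOf_of_notMem hd] at h'
    exact absurd h'.symm (List.idxOf_lt_length_of_mem hy').ne
  · rw [List.idxOf_of_notMem hd] at h'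
    exact absurd h' (List.idxOf_lt_length_of_mem hx').ne
  · exact (List.idxOf_inj hx').1 h'

/-- Universality quantifies over all words of numbers, so each number must name a letter. The spare
index names `d`. -/
theorem exists_indexFin_eq {α : Type} [DecidableEq α] {l : List α} (hl : l.Nodup) {d : α}
    (hd : d ∉ l) (i : Fin (l.length + 1)) : ∃ x ∈ d :: l, indexFin l x = i := by
  rcases Nat.lt_or_ge i l.length with h | h
  · exact ⟨l[i.1], by simp, Fin.ext (hl.idxOf_getElem _ h)⟩
  · refine ⟨d, by simp, Fin.ext ?_⟩
    have := i.2
    change l.idxOf d = i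
    rw [List.idxOf_of_notMem hd]
    lia

/-- The finite presentation of a grammar that results from numbering its symbols. -/
def renumber (A : List T) (X : N) (rules : List (ContextFreeRule T N)) :
    FiniteCFG (A.length + 1) where
  numNT := (nonterminals rules).length + 1
  initial := indexFin (nonterminals rules) X
  rules := (rules.map (mapRule (indexFin A) (indexFin (nonterminals rules)))).dedup
  rules_nodup := List.nodup_dedup _

theorem renumber_rules (A : List T) (X : N) (rules : List (ContextFreeRule T N)) :
    {r | r ∈ (renumber A X rules).toCFG.rules} =
      mapRule (indexFin A) (indexFin (nonterminals rules)) '' {r | r ∈ rules} := by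
  ext r
  let e : ContextFreeRule (Fin (A.length + 1)) (Fin ((nonterminals rules).length + 1)) := r
  exact (List.mem_dedup (a := e)).trans List.mem_map

variable {A : List T} {d : T} {X : N} {rules : List (ContextFreeRule T N)}

theorem renumber_unambiguous (hd : d ∉ A) (hX : X ∈ nonterminals rules)
    (h : ∀ r ∈ rules, ∀ a, Symbol.terminal a ∈ r.output → a ∈ d :: A)
    (hu : UniqueParses {r | r ∈ rules} [.nonterminal X]) :
    (renumber A X rules).toCFG.Unambiguous := by
  rw [unambiguous_iff_uniqueParses, renumber_rules]
  exact hu.map (A := {x | x ∈ d :: A}) (injOn_indexFin_insert hd) (injOn_indexFin _)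
    (nonterminals_spec h) (s := [.nonterminal X]) ⟨by simp, by simpa using hX⟩

theorem renumber_universal_iff (hA : A.Nodup) (hd : d ∉ A) (hX : X ∈ nonterminals rules)
    (h : ∀ r ∈ rules, ∀ a, Symbol.terminal a ∈ r.output → a ∈ d :: A) :
    (∀ w, w ∈ (renumber A X rules).toCFG.language) ↔
      ∀ w : List T, (∀ a ∈ w, a ∈ d :: A) → ∃ ρ, Parses {r | r ∈ rules} [.nonterminal X] w ρ := by
  have key : ∀ w : List T, (∀ a ∈ w, a ∈ d :: A) →
      (w.map (indexFin A) ∈ (renumber A X rules).toCFG.language ↔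
        ∃ ρ, Parses {r | r ∈ rules} [.nonterminal X] w ρ) := by
    intro w hw
    rw [mem_language_iff_exists_parses, renumber_rules]
    exact exists_parses_map_iff (A := {x | x ∈ d :: A}) (injOn_indexFin_insert hd)
      (injOn_indexFin _) (nonterminals_spec h) (s := [.nonterminal X]) ⟨by simp, by simpa using hX⟩
      hw
  constructor
  · intro hw w hwA
    exact (key w hwA).1 (hw _)
  · intro hw w
    -- A section of the numbering turns an arbitrary word of numbers into a word of letters.
    choose f hf hf' using exists_indexFin_eq hA hd
    have h₁ : ∀ a ∈ w.map f, a ∈ d :: A := by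
      intro a ha
      obtain ⟨i, -, rfl⟩ := List.mem_map.1 ha
      exact hf i
    have h₂ := (key _ h₁).2 (hw _ h₁)
    rw [List.map_map, show indexFin A ∘ f = id from funext hf', List.map_id] at h₂
    exact h₂

end Renumber

/-! ## From inclusion to universality -/

/-- The transitions of an automaton with `n` states over the alphabet `{0, …, k - 1}`, and
transitions from a new initial state `n` with the label `k` and to a new final state `n + 1` with
the label `k + 1`. -/
def runEdges (k n : ℕ) (S F : List ℕ) (Δ : List Edge) : List Edge :=
  (S.map (fun s => (n, k, s)) ++ (Δ ++ F.map fun f => (f, k + 1, n + 1))).dedup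

/-- A transition that does not occur in any accepting run. -/
def sinkEdge (n : ℕ) : Edge := (n + 2, 0, n + 2)

/-- The starting nonterminal between the new labels. -/
def startForm (k X : ℕ) : List (Symbol ℕ ℕ) :=
  [.terminal k, .nonterminal X, .terminal (k + 1)]

/-- The suffixes of the right-hand sides. -/
def suffixes (k X : ℕ) (R : List (ContextFreeRule ℕ ℕ)) : List (List (Symbol ℕ ℕ)) :=
  (startForm k X :: R.map fun r => r.output).flatMap List.tails

/-- The rules of the grammar of runs of an automaton and a grammar. -/
def reductionRules (k n : ℕ) (S F : List ℕ) (Δ : List Edge) (X : ℕ)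
    (R : List (ContextFreeRule ℕ ℕ)) : List (ContextFreeRule Edge RunNT) :=
  runRules n (sinkEdge n :: runEdges k n S F Δ) R (suffixes k X R) (startForm k X)

section Numbers

variable {k n : ℕ} {S F : List ℕ} {Δ : List Edge} {X : ℕ} {R : List (ContextFreeRule ℕ ℕ)}

theorem mem_runEdges {e : Edge} : e ∈ runEdges k n S F Δ ↔
    (∃ s ∈ S, e = (n, k, s)) ∨ e ∈ Δ ∨ ∃ f ∈ F, e = (f, k + 1, n + 1) := by
  simp only [runEdges, List.mem_dedup, List.mem_append, List.mem_map, eq_comm]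

theorem sinkEdge_notMem (hΔ : ∀ e ∈ Δ, e.1 < n ∧ e.2.2 < n) :
    sinkEdge n ∉ runEdges k n S F Δ := by
  rw [mem_runEdges]
  rintro (⟨s, -, h⟩ | h | ⟨f, hf, h⟩)
  · simp [sinkEdge] at h
  · have := (hΔ _ h).1
    simp only [sinkEdge] at this
    lia
  · simp [sinkEdge] at h

theorem runSystem (hS : ∀ s ∈ S, s < n) (hF : ∀ f ∈ F, f < n)
    (hΔ : ∀ e ∈ Δ, e.1 < n ∧ e.2.2 < n) :
    RunSystem n (sinkEdge n :: runEdges k n S F Δ) R (suffixes k X R) (startForm k X) where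
  target_lt e he h := by
    rcases List.mem_cons.1 he with rfl | he
    · simp [sinkEdge] at h
    · rcases mem_runEdges.1 he with ⟨s, hs, rfl⟩ | he | ⟨f, hf, rfl⟩
      · have := hS s hs
        simp only
        lia
      · have := hΔ e he
        lia
      · simp
  target_sink e he h := by
    rcases List.mem_cons.1 he with rfl | he
    · rfl
    · rcases mem_runEdges.1 he with ⟨s, hs, rfl⟩ | he | ⟨f, hf, rfl⟩
      · simp at h
      · have := hΔ e he
        lia
      · have := hF f hf
        simp only at h
        lia
  start_mem := by simp [suffixes]
  output_mem r hr := by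
    refine List.mem_flatMap.2 ⟨r.output, ?_, by simp⟩
    exact List.mem_cons_of_mem _ (List.mem_map.2 ⟨r, hr, rfl⟩)
  tail_mem x β h := by
    obtain ⟨α, hα, h⟩ := List.mem_flatMap.1 h
    exact List.mem_flatMap.2 ⟨α, hα, by
      rw [List.mem_tails] at h ⊢
      exact (List.suffix_cons x β).trans h⟩

/-- The delimiters apply no rule, so the list `ρ` is unchanged and unambiguity carries over. -/
theorem parses_startForm_iff {w : List ℕ} {ρ : List (List (Symbol ℕ ℕ))} :
    Parses {r | r ∈ R} (startForm k X) w ρ ↔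
      ∃ v, w = k :: (v ++ [k + 1]) ∧ Parses {r | r ∈ R} [.nonterminal X] v ρ := by
  rw [startForm, parses_terminal_iff]
  constructor
  · rintro ⟨_, rfl, h⟩
    obtain ⟨α, w₁, w₂, ρ₁, ρ₂, rfl, rfl, hr, h₁, h₂⟩ := parses_nonterminal_iff.1 h
    obtain ⟨w₃, rfl, h₃⟩ := parses_terminal_iff.1 h₂
    obtain ⟨rfl, rfl⟩ := parses_nil_iff.1 h₃
    exact ⟨w₁, rfl, parses_singleton_iff.2 ⟨α, ρ₁, by simp, hr, h₁⟩⟩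
  · rintro ⟨v, rfl, h⟩
    obtain ⟨α, ρ', rfl, hr, h⟩ := parses_singleton_iff.1 h
    refine ⟨_, rfl, ?_⟩
    have := Parses.nonterminal X hr h (.terminal (k + 1) .nil)
    rwa [List.append_nil] at this

theorem uniqueParses_startForm (h : UniqueParses {r | r ∈ R} [.nonterminal X]) :
    UniqueParses {r | r ∈ R} (startForm k X) := by
  intro w ρ ρ' hρ hρ'
  obtain ⟨v, rfl, h₁⟩ := parses_startForm_iff.1 hρ
  obtain ⟨v', h₂, h₃⟩ := parses_startForm_iff.1 hρ'
  simp only [List.cons.injEq, List.append_cancel_right_eq, true_and] at h₂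
  subst h₂
  exact h _ _ _ h₁ h₃

/-- From an old state the new initial state and the sink are unreachable, and no transition leaves
`n + 1`. Such a run therefore uses old transitions up to its last letter. -/
theorem isRun_inner_iff (hF : ∀ f ∈ F, f < n) (hΔ : ∀ e ∈ Δ, e.1 < n ∧ e.2.2 < n) {p : ℕ}
    (hp : p < n) {w : List Edge} :
    ((∀ e ∈ w, e ∈ sinkEdge n :: runEdges k n S F Δ) ∧ IsRun p w (n + 1)) ↔
      ∃ u, ∃ f ∈ F, (∀ e ∈ u, e ∈ Δ) ∧ IsRun p u f ∧ w = u ++ [(f, k + 1, n + 1)] := by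
  induction w generalizing p with
  | nil =>
    simp [IsRun]
    lia
  | cons e w ih =>
    constructor
    · rintro ⟨hw, rfl, hr⟩
      obtain ⟨he, hw₁⟩ := List.forall_mem_cons.1 hw
      rcases List.mem_cons.1 he with rfl | he
      · simp [sinkEdge] at hp
      · rcases mem_runEdges.1 he with ⟨s, hs, rfl⟩ | he | ⟨f, hf, rfl⟩
        · simp at hp
        · obtain ⟨u, f, hf, hu, hr', rfl⟩ := (ih (hΔ e he).2).1 ⟨hw₁, hr⟩
          exact ⟨e :: u, f, hf, List.forall_mem_cons.2 ⟨he, hu⟩, ⟨rfl, hr'⟩, rfl⟩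
        · refine ⟨[], f, hf, by simp, rfl, ?_⟩
          -- Any further letter would have to be a transition from `n + 1`, and there is none.
          obtain _ | ⟨e', w⟩ := w
          · rfl
          · obtain ⟨h₁, -⟩ := hr
            obtain ⟨he₂, -⟩ := List.forall_mem_cons.1 hw₁
            simp only at h₁
            rcases List.mem_cons.1 he₂ with rfl | he₃
            · simp [sinkEdge] at h₁
            · rcases mem_runEdges.1 he₃ with ⟨s, hs, rfl⟩ | he₄ | ⟨f', hf', rfl⟩
              · simp at h₁
              · have := (hΔ _ he₄).1
                lia
              · have := hF f' hf'
                simp only at h₁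
                lia
    · rintro ⟨u, f, hf, hu, hr, h⟩
      rw [h]
      refine ⟨fun e he => ?_, isRun_append.2 ⟨f, hr, rfl, rfl⟩⟩
      rw [List.mem_cons, mem_runEdges]
      rcases List.mem_append.1 he with he | he
      · exact .inr (.inr (.inl (hu e he)))
      · exact .inr (.inr (.inr ⟨f, hf, by simpa using he⟩))

/-- Only the new initial transitions start in `n`; they enter old states, where `isRun_inner_iff`
applies. -/
theorem isRun_accepting_iff (hS : ∀ s ∈ S, s < n) (hF : ∀ f ∈ F, f < n)
    (hΔ : ∀ e ∈ Δ, e.1 < n ∧ e.2.2 < n) {w : List Edge} :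
    ((∀ e ∈ w, e ∈ sinkEdge n :: runEdges k n S F Δ) ∧ IsRun n w (n + 1)) ↔
      ∃ u, ∃ s ∈ S, ∃ f ∈ F, (∀ e ∈ u, e ∈ Δ) ∧ IsRun s u f ∧
        w = (n, k, s) :: (u ++ [(f, k + 1, n + 1)]) := by
  constructor
  · rintro ⟨hw, hr⟩
    obtain _ | ⟨e, w⟩ := w
    · simp [IsRun] at hr
    · obtain ⟨he, hw₁⟩ := List.forall_mem_cons.1 hw
      obtain ⟨h₁, hr₁⟩ := hr
      rcases List.mem_cons.1 he with rfl | he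
      · simp [sinkEdge] at h₁
      · rcases mem_runEdges.1 he with ⟨s, hs, rfl⟩ | he | ⟨f, hf, rfl⟩
        · obtain ⟨u, f, hf, hu, hr₂, rfl⟩ := (isRun_inner_iff hF hΔ (hS s hs)).1 ⟨hw₁, hr₁⟩
          exact ⟨u, s, hs, f, hf, hu, hr₂, rfl⟩
        · have := (hΔ _ he).1
          lia
        · have := hF f hf
          simp only at h₁
          lia
  · rintro ⟨u, s, hs, f, hf, hu, hr, rfl⟩
    obtain ⟨h₁, h₂⟩ := (isRun_inner_iff (k := k) (S := S) hF hΔ (hS s hs)).2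
      ⟨u, f, hf, hu, hr, rfl⟩
    refine ⟨List.forall_mem_cons.2 ⟨?_, h₁⟩, rfl, h₂⟩
    exact List.mem_cons_of_mem _ (mem_runEdges.2 (.inl ⟨s, hs, rfl⟩))

/-- Universality of the grammar of runs expresses the inclusion. -/
theorem reductionRules_universal_iff (hS : ∀ s ∈ S, s < n) (hF : ∀ f ∈ F, f < n)
    (hΔ : ∀ e ∈ Δ, e.1 < n ∧ e.2.2 < n) :
    (∀ w : List Edge, (∀ e ∈ w, e ∈ sinkEdge n :: runEdges k n S F Δ) →
      ∃ ρ, Parses {r | r ∈ reductionRules k n S F Δ X R} [.nonterminal runStart] w ρ) ↔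
    ∀ u : List Edge, (∀ e ∈ u, e ∈ Δ) → ∀ s ∈ S, ∀ f ∈ F, IsRun s u f →
      ∃ ρ, Parses {r | r ∈ R} [.nonterminal X] (u.map fun e => e.2.1) ρ := by
  have hsys := runSystem (k := k) (X := X) (R := R) hS hF hΔ
  constructor
  · intro h u hu s hs f hf hr
    obtain ⟨h₁, h₂⟩ := (isRun_accepting_iff (k := k) hS hF hΔ).2 ⟨u, s, hs, f, hf, hu, hr, rfl⟩
    obtain ⟨ρ, hρ⟩ := (exists_parses_runStart_iff hsys h₁).1 (h _ h₁) h₂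
    obtain ⟨v, hv, hρ⟩ := parses_startForm_iff.1 hρ
    refine ⟨ρ, ?_⟩
    have : (u.map fun e => e.2.1) = v := by simpa using hv
    rwa [this]
  · intro h w hw
    refine (exists_parses_runStart_iff hsys hw).2 fun hr => ?_
    obtain ⟨u, s, hs, f, hf, hu, hr', rfl⟩ := (isRun_accepting_iff hS hF hΔ).1 ⟨hw, hr⟩
    obtain ⟨ρ, hρ⟩ := h u hu s hs f hf hr'
    exact ⟨ρ, parses_startForm_iff.2 ⟨_, by simp, hρ⟩⟩

theorem runStart_mem_nonterminals : runStart ∈ nonterminals (reductionRules k n S F Δ X R) :=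
  List.mem_flatMap.2 ⟨⟨runStart, _⟩, start_mem_runRules.2 (.inl rfl), by simp⟩

theorem terminal_mem_reductionRules : ∀ r ∈ reductionRules k n S F Δ X R, ∀ e,
    Symbol.terminal e ∈ r.output → e ∈ sinkEdge n :: runEdges k n S F Δ := by
  intro r hr e he
  simp only [reductionRules, runRules, List.mem_append, List.mem_flatMap, List.mem_map,
    List.mem_range] at hr
  obtain ((h | ⟨p, -, rfl⟩) | ⟨α, -, h⟩) | ⟨q, -, h | ⟨e', he', rfl⟩⟩ := hr
  · simp only [List.mem_cons, List.not_mem_nil, or_false] at h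
    rcases h with rfl | rfl <;> simp at he
  · simp at he
  · obtain _ | ⟨a | Y, β⟩ := α
    · simp [listElim] at h
    · simp only [listElim, symbolElim, List.mem_flatMap] at h
      obtain ⟨e', he', h⟩ := h
      split_ifs at h
      · obtain ⟨q, -, rfl⟩ := List.mem_map.1 h
        simp only [List.mem_cons, Symbol.terminal.injEq, reduceCtorEq, List.not_mem_nil,
          or_false] at he
        rwa [he]
      · simp at h
    · simp only [listElim, symbolElim, List.mem_flatMap] at h
      obtain ⟨r', -, h⟩ := h
      split_ifs at h
      · simp only [List.mem_flatMap, List.mem_map] at h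
        obtain ⟨_, -, _, -, _, -, rfl⟩ := h
        simp at he
      · simp at h
  · split_ifs at h <;> simp at h
    subst h
    simp at he
  · simp only [List.mem_cons, Symbol.terminal.injEq, reduceCtorEq, List.not_mem_nil,
      or_false] at he
    rwa [he]

end Numbers

/-! ### Instances -/

/-- The productions of a grammar with symbols replaced by their numbers. -/
def FiniteCFG.numRules {k : ℕ} (G : FiniteCFG k) : List (ContextFreeRule ℕ ℕ) :=
  G.rules.map (mapRule Fin.val Fin.val)

/-- The transitions of an automaton with states and letters replaced by their numbers. -/
def FiniteNFA.numTrans {k : ℕ} (A : FiniteNFA k) : List Edge :=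
  A.trans.map fun t => (t.1.val, t.2.1.val, t.2.2.val)

theorem FiniteCFG.numRules_eq {k : ℕ} (G : FiniteCFG k) :
    {r | r ∈ G.numRules} = mapRule Fin.val Fin.val '' {r | r ∈ G.toCFG.rules} := by
  ext r
  change _ ↔ ∃ r', r' ∈ G.rules ∧ _
  simp [numRules]

theorem FiniteCFG.uniqueParses_numRules {k : ℕ} {G : FiniteCFG k} (h : G.toCFG.Unambiguous) :
    UniqueParses {r | r ∈ G.numRules} [.nonterminal G.initial.val] := by
  rw [unambiguous_iff_uniqueParses] at h
  rw [numRules_eq]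
  exact h.map (A := Set.univ) (B := Set.univ) Fin.val_injective.injOn Fin.val_injective.injOn
    (fun r _ => ⟨trivial, fun _ _ => trivial, fun _ _ => trivial⟩)
    ⟨fun _ _ => trivial, fun _ _ => trivial⟩

theorem FiniteCFG.mem_language_iff {k : ℕ} {G : FiniteCFG k} {w : List (Fin k)} :
    w ∈ G.toCFG.language ↔
      ∃ ρ, Parses {r | r ∈ G.numRules} [.nonterminal G.initial.val] (w.map Fin.val) ρ := by
  rw [mem_language_iff_exists_parses, numRules_eq]
  exact (exists_parses_map_iff (A := Set.univ) (B := Set.univ) (φ := Fin.val) (ψ := Fin.val)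
    Fin.val_injective.injOn Fin.val_injective.injOn
    (fun r _ => ⟨trivial, fun _ _ => trivial, fun _ _ => trivial⟩)
    (s := [.nonterminal G.toCFG.initial])
    ⟨fun _ _ => trivial, fun _ _ => trivial⟩ (fun _ _ => trivial)).symm

/-- Sets of reachable states are replaced by individual runs, the words over the new alphabet. -/
theorem FiniteNFA.mem_evalFrom_iff {k : ℕ} {A : FiniteNFA k} {x : List (Fin k)}
    {s t : Fin A.numStates} : t ∈ A.toNFA.evalFrom {s} x ↔
      ∃ u : List Edge, (∀ e ∈ u, e ∈ A.numTrans) ∧ IsRun s.val u t.val ∧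
        u.map (fun e => e.2.1) = x.map Fin.val := by
  induction x generalizing s with
  | nil =>
    simp only [NFA.evalFrom_nil, Set.mem_singleton_iff, List.map_nil, List.map_eq_nil_iff]
    constructor
    · rintro rfl
      exact ⟨[], by simp, rfl, rfl⟩
    · rintro ⟨u, -, h, rfl⟩
      exact (Fin.ext h).symm
  | cons a x ih =>
    rw [NFA.evalFrom_cons, NFA.stepSet_singleton, NFA.mem_evalFrom_iff_exists]
    constructor
    · rintro ⟨s', hs', h⟩
      obtain ⟨u, hu, hr, hx⟩ := ih.1 h
      refine ⟨(s.val, a.val, s'.val) :: u, List.forall_mem_cons.2 ⟨?_, hu⟩, ⟨rfl, hr⟩, by simp [hx]⟩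
      exact List.mem_map.2 ⟨(s, a, s'), hs', rfl⟩
    · rintro ⟨u, hu, hr, hx⟩
      obtain ⟨e, u, rfl, he, hx'⟩ := List.map_eq_cons_iff.1 hx
      obtain ⟨he', hu'⟩ := List.forall_mem_cons.1 hu
      obtain ⟨⟨p, b, s'⟩, hp, rfl⟩ := List.mem_map.1 he'
      obtain ⟨h₁, h₂⟩ := hr
      obtain rfl : p = s := Fin.ext h₁
      obtain rfl : b = a := Fin.ext he
      exact ⟨s', hp, ih.2 ⟨u, hu', h₂, hx'⟩⟩

/-- An accepted word labels at least one accepting run, and the condition on a run depends only on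
its labels. Quantifying over runs instead of words thus changes nothing. -/
theorem FiniteNFA.accepts_le_iff {k : ℕ} (A : FiniteNFA k) (G : FiniteCFG k) :
    A.toNFA.accepts ≤ G.toCFG.language ↔
      ∀ u : List Edge, (∀ e ∈ u, e ∈ A.numTrans) → ∀ s ∈ A.start.map Fin.val,
        ∀ f ∈ A.accept.map Fin.val, IsRun s u f →
        ∃ ρ, Parses {r | r ∈ G.numRules} [.nonterminal G.initial.val]
          (u.map fun e => e.2.1) ρ := by
  constructor
  · intro h u hu s hs f hf hr
    obtain ⟨s, hs', rfl⟩ := List.mem_map.1 hs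
    obtain ⟨f, hf', rfl⟩ := List.mem_map.1 hf
    have hx : ∃ x : List (Fin k), u.map (fun e => e.2.1) = x.map Fin.val := by
      have : ∀ a ∈ u.map (fun e => e.2.1), a < k := by
        intro a ha
        obtain ⟨e, he, rfl⟩ := List.mem_map.1 ha
        obtain ⟨t, -, rfl⟩ := List.mem_map.1 (hu e he)
        exact t.2.1.2
      lift u.map (fun e => e.2.1) to List (Fin k) using this with x
      exact ⟨x, rfl⟩
    obtain ⟨x, hx⟩ := hx
    rw [hx, ← FiniteCFG.mem_language_iff]
    refine h (NFA.mem_accepts.2 ⟨f, hf', ?_⟩)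
    exact (NFA.mem_evalFrom_iff_exists).2 ⟨s, hs', mem_evalFrom_iff.2 ⟨u, hu, hr, hx⟩⟩
  · intro h x hx
    obtain ⟨f, hf, hx₁⟩ := NFA.mem_accepts.1 hx
    obtain ⟨s, hs, hx₂⟩ := (NFA.mem_evalFrom_iff_exists).1 hx₁
    obtain ⟨u, hu, hr, hx₃⟩ := mem_evalFrom_iff.1 hx₂
    refine FiniteCFG.mem_language_iff.2 ?_
    rw [← hx₃]
    exact h u hu s (List.mem_map.2 ⟨s, hs, rfl⟩) f (List.mem_map.2 ⟨f, hf, rfl⟩) hr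

theorem FiniteNFA.numTrans_lt {k : ℕ} (A : FiniteNFA k) :
    ∀ e ∈ A.numTrans, e.1 < A.numStates ∧ e.2.2 < A.numStates := by
  intro e he
  obtain ⟨t, -, rfl⟩ := List.mem_map.1 he
  exact ⟨t.1.2, t.2.2.2⟩

theorem forall_mem_map_val_lt {m : ℕ} (l : List (Fin m)) : ∀ i ∈ l.map Fin.val, i < m := by
  intro i hi
  obtain ⟨j, -, rfl⟩ := List.mem_map.1 hi
  exact j.2

/-- The letters of the grammar of runs of an instance, up to the sink. -/
def NFAInUCFGInstance.letters (I : NFAInUCFGInstance) : List Edge :=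
  runEdges I.alphabetSize I.automaton.numStates (I.automaton.start.map Fin.val)
    (I.automaton.accept.map Fin.val) I.automaton.numTrans

/-- The rules of the grammar of runs of an instance. -/
def NFAInUCFGInstance.runGrammarRules (I : NFAInUCFGInstance) :
    List (ContextFreeRule Edge RunNT) :=
  reductionRules I.alphabetSize I.automaton.numStates (I.automaton.start.map Fin.val)
    (I.automaton.accept.map Fin.val) I.automaton.numTrans I.grammar.initial.val I.grammar.numRules

theorem NFAInUCFGInstance.sinkEdge_notMem_letters (I : NFAInUCFGInstance) :
    sinkEdge I.automaton.numStates ∉ I.letters :=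
  sinkEdge_notMem I.automaton.numTrans_lt

/-- The instance of the universality problem to which an instance of the inclusion problem is
mapped. -/
def NFAInUCFGInstance.toUUCFG (I : NFAInUCFGInstance) : UUCFGInstance where
  -- The additional letter is the sink transition, which lies on no accepting run.
  alphabetSize := I.letters.length + 1
  grammar := renumber I.letters runStart I.runGrammarRules
  unambiguous := renumber_unambiguous I.sinkEdge_notMem_letters runStart_mem_nonterminals
    terminal_mem_reductionRules (uniqueParses_runStart
      (runSystem (forall_mem_map_val_lt _) (forall_mem_map_val_lt _) I.automaton.numTrans_lt)
      (uniqueParses_startForm (FiniteCFG.uniqueParses_numRules I.unambiguous)))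

theorem NFAInUCFGInstance.yes_iff (I : NFAInUCFGInstance) :
    NFAInUCFG.Yes I ↔ UUCFG.Yes I.toUUCFG := by
  change I.automaton.toNFA.accepts ≤ I.grammar.toCFG.language ↔
    ∀ w, w ∈ (renumber I.letters runStart I.runGrammarRules).toCFG.language
  refine Iff.trans ?_ (renumber_universal_iff (A := I.letters) (rules := I.runGrammarRules)
    (List.nodup_dedup _) I.sinkEdge_notMem_letters
    runStart_mem_nonterminals terminal_mem_reductionRules).symm
  rw [FiniteNFA.accepts_le_iff]
  exact (reductionRules_universal_iff (forall_mem_map_val_lt _) (forall_mem_map_val_lt _)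
    I.automaton.numTrans_lt).symm

/-! ## From universality to inclusion -/

/-- The automaton with a single state that accepts all words. -/
def universalNFA (k : ℕ) : FiniteNFA k where
  numStates := 1
  start := [0]
  accept := [0]
  trans := (List.finRange k).map fun a => (0, a, 0)

theorem mem_accepts_universalNFA {k : ℕ} (w : List (Fin k)) :
    w ∈ (universalNFA k).toNFA.accepts := by
  have h : ∀ (w : List (Fin k)) (i : Fin (universalNFA k).numStates),
      i ∈ (universalNFA k).toNFA.evalFrom {i} w := by
    intro w i
    induction w with
    | nil => rfl
    | cons a w ih =>
      rw [NFA.evalFrom_cons, NFA.stepSet_singleton, NFA.mem_evalFrom_iff_exists]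
      refine ⟨i, List.mem_map.2 ⟨a, List.mem_finRange a, ?_⟩, ih⟩
      exact congrArg (fun i : Fin 1 => (i, a, i)) (Fin.fin_one_eq_zero i).symm
  have h₀ : ∃ i : Fin (universalNFA k).numStates, i = (0 : Fin 1) := ⟨_, rfl⟩
  obtain ⟨i, hi⟩ := h₀
  refine NFA.mem_accepts.2 ⟨i, List.mem_singleton.2 hi, ?_⟩
  exact NFA.mem_evalFrom_iff_exists.2 ⟨i, List.mem_singleton.2 hi, h w i⟩

/-- The instance of the inclusion problem to which an instance of the universality problem is
mapped. -/
def UUCFGInstance.toNFAInUCFG (I : UUCFGInstance) : NFAInUCFGInstance where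
  alphabetSize := I.alphabetSize
  automaton := universalNFA I.alphabetSize
  grammar := I.grammar
  unambiguous := I.unambiguous

theorem UUCFGInstance.yes_iff (I : UUCFGInstance) : UUCFG.Yes I ↔ NFAInUCFG.Yes I.toNFAInUCFG :=
  ⟨fun h w _ => h w, fun h w => h (mem_accepts_universalNFA w)⟩

end InclusionProblems

namespace InclusionProblems

open ContextFreeGrammar StackProgram

/-! ## Encoding and decoding in polynomial time -/

/-- A self-delimiting encoding that can be decoded in polynomial time. -/
def PolyTimeDecodable {α : Type} [ToTree α] (enc : α → List Bool) : Prop :=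
  ∃ p : List Bool → α × List Bool, PolyTime p ∧ (∀ l, (p l).2 <:+ l) ∧
    ∀ x l, p (enc x ++ l) = (x, l)

namespace PolyTimeDecodable

section List

variable {α : Type} {enc : α → List Bool}

/-- Decode one further element of a list if there is one. -/
def listStep (p : List Bool → α × List Bool) (t : List α × List Bool) : List α × List Bool :=
  listElim t.2 t fun b r => if b = true then (t.1 ++ [(p r).1], (p r).2) else t

theorem listStep_suffix {p : List Bool → α × List Bool} (hs : ∀ l, (p l).2 <:+ l)
    (t : List α × List Bool) : (listStep p t).2 <:+ t.2 := by
  obtain ⟨acc, _ | ⟨_ | _, r⟩⟩ := t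
  · exact List.suffix_refl _
  · exact List.suffix_refl _
  · exact (hs r).trans (List.suffix_cons _ _)

theorem length_le_encodeList (l : List α) : l.length ≤ (encodeList enc l).length := by
  induction l with
  | nil => simp
  | cons x l ih =>
    simp only [encodeList, List.length_cons, List.length_append]
    lia

/-- At the closing `false` further rounds are idle, so any fuel of at least the length of the list
gives the same result. -/
theorem foldl_listStep {p : List Bool → α × List Bool} (hc : ∀ x l, p (enc x ++ l) = (x, l))
    (l : List Bool) (fuel : List Bool) (xs acc : List α) (h : xs.length ≤ fuel.length) :
    fuel.foldl (fun t _ => listStep p t) (acc, encodeList enc xs ++ l) =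
      (acc ++ xs, false :: l) := by
  induction fuel generalizing xs acc with
  | nil =>
    obtain rfl := List.length_eq_zero_iff.1 (Nat.le_zero.1 h)
    simp [encodeList]
  | cons b fuel ih =>
    rw [List.foldl_cons]
    obtain _ | ⟨x, xs⟩ := xs
    · exact ih [] acc (by simp)
    · rw [show listStep p (acc, encodeList enc (x :: xs) ++ l) =
        (acc ++ [x], encodeList enc xs ++ l) by
        simp only [listStep, encodeList, listElim, List.cons_append, List.append_assoc, hc, if_true]]
      have := ih xs (acc ++ [x]) (by simpa using h)
      rwa [← List.append_cons] at this

end List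

variable {α β : Type} [ToTree α] [ToTree β] {enc : α → List Bool} {enc' : β → List Bool}

theorem map (h : PolyTimeDecodable enc) {f : α → β} {g : β → α} (hf : PolyTime f)
    (hg : ∀ y, f (g y) = y) (henc : ∀ y, enc' y = enc (g y)) : PolyTimeDecodable enc' := by
  obtain ⟨p, hp, hs, hc⟩ := h
  refine ⟨fun l => (f (p l).1, (p l).2), by fun_prop, hs, fun y l => ?_⟩
  simp only [henc, hc, hg]

theorem pair (h : PolyTimeDecodable enc) (h' : PolyTimeDecodable enc') :
    PolyTimeDecodable fun x : α × β => enc x.1 ++ enc' x.2 := by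
  obtain ⟨p, hp, hs, hc⟩ := h
  obtain ⟨p', hp', hs', hc'⟩ := h'
  refine ⟨fun l => (((p l).1, (p' (p l).2).1), (p' (p l).2).2), by fun_prop,
    fun l => (hs' _).trans (hs l), fun x l => ?_⟩
  simp only [List.append_assoc, hc, hc']

theorem unit : PolyTimeDecodable fun _ : Unit => [] :=
  ⟨fun l => ((), l), by fun_prop, fun l => List.suffix_refl l, fun _ _ => rfl⟩

theorem bool : PolyTimeDecodable fun b : Bool => [b] :=
  ⟨fun l => (listElim l false fun b _ => b, l.tail), by fun_prop, fun l => List.tail_suffix l,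
    fun _ _ => rfl⟩

theorem tsize_le_of_suffix {l l' : List α} (h : l <:+ l') : tsize l ≤ tsize l' := by
  obtain ⟨u, rfl⟩ := h
  have h₁ := tsize_append u l
  have h₂ := tsize_pos u
  lia

theorem list (h : PolyTimeDecodable enc) : PolyTimeDecodable (encodeList enc) := by
  obtain ⟨p, hp, hs, hc⟩ := h
  -- The word itself is the fuel, as it is at least as long as the list it encodes; the final tail
  -- removes the closing `false`.
  refine ⟨fun l => ((l.foldl (fun t _ => listStep p t) ([], l)).1,
    (l.foldl (fun t _ => listStep p t) ([], l)).2.tail), ?_, fun l => ?_, fun xs l => ?_⟩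
  · have : PolyTime fun l : List Bool => l.foldl (fun t _ => listStep p t) ([], l) := by
      obtain ⟨q, hq⟩ := hp.size
      refine PolyTime.foldl_of_invariant (step := fun _ t _ => listStep p t)
        -- The bound must hold for malformed words too. Since a decoder always returns a suffix, the
        -- rest never outgrows the input and each decoded element has polynomial size.
        (fun l t => t.2 <:+ l) (by fun_prop) (by fun_prop) (by unfold listStep; fun_prop)
        (fun l => List.suffix_refl l) (fun l t ht _ _ => (listStep_suffix hs t).trans ht)
        ⟨q + 1, fun l t ht b _ => ?_⟩
      have h₁ : tsize t.2 ≤ tsize (l, b) := by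
        have := tsize_le_of_suffix ht
        rw [tsize_pair]
        lia
      obtain ⟨acc, _ | ⟨_ | _, r⟩⟩ := t
      · exact Nat.le_add_right _ _
      · exact Nat.le_add_right _ _
      · have h₂ := tsize_le_of_suffix (hs r)
        have h₃ := (tsize_pair _ _).symm.trans_le ((hq r).trans (eval_mono q ((tsize_le_of_suffix
          (List.suffix_cons true r)).trans h₁)))
        have h₄ := tsize_append acc [(p r).1]
        generalize tsize (l, b) = m at h₃ ⊢
        simp only [listStep, listElim, if_true, tsize_pair, tsize_cons, tsize_nil,
          Polynomial.eval_add, Polynomial.eval_one] at h₄ ⊢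
        lia
    fun_prop
  · refine (List.tail_suffix _).trans ?_
    have : ∀ (fuel : List Bool) (t : List α × List Bool),
        (fuel.foldl (fun t _ => listStep p t) t).2 <:+ t.2 := by
      intro fuel
      induction fuel with
      | nil => exact fun t => List.suffix_refl _
      | cons b fuel ih => exact fun t => (ih _).trans (listStep_suffix hs t)
    exact this l _
  · have h₁ := foldl_listStep hc l (encodeList enc xs ++ l) xs [] (by
      have := length_le_encodeList (enc := enc) xs
      rw [List.length_append]
      lia)
    simp [h₁]

/-- A unary number is an encoded list of units, each with the empty code. -/
theorem nat : PolyTimeDecodable encodeNat := by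
  refine unit.list.map (f := List.length) (g := fun n => List.replicate n ()) (by fun_prop)
    (by simp) fun n => ?_
  induction n with
  | zero => rfl
  | succ n ih =>
    rw [List.replicate_succ, encodeList, ← ih]
    rfl

end PolyTimeDecodable

@[fun_prop]
theorem polyTime_encodeNat {α : Type} [ToTree α] {f : α → ℕ} (hf : PolyTime f) :
    PolyTime fun x => encodeNat (f x) := by
  unfold encodeNat
  fun_prop

theorem polyTime_encodeList {α β : Type} [ToTree α] [ToTree β] {enc : β → List Bool}
    {f : α → List β} (henc : PolyTime enc) (hf : PolyTime f) :
    PolyTime fun x => encodeList enc (f x) := by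
  have h : ∀ l, encodeList enc l = (l.flatMap fun x => true :: enc x) ++ [false] := by
    intro l
    induction l with
    | nil => rfl
    | cons x l ih => simp [encodeList, ih]
  simp only [h]
  fun_prop

theorem encodeList_map {α β : Type*} {enc : α → List Bool} {enc' : β → List Bool} {f : α → β}
    (h : ∀ x, enc x = enc' (f x)) (l : List α) : encodeList enc l = encodeList enc' (l.map f) := by
  induction l with
  | nil => rfl
  | cons x l ih => simp only [encodeList, List.map_cons, h, ih]

/-! ### Instances as lists of numbers -/

/-- Encoding of a triple of numbers. -/
def encodeEdge (e : Edge) : List Bool :=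
  encodeNat e.1 ++ (encodeNat e.2.1 ++ encodeNat e.2.2)

/-- Encoding of a symbol that is given by a number. -/
def encodeNumSymbol (s : Symbol ℕ ℕ) : List Bool :=
  symbolElim s (fun a => true :: encodeNat a) fun X => false :: encodeNat X

/-- Encoding of a production of a grammar whose symbols are numbers. -/
def encodeNumRule (r : ContextFreeRule ℕ ℕ) : List Bool :=
  encodeNat r.input ++ encodeList encodeNumSymbol r.output

/-- Automata whose states and letters are numbers. -/
abbrev NumNFA := ℕ × List ℕ × List ℕ × List Edge

/-- Grammars whose symbols are numbers. -/
abbrev NumCFG := ℕ × ℕ × List (ContextFreeRule ℕ ℕ)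

/-- Encoding of an automaton whose states and letters are numbers. -/
def encodeNumNFA (A : NumNFA) : List Bool :=
  encodeNat A.1 ++ (encodeList encodeNat A.2.1 ++
    (encodeList encodeNat A.2.2.1 ++ encodeList encodeEdge A.2.2.2))

/-- Encoding of a grammar whose symbols are numbers. -/
def encodeNumCFG (G : NumCFG) : List Bool :=
  encodeNat G.1 ++ (encodeNat G.2.1 ++ encodeList encodeNumRule G.2.2)

/-- Forget that the states and letters of an automaton are bounded. -/
def FiniteNFA.num {k : ℕ} (A : FiniteNFA k) : NumNFA :=
  (A.numStates, A.start.map Fin.val, A.accept.map Fin.val, A.numTrans)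

/-- Forget that the symbols of a grammar are bounded. -/
def FiniteCFG.num {k : ℕ} (G : FiniteCFG k) : NumCFG :=
  (G.numNT, G.initial.val, G.numRules)

/-- A bounded index is encoded like its value. Computations can therefore be carried out on plain
numbers, away from types that depend on the instance. -/
theorem FiniteNFA.encode_eq {k : ℕ} (A : FiniteNFA k) : A.encode = encodeNumNFA A.num := by
  simp only [encode, encodeNumNFA, num, numTrans]
  rw [encodeList_map (enc := encodeFin) (enc' := encodeNat) (f := Fin.val) fun _ => rfl,
    encodeList_map (enc := encodeFin) (enc' := encodeNat) (f := Fin.val) fun _ => rfl,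
    encodeList_map (enc := encodeTransition) (enc' := encodeEdge)
      (f := fun t => (t.1.val, t.2.1.val, t.2.2.val)) fun _ => rfl]

theorem encodeRule_eq {k n : ℕ} (r : ContextFreeRule (Fin k) (Fin n)) :
    encodeRule r = encodeNumRule (mapRule Fin.val Fin.val r) := by
  refine congrArg (encodeNat r.input ++ ·) (encodeList_map (f := mapSymbol Fin.val Fin.val) ?_ _)
  rintro (a | X) <;> rfl

theorem FiniteCFG.encode_eq {k : ℕ} (G : FiniteCFG k) : G.encode = encodeNumCFG G.num := by
  simp only [encode, encodeNumCFG, num, numRules]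
  rw [encodeList_map encodeRule_eq]
  rfl

theorem decodable_encodeNumNFA : PolyTimeDecodable encodeNumNFA :=
  have hn := PolyTimeDecodable.nat
  hn.pair (hn.list.pair (hn.list.pair (hn.pair (hn.pair hn)).list))

theorem decodable_encodeNumCFG : PolyTimeDecodable encodeNumCFG := by
  have hn := PolyTimeDecodable.nat
  have hs : PolyTimeDecodable encodeNumSymbol := by
    refine (PolyTimeDecodable.bool.pair hn).map
      (f := fun y => if y.1 = true then .terminal y.2 else .nonterminal y.2)
      (g := fun s => symbolElim s (fun a => (true, a)) fun X => (false, X)) (by fun_prop) ?_ ?_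
    · rintro (_ | _) <;> rfl
    · rintro (_ | _) <;> rfl
  have hr : PolyTimeDecodable encodeNumRule :=
    (hn.pair hs.list).map (f := fun y => ⟨y.1, y.2⟩) (g := fun r => (r.input, r.output))
      (by fun_prop) (fun _ => rfl) fun _ => rfl
  exact hn.pair (hn.pair hr.list)

theorem polyTime_encodeNumNFA : PolyTime encodeNumNFA := by
  have hn : PolyTime encodeNat := by fun_prop
  have he : PolyTime encodeEdge := by unfold encodeEdge; fun_prop
  unfold encodeNumNFA
  exact (polyTime_encodeNat PolyTime.fst).append ((polyTime_encodeList hn (by fun_prop)).append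
    ((polyTime_encodeList hn (by fun_prop)).append (polyTime_encodeList he (by fun_prop))))

theorem polyTime_encodeNumCFG : PolyTime encodeNumCFG := by
  have hs : PolyTime encodeNumSymbol := by unfold encodeNumSymbol; fun_prop
  have hr : PolyTime encodeNumRule := by
    unfold encodeNumRule
    exact (by fun_prop : PolyTime _).append (polyTime_encodeList hs (by fun_prop))
  unfold encodeNumCFG
  exact (polyTime_encodeNat PolyTime.fst).append ((by fun_prop : PolyTime _).append
    (polyTime_encodeList hr (by fun_prop)))

end InclusionProblems

namespace InclusionProblems

open ContextFreeGrammar StackProgram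

/-! ## The reductions are computable in polynomial time -/

theorem mapSymbol_injective {T T' N N' : Type} {φ : T → T'} {ψ : N → N'}
    (hφ : Function.Injective φ) (hψ : Function.Injective ψ) :
    Function.Injective (mapSymbol φ ψ) := by
  rintro (a | X) (b | Y) h <;> simp_all [mapSymbol, hφ.eq_iff, hψ.eq_iff]

theorem mapRule_injective {T T' N N' : Type} {φ : T → T'} {ψ : N → N'}
    (hφ : Function.Injective φ) (hψ : Function.Injective ψ) : Function.Injective (mapRule φ ψ) := by
  rintro ⟨X, s⟩ ⟨Y, s'⟩ h
  simp only [mapRule, ContextFreeRule.mk.injEq] at h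
  rw [hψ h.1, List.map_injective_iff.2 (mapSymbol_injective hφ hψ) h.2]

section Renumber

variable {T N : Type} [DecidableEq T] [DecidableEq N]

/-- The grammar with numbered symbols, as a grammar whose symbols are numbers. -/
def numRenumber (A : List T) (X : N) (rules : List (ContextFreeRule T N)) : NumCFG :=
  ((nonterminals rules).length + 1, (nonterminals rules).idxOf X,
    (rules.map fun r => ⟨(nonterminals rules).idxOf r.input, r.output.map fun s =>
      symbolElim s (fun a => .terminal (A.idxOf a))
        fun X => .nonterminal ((nonterminals rules).idxOf X)⟩).dedup)

/-- Forgetting the bounds is injective and so commutes with removing duplicates, which can then be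
done on numbers. -/
theorem num_renumber (A : List T) (X : N) (rules : List (ContextFreeRule T N)) :
    (renumber A X rules).num = numRenumber A X rules := by
  refine Prod.ext rfl (Prod.ext rfl ?_)
  simp only [FiniteCFG.num, FiniteCFG.numRules, renumber, numRenumber]
  rw [← List.dedup_map_of_injective (mapRule_injective Fin.val_injective Fin.val_injective),
    List.map_map]
  congr 2
  funext r
  simp only [Function.comp_apply, mapRule, List.map_map]
  congr 2
  funext s
  cases s <;> rfl

end Renumber

section Rules

variable {α : Type} [ToTree α]

@[fun_prop]
theorem polyTime_runEdges {k n : α → ℕ} {S F : α → List ℕ} {Δ : α → List Edge} (hk : PolyTime k)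
    (hn : PolyTime n) (hS : PolyTime S) (hF : PolyTime F) (hΔ : PolyTime Δ) :
    PolyTime fun x => runEdges (k x) (n x) (S x) (F x) (Δ x) := by
  unfold runEdges
  fun_prop

@[fun_prop]
theorem polyTime_suffixes {k X : α → ℕ} {R : α → List (ContextFreeRule ℕ ℕ)} (hk : PolyTime k)
    (hX : PolyTime X) (hR : PolyTime R) : PolyTime fun x => suffixes (k x) (X x) (R x) := by
  unfold suffixes startForm
  fun_prop

@[fun_prop]
-- The nested loops run over given lists and over ranges bounded by the unary number `n`, with three
-- nested ranges at most; this is where short right-hand sides pay off.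
theorem polyTime_runRules {n : α → ℕ} {E : α → List Edge} {R : α → List (ContextFreeRule ℕ ℕ)}
    {I : α → List (List (Symbol ℕ ℕ))} {α₀ : α → List (Symbol ℕ ℕ)} (hn : PolyTime n)
    (hE : PolyTime E) (hR : PolyTime R) (hI : PolyTime I) (hα₀ : PolyTime α₀) :
    PolyTime fun x => runRules (n x) (E x) (R x) (I x) (α₀ x) := by
  unfold runRules inner coRun
  refine ((PolyTime.append ?_ ?_).append ?_).append ?_
  · fun_prop
  · fun_prop
  · fun_prop
  · fun_prop

@[fun_prop]
theorem polyTime_reductionRules {k n X : α → ℕ} {S F : α → List ℕ} {Δ : α → List Edge}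
    {R : α → List (ContextFreeRule ℕ ℕ)} (hk : PolyTime k) (hn : PolyTime n) (hS : PolyTime S)
    (hF : PolyTime F) (hΔ : PolyTime Δ) (hX : PolyTime X) (hR : PolyTime R) :
    PolyTime fun x => reductionRules (k x) (n x) (S x) (F x) (Δ x) (X x) (R x) := by
  unfold reductionRules startForm sinkEdge
  fun_prop

variable {T N : Type} [ToTree T] [ToTree N]

@[fun_prop]
theorem polyTime_nonterminals {R : α → List (ContextFreeRule T N)} (hR : PolyTime R) :
    PolyTime fun x => nonterminals (R x) := by
  unfold nonterminals
  fun_prop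

variable [DecidableEq T] [DecidableEq N]

@[fun_prop]
theorem polyTime_numRenumber [PolyTimeEq T] [PolyTimeEq N] {A : α → List T} {X : α → N}
    {rules : α → List (ContextFreeRule T N)} (hA : PolyTime A) (hX : PolyTime X)
    (hr : PolyTime rules) : PolyTime fun x => numRenumber (A x) (X x) (rules x) := by
  unfold numRenumber
  fun_prop

end Rules

/-- Decode, apply `g`, encode again. The unambiguity proof in an instance has no code, so it plays
no part in the computation. -/
theorem computable_of_polyTime {α β I J : Type} [ToTree α] [ToTree β] {enc : α → List Bool}
    {enc' : β → List Bool} (henc : PolyTimeDecodable enc) (henc' : PolyTime enc') {g : α → β}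
    (hg : PolyTime g) {ea : I → List Bool} {eb : J → List Bool} {f : I → J} {a : I → α}
    (ha : ∀ i, ea i = enc (a i)) (hf : ∀ i, eb (f i) = enc' (g (a i))) :
    Nonempty (Turing.TM2ComputableInPolyTime ea eb f) := by
  obtain ⟨p, hp, -, hc⟩ := henc
  refine PolyTime.computableInPolyTime (F := fun l => enc' (g (p l).1)) (by fun_prop) fun i => ?_
  have h := hc (a i) []
  rw [List.append_nil] at h
  simp only [ha, h, hf]

theorem computable_toUUCFG : Nonempty (Turing.TM2ComputableInPolyTime NFAInUCFGInstance.encode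
    UUCFGInstance.encode NFAInUCFGInstance.toUUCFG) := by
  refine computable_of_polyTime (α := ℕ × NumNFA × NumCFG) (β := ℕ × NumCFG)
    (PolyTimeDecodable.nat.pair (decodable_encodeNumNFA.pair decodable_encodeNumCFG))
    ((polyTime_encodeNat PolyTime.fst).append (polyTime_encodeNumCFG.comp PolyTime.snd))
    (g := fun x =>
      ((runEdges x.1 x.2.1.1 x.2.1.2.1 x.2.1.2.2.1 x.2.1.2.2.2).length + 1,
        numRenumber (runEdges x.1 x.2.1.1 x.2.1.2.1 x.2.1.2.2.1 x.2.1.2.2.2) runStart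
          (reductionRules x.1 x.2.1.1 x.2.1.2.1 x.2.1.2.2.1 x.2.1.2.2.2 x.2.2.2.1 x.2.2.2.2)))
    ?_ (a := fun I => (I.alphabetSize, I.automaton.num, I.grammar.num)) (fun I => ?_) fun I => ?_
  · fun_prop
  · simp only [NFAInUCFGInstance.encode, FiniteNFA.encode_eq, FiniteCFG.encode_eq]
  · rw [UUCFGInstance.encode, FiniteCFG.encode_eq]
    exact congrArg (encodeNat _ ++ encodeNumCFG ·) (num_renumber _ _ _)

theorem num_universalNFA (k : ℕ) :
    (universalNFA k).num = (1, [0], [0], (List.range k).map fun a => (0, a, 0)) := by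
  refine Prod.ext rfl (Prod.ext rfl (Prod.ext rfl ?_))
  simp only [FiniteNFA.num, FiniteNFA.numTrans, universalNFA, List.map_map]
  rw [← List.map_coe_finRange_eq_range, List.map_map]
  rfl

theorem computable_toNFAInUCFG : Nonempty (Turing.TM2ComputableInPolyTime UUCFGInstance.encode
    NFAInUCFGInstance.encode UUCFGInstance.toNFAInUCFG) := by
  refine computable_of_polyTime (α := ℕ × NumCFG) (β := ℕ × NumNFA × NumCFG)
    (PolyTimeDecodable.nat.pair decodable_encodeNumCFG)
    ((polyTime_encodeNat PolyTime.fst).append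
      ((polyTime_encodeNumNFA.comp (PolyTime.fst.comp PolyTime.snd)).append
        (polyTime_encodeNumCFG.comp (PolyTime.snd.comp PolyTime.snd))))
    (g := fun x => (x.1, (1, [0], [0], (List.range x.1).map fun a => (0, a, 0)), x.2))
    (by fun_prop) (a := fun I => (I.alphabetSize, I.grammar.num)) (fun I => ?_) fun I => ?_
  · simp only [UUCFGInstance.encode, FiniteCFG.encode_eq]
  · rw [NFAInUCFGInstance.encode, FiniteNFA.encode_eq, FiniteCFG.encode_eq]
    exact congrArg (fun A => encodeNat _ ++ (encodeNumNFA A ++ _)) (num_universalNFA _)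

end InclusionProblems

theorem mainTheorem5 :
    InclusionProblems.PolyTimeInterreducible
      InclusionProblems.NFAInUCFG InclusionProblems.UUCFG :=
  ⟨⟨InclusionProblems.NFAInUCFGInstance.toUUCFG, InclusionProblems.computable_toUUCFG,
    InclusionProblems.NFAInUCFGInstance.yes_iff⟩,
    ⟨InclusionProblems.UUCFGInstance.toNFAInUCFG, InclusionProblems.computable_toNFAInUCFG,
      InclusionProblems.UUCFGInstance.yes_iff⟩⟩
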